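/- **Definitions.** For $\delta\in[0,1]$ and real $m$, a vector $v\in\mathbb R^n$ is $(m,\delta)$-spread if $\|v_S\|_2\le\delta\|v\|_2$ for every $S\subseteq[n]$ with $|S|\le m$, where $v_S$ is the restriction of $v$ to the coordinates in $S$; a matrix $A\in\mathbb R^{n\times d}$ is $(m,\delta)$-spread if every vector of its column span is. For $\rho\in(0,1)$ and $\sigma\in[0,1/\sqrt{1-\rho})$, the noisy Bernoulli–Rademacher distribution $\mathrm{nBR}(\rho,\sigma)$ on $\mathbb R$ is $N(0,\sigma^2)$ with probability $1-\rho$ and $\pm 1/\sqrt{\rho'}$ with probability $\rho/2$ each, where $\rho'=\rho/(1-(1-\rho)\sigma^2)$. The null distribution $\nu=\nu_{n,d}$ is the law of an $n\times d$ matrix with independent $N(0,1)$ entries. The planted distribution $\mu=\mu_{n,d,\rho,\sigma}$ is the law of $YQ$, where $Y$ is an $n\times d$ matrix with independent entries, those of the first column distributed as $\mathrm{nBR}(\rho,\sigma)$ and the others as $N(0,1)$, and $Q$ is an independent Haar-distributed orthogonal $d\times d$ matrix. The degree-$D$ likelihood ratio $L^{\le D}$ of $\mu$ with respect to $\nu$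 is the polynomial of degree at most $D$ in the $nd$ matrix entries with $\mathbb E_\nu[L^{\le D}p]=\mathbb E_\mu[p]$ for every polynomial $p$ of degree at most $D$; if $\mu\ll\nu$ and $d\mu/d\nu\in L^2(\nu)$, this is the $L^2(\nu)$-orthogonal projection of $d\mu/d\nu$ onto the polynomials of degree at most $D$. Limits are as $n\to\infty$; "with high probability" means with probability tending to $1$; "eventually" means for all sufficiently large $n$. **Theorem.** (A) There are absolute constants $c_1,c_2,c_3\in(0,1)$, $C_4>1$ and $K$ such that the following holds for every constant $C>1$. Let $\delta\in(c_2,1)$ be a constant and let $\rho,\sigma,d,m,D$ depend on $n$ in such a way that $\rho n\to\infty$ and, eventually, $\rho\in(0,1)$, $0\le\sigma<1/\sqrt{1-\rho}$, $\sigma^2\le\frac12(\log n)^{-C}$, $$C_4\,\rho^{-1}\sqrt n\,(\log n)^{2C}\le d\le c_3n,\qquad 1.5\rho n<m<c_1n,\qquad D\le(\log n)^C,$$ where $d,D$ are natural numbers and $m$ is real. Then 1. $A\sim\nu$ is $(m,\delta)$-spread with high probability; 2. $A\sim\mu$ is not $(m,\delta)$-spread with high probability; 3. eventually, $L^{\le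 D}$ exists and $\mathbb E_\nu[L^{\le D}(A)^2]\le K$. (B) Consequently, there are absolute constants $\delta_0\in(0,1)$ and $K$ such that for every $C>1$ there is $q>0$ with the following property. Let $B$ be a constant and let $\alpha\in(0,1)$ and $d,t\in\mathbb N$ depend on $n$ so that, eventually, $$\frac d{\alpha^2}\le\frac n{(\log n)^q},\qquad n\le\frac{(d/\alpha)^{4/3}}{(\log n)^q},\qquad t\le B(\log n)^C.$$ Then there are probability distributions $\mathcal D_1=\mathcal D_1(n)$ on $\mathbb R^{n\times d}$ such that, with $\mathcal D_0=\nu_{n,d}$: 1. for every constant $\kappa>0$, $X\sim\mathcal D_0$ is $(\kappa d/\alpha^2,\delta_0)$-spread with high probability; 2. for all constants $\kappa>0$ and $\delta\in(0,1)$, $X\sim\mathcal D_1$ is not $(\kappa d/\alpha^2,\delta)$-spread with high probability; 3. eventually, every polynomial $p:\mathbb R^{n\times d}\to\mathbb R$ of degree at most $t$ is $\mathcal D_1$-integrable and satisfies $\mathbb E_{\mathcal D_0}p(X)-\mathbb E_{\mathcal D_1}p(X)\le K\sqrt{\operatorname{Var}_{\mathcal D_0}p(X)}$. -/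

import Mathlib

open MeasureTheory ProbabilityTheory Filter Topology

/-! ### Well-spreadness -/

/-- `v ∈ ℝⁿ` is `(m, δ)`-spread (in `ℓ₂`): `‖v_S‖₂ ≤ δ ‖v‖₂` for every `S` with `|S| ≤ m`. -/
def VectorSpread {n : ℕ} (m δ : ℝ) (v : Fin n → ℝ) : Prop :=
  ∀ S : Finset (Fin n), (S.card : ℝ) ≤ m →
    Real.sqrt (∑ i ∈ S, v i ^ 2) ≤ δ * Real.sqrt (∑ i, v i ^ 2)

/-- A subspace of `ℝⁿ` is `(m, δ)`-spread if all its vectors are. -/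
def SubspaceSpread {n : ℕ} (m δ : ℝ) (V : Submodule ℝ (Fin n → ℝ)) : Prop :=
  ∀ v ∈ V, VectorSpread m δ v

/-- An `n × d` matrix is `(m, δ)`-spread if its column span is. -/
def MatrixSpread {n d : ℕ} (m δ : ℝ) (A : Fin n → Fin d → ℝ) : Prop :=
  SubspaceSpread m δ (Submodule.span ℝ (Set.range fun (j : Fin d) (i : Fin n) => A i j))

/-! ### The null and planted distributions on `n × d` matrices -/

/-- The noisy Bernoulli–Rademacher distribution: `N(0, σ²)` with probability `1 - ρ` and
`± 1 / √ρ'` with probability `ρ / 2` each, where `ρ' = ρ / (1 - (1 - ρ) σ²)`. -/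
noncomputable def noisyBernoulliRademacher (ρ σ : ℝ) : Measure ℝ :=
  ENNReal.ofReal (1 - ρ) • gaussianReal 0 (σ ^ 2).toNNReal
    + ENNReal.ofReal (ρ / 2) • Measure.dirac (1 / Real.sqrt (ρ / (1 - (1 - ρ) * σ ^ 2)))
    + ENNReal.ofReal (ρ / 2) • Measure.dirac (-(1 / Real.sqrt (ρ / (1 - (1 - ρ) * σ ^ 2))))

/-- The null distribution: independent standard Gaussian entries. -/
noncomputable def nullMeasure (n d : ℕ) : Measure (Fin n → Fin d → ℝ) :=
  Measure.pi fun _ => Measure.pi fun _ => gaussianReal 0 1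

/-- The law of `Y`: independent entries, noisy Bernoulli–Rademacher in the first column and
standard Gaussian in all the others. -/
noncomputable def hiddenMeasure (n d : ℕ) (ρ σ : ℝ) : Measure (Fin n → Fin d → ℝ) :=
  Measure.pi fun _ => Measure.pi fun j : Fin d =>
    if (j : ℕ) = 0 then noisyBernoulliRademacher ρ σ else gaussianReal 0 1

instance orthogonalGroupCompact (d : ℕ) :
    CompactSpace (Matrix.orthogonalGroup (Fin d) ℝ) := by
  rw [← isCompact_univ_iff, Subtype.isCompact_iff, Set.image_univ, Subtype.range_coe]
  refine IsCompact.of_isClosed_subset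
    (isCompact_univ_pi fun _ : Fin d => isCompact_univ_pi fun _ : Fin d =>
      isCompact_closedBall (0 : ℝ) 1)
    (isClosed_unitary (R := Matrix (Fin d) (Fin d) ℝ)) ?_
  intro U hU i _ j _
  rw [mem_closedBall_zero_iff]
  exact entry_norm_bound_of_unitary hU i j

/-- The law of a uniformly random orthogonal matrix: the Haar probability measure of the
orthogonal group `O(d)`, regarded as a measure on all `d × d` matrices. -/
noncomputable def haarOrthogonal (d : ℕ) : Measure (Fin d → Fin d → ℝ) :=
  letI : MeasurableSpace (Matrix.orthogonalGroup (Fin d) ℝ) := borel _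
  haveI : BorelSpace (Matrix.orthogonalGroup (Fin d) ℝ) := ⟨rfl⟩
  Measure.map (fun (Q : Matrix.orthogonalGroup (Fin d) ℝ) (i j : Fin d) =>
      (Q : Matrix (Fin d) (Fin d) ℝ) i j)
    (Measure.haarMeasure (⊤ : TopologicalSpace.PositiveCompacts
      (Matrix.orthogonalGroup (Fin d) ℝ)))

/-- The planted distribution: the law of `Y * Q`, where `Q` is a uniformly random orthogonal
matrix independent of `Y`. -/
noncomputable def plantedMeasure (n d : ℕ) (ρ σ : ℝ) : Measure (Fin n → Fin d → ℝ) :=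
  Measure.map (fun (P : (Fin n → Fin d → ℝ) × (Fin d → Fin d → ℝ)) (i : Fin n) (k : Fin d) =>
      ∑ j, P.1 i j * P.2 j k)
    ((hiddenMeasure n d ρ σ).prod (haarOrthogonal d))

theorem isProbabilityMeasure_noisyBernoulliRademacher {ρ σ : ℝ} (h0 : 0 ≤ ρ) (h1 : ρ ≤ 1) :
    IsProbabilityMeasure (noisyBernoulliRademacher ρ σ) := by
  constructor
  simp only [noisyBernoulliRademacher, Measure.add_apply, Measure.smul_apply, measure_univ,
    smul_eq_mul, mul_one]
  rw [← ENNReal.ofReal_add (by linarith) (by linarith),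
    ← ENNReal.ofReal_add (by linarith) (by linarith)]
  rw [show 1 - ρ + ρ / 2 + ρ / 2 = 1 by ring, ENNReal.ofReal_one]

instance isProbabilityMeasure_nullMeasure (n d : ℕ) :
    IsProbabilityMeasure (nullMeasure n d) := by
  unfold nullMeasure; infer_instance

instance isProbabilityMeasure_haarOrthogonal (d : ℕ) :
    IsProbabilityMeasure (haarOrthogonal d) := by
  let : MeasurableSpace (Matrix.orthogonalGroup (Fin d) ℝ) := borel _
  have : BorelSpace (Matrix.orthogonalGroup (Fin d) ℝ) := ⟨rfl⟩
  have h := Measure.haarMeasure_self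
    (K₀ := (⊤ : TopologicalSpace.PositiveCompacts (Matrix.orthogonalGroup (Fin d) ℝ)))
  rw [TopologicalSpace.PositiveCompacts.coe_top] at h
  have : IsProbabilityMeasure (Measure.haarMeasure (⊤ : TopologicalSpace.PositiveCompacts
      (Matrix.orthogonalGroup (Fin d) ℝ))) := ⟨h⟩
  refine Measure.isProbabilityMeasure_map (Continuous.measurable ?_).aemeasurable
  exact continuous_pi fun i => continuous_pi fun j => continuous_subtype_val.matrix_elem i j

theorem isProbabilityMeasure_plantedMeasure (n d : ℕ) {ρ σ : ℝ} (h0 : 0 ≤ ρ) (h1 : ρ ≤ 1) :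
    IsProbabilityMeasure (plantedMeasure n d ρ σ) := by
  have := isProbabilityMeasure_noisyBernoulliRademacher (σ := σ) h0 h1
  have : ∀ j : Fin d, IsProbabilityMeasure
      (if (j : ℕ) = 0 then noisyBernoulliRademacher ρ σ else gaussianReal 0 1) := by
    intro j; split_ifs <;> infer_instance
  have : IsProbabilityMeasure (hiddenMeasure n d ρ σ) := by
    unfold hiddenMeasure; infer_instance
  exact Measure.isProbabilityMeasure_map (Measurable.aemeasurable (by fun_prop))

/-! ### The low-degree likelihood ratio -/

/-- The value at the matrix `A` of a polynomial in the `n * d` matrix entries. -/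
noncomputable def evalMatrix {n d : ℕ} (p : MvPolynomial (Fin n × Fin d) ℝ)
    (A : Fin n → Fin d → ℝ) : ℝ :=
  MvPolynomial.eval (fun e => A e.1 e.2) p

/-- `L` is the degree-`D` likelihood ratio `L^{≤ D}` of `μ` with respect to `ν`: the polynomial of
degree at most `D` such that `E_ν[L p] = E_μ[p]` for all polynomials `p` of degree at most `D`.
If `μ ≪ ν` this says that `L` is the `L²(ν)`-orthogonal projection of `dμ/dν` onto the polynomials
of degree at most `D` (see `isLowDegreeLikelihoodRatio_iff`). It does not need `μ ≪ ν`. -/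
structure IsLowDegreeLikelihoodRatio {n d : ℕ} (ν μ : Measure (Fin n → Fin d → ℝ)) (D : ℕ)
    (L : MvPolynomial (Fin n × Fin d) ℝ) : Prop where
  totalDegree_le : L.totalDegree ≤ D
  integrable_planted : ∀ p : MvPolynomial (Fin n × Fin d) ℝ, p.totalDegree ≤ D →
    Integrable (fun A => evalMatrix p A) μ
  integrable_null : ∀ p : MvPolynomial (Fin n × Fin d) ℝ, p.totalDegree ≤ D →
    Integrable (fun A => evalMatrix L A * evalMatrix p A) ν
  integral_eq : ∀ p : MvPolynomial (Fin n × Fin d) ℝ, p.totalDegree ≤ D →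
    ∫ A, evalMatrix L A * evalMatrix p A ∂ν = ∫ A, evalMatrix p A ∂μ

/-- When `dμ/dν` exists, the residual `dμ/dν - L` is `ν`-orthogonal to all polynomials of degree
at most `D` exactly when `L` is the degree-`D` likelihood ratio. -/
theorem isLowDegreeLikelihoodRatio_iff {n d : ℕ} {ν μ : Measure (Fin n → Fin d → ℝ)}
    [SigmaFinite ν] [SigmaFinite μ] (hμν : μ ≪ ν) {D : ℕ} {L : MvPolynomial (Fin n × Fin d) ℝ}
    (hL : L.totalDegree ≤ D)
    (hμ : ∀ p : MvPolynomial (Fin n × Fin d) ℝ, p.totalDegree ≤ D →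
      Integrable (fun A => evalMatrix p A) μ)
    (hν : ∀ p : MvPolynomial (Fin n × Fin d) ℝ, p.totalDegree ≤ D →
      Integrable (fun A => evalMatrix L A * evalMatrix p A) ν) :
    IsLowDegreeLikelihoodRatio ν μ D L ↔
      ∀ p : MvPolynomial (Fin n × Fin d) ℝ, p.totalDegree ≤ D →
        ∫ A, ((μ.rnDeriv ν A).toReal - evalMatrix L A) * evalMatrix p A ∂ν = 0 := by
  have key : ∀ p : MvPolynomial (Fin n × Fin d) ℝ, p.totalDegree ≤ D →
      ∫ A, ((μ.rnDeriv ν A).toReal - evalMatrix L A) * evalMatrix p A ∂ν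
        = ∫ A, evalMatrix p A ∂μ - ∫ A, evalMatrix L A * evalMatrix p A ∂ν := by
    intro p hp
    have h1 : Integrable (fun A => (μ.rnDeriv ν A).toReal * evalMatrix p A) ν := by
      simpa only [smul_eq_mul] using (integrable_rnDeriv_smul_iff hμν).2 (hμ p hp)
    simp only [sub_mul]
    rw [integral_sub h1 (hν p hp)]
    congr 1
    simpa only [smul_eq_mul] using integral_rnDeriv_smul hμν (f := fun A => evalMatrix p A)
  constructor
  · intro h p hp
    rw [key p hp, h.integral_eq p hp, sub_self]
  · intro h
    refine ⟨hL, hμ, hν, fun p hp => ?_⟩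
    have := h p hp
    rw [key p hp] at this
    linarith

/-!
For a unit vector `u`, let `Λ_u` be the degree-`D` likelihood ratio, with respect to the null
distribution, of the matrix with a hidden direction `u`: in the rows `A_i` it is the Hermite
expansion

  `Λ_u(A) = ∑_k ∏_i c_{k i} / (k i)! * He_{k i}(⟨A_i, u⟩)`,

where `k` runs over the multi-indices with `∑ i, k i ≤ D` and `c_k` is the `k`-th Hermite moment of
the noisy Bernoulli–Rademacher distribution (`directionalRatio`, `integral_hiddenMeasure_eq`).
Since the Gaussian distribution is invariant under rotations, a polynomial of degree at most `D` has
planted expectation `E_Q E_ν[p Λ_{Q₀}]`, where `Q₀` is the first row of the Haar matrix `Q`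
(`integral_plantedMeasure_eq`); hence the low-degree likelihood ratio exists, and by Hermite
orthogonality its second moment is the average of
`∑_k ∏_i c_{k i}² / (k i)! * ⟨Q₀, Q'₀⟩ ^ ∑ i, k i` over two independent copies `Q`, `Q'`. The first
four Hermite moments agree with those of the Gaussian: `c₀ = 1` and `c₁ = c₂ = c₃ = 0`. As
`c_k² / k! ≤ 4 ρ² (4 / ρ) ^ k` for `k ≥ 2`, and as the `2j`-th moment of `⟨Q₀, w⟩`, for a unit
vector `w`, is at most `(2j - 1)!! / d ^ j`, the sum is at most `(1 + O(D² / (ρ² d²)))ⁿ`, which is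
bounded in the given range of parameters (`integral_sq_lowDegreeLikelihoodRatio_le_three`).

The null matrix is spread by a net argument with constants only: its operator norm is `O(√n)`, and
by a Chernoff bound every fixed vector of the net keeps a constant proportion of its mass on every
set of at least half of the rows (`nullMeasure_not_matrixSpread_le`). The planted matrix is not
spread, because its column span contains the first column `y` of `Y`, and `y` is concentrated on the
set of its atoms `± 1 / √ρ'`: that set has at most `1.5 ρ n` elements by Chebyshev's inequality, and
the remaining entries have total mass `O(σ² n)` in mean (`plantedMeasure_not_matrixSpread_ge`).

For the second part take `σ = 0` and `ρ = d / (α² n log n)`, so that `ρ n` is of smaller order than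
`d / α²` (`sparsity_bounds`). By Cauchy–Schwarz the advantage of a low-degree polynomial is at most
the `L²(ν)`-norm of the low-degree likelihood ratio times the standard deviation of the polynomial
(`IsLowDegreeLikelihoodRatio.integral_sub_integral_le`).
-/

/-! ### Functions with moments of every order -/

/-- `f` has finite moments of every order under `m`. -/
def HasAllMoments {Ω : Type*} [MeasurableSpace Ω] (f : Ω → ℝ) (m : Measure Ω) : Prop :=
  ∀ p : ℕ, MemLp f p m

namespace HasAllMoments

variable {Ω Ω' : Type*} [MeasurableSpace Ω] [MeasurableSpace Ω'] {m : Measure Ω}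
  {m' : Measure Ω'} {f g : Ω → ℝ}

theorem integrable (hf : HasAllMoments f m) : Integrable f m := by
  simpa using memLp_one_iff_integrable.1 (by simpa using hf 1)

theorem const [IsFiniteMeasure m] (c : ℝ) : HasAllMoments (fun _ : Ω => c) m :=
  fun _ => memLp_const c

theorem add (hf : HasAllMoments f m) (hg : HasAllMoments g m) :
    HasAllMoments (fun x => f x + g x) m := fun p => (hf p).add (hg p)

theorem mul (hf : HasAllMoments f m) (hg : HasAllMoments g m) :
    HasAllMoments (fun x => f x * g x) m := by
  intro p
  have : ENNReal.HolderTriple ((2 * p : ℕ) : ENNReal) ((2 * p : ℕ) : ENNReal) (p : ENNReal) := by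
    constructor
    push_cast
    rw [ENNReal.mul_inv (by simp) (by simp), ← add_mul, ENNReal.inv_two_add_inv_two, one_mul]
  exact (hg (2 * p)).mul (hf (2 * p))

theorem sum [IsFiniteMeasure m] {ι : Type*} (s : Finset ι) {F : ι → Ω → ℝ}
    (h : ∀ i ∈ s, HasAllMoments (F i) m) : HasAllMoments (fun x => ∑ i ∈ s, F i x) m :=
  fun p => memLp_finsetSum s fun i hi => h i hi p

theorem prod [IsFiniteMeasure m] {ι : Type*} (s : Finset ι) {F : ι → Ω → ℝ}
    (h : ∀ i ∈ s, HasAllMoments (F i) m) : HasAllMoments (fun x => ∏ i ∈ s, F i x) m := by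
  classical
  induction s using Finset.induction_on with
  | empty => simpa using const (m := m) 1
  | insert a s ha ih =>
    simp only [Finset.prod_insert ha]
    exact (h a (Finset.mem_insert_self a s)).mul
      (ih fun i hi => h i (Finset.mem_insert_of_mem hi))

theorem pow [IsFiniteMeasure m] (hf : HasAllMoments f m) (k : ℕ) :
    HasAllMoments (fun x => f x ^ k) m := by
  simpa using prod (m := m) (Finset.range k) (F := fun _ => f) fun _ _ => hf

theorem eval_polynomial [IsFiniteMeasure m] (hf : HasAllMoments f m) (P : Polynomial ℝ) :
    HasAllMoments (fun x => P.eval (f x)) m := by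
  simp only [Polynomial.eval_eq_sum_range]
  exact sum _ fun i _ => (const _).mul (hf.pow i)

theorem eval_mvPolynomial [IsFiniteMeasure m] {τ : Type*} {F : Ω → τ → ℝ}
    (h : ∀ t, HasAllMoments (fun x => F x t) m) (P : MvPolynomial τ ℝ) :
    HasAllMoments (fun x => MvPolynomial.eval (F x) P) m := by
  induction P using MvPolynomial.induction_on with
  | C a => simpa using const (m := m) a
  | add p q hp hq => simpa using hp.add hq
  | mul_X p t hp => simpa using hp.mul (h t)

theorem comp_measurePreserving {T : Ω' → Ω} (hf : HasAllMoments f m)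
    (hT : MeasurePreserving T m' m) : HasAllMoments (fun x => f (T x)) m' :=
  fun p => (hf p).comp_measurePreserving hT

theorem of_bounded [IsFiniteMeasure m] (hf : AEStronglyMeasurable f m) (c : ℝ)
    (h : ∀ᵐ x ∂m, ‖f x‖ ≤ c) : HasAllMoments f m :=
  fun _ => MemLp.of_bound hf c h

end HasAllMoments

theorem hasAllMoments_id_gaussianReal (v : NNReal) :
    HasAllMoments (fun x : ℝ => x) (gaussianReal 0 v) :=
  fun p => memLp_id_gaussianReal' p (by simp)

theorem hasAllMoments_pi_gaussian {ι : Type*} [Fintype ι] (j : ι) :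
    HasAllMoments (fun x : ι → ℝ => x j) (Measure.pi fun _ : ι => gaussianReal 0 1) :=
  (hasAllMoments_id_gaussianReal 1).comp_measurePreserving
    (measurePreserving_eval (fun _ : ι => gaussianReal 0 1) j)

theorem hasAllMoments_nullMeasure {n d : ℕ} (i : Fin n) (j : Fin d) :
    HasAllMoments (fun A : Fin n → Fin d → ℝ => A i j) (nullMeasure n d) :=
  (hasAllMoments_pi_gaussian j).comp_measurePreserving
    (measurePreserving_eval (fun _ : Fin n => Measure.pi fun _ : Fin d => gaussianReal 0 1) i)

/-! ### Gaussian integration by parts -/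

theorem integral_id_mul_polynomial_gaussian (P : Polynomial ℝ) :
    ∫ x, x * P.eval x ∂gaussianReal 0 1 = ∫ x, P.derivative.eval x ∂gaussianReal 0 1 := by
  have hint : ∀ Q : Polynomial ℝ,
      Integrable (fun x => gaussianPDFReal 0 1 x * Q.eval x) := by
    intro Q
    have h := ((hasAllMoments_id_gaussianReal 1).eval_polynomial Q).integrable
    rw [gaussianReal_of_var_ne_zero 0 one_ne_zero] at h
    rw [integrable_withDensity_iff_integrable_smul' (measurable_gaussianPDF 0 1)
      (ae_of_all _ fun x => gaussianPDF_lt_top)] at h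
    simpa only [toReal_gaussianPDF, smul_eq_mul] using h
  have hd : ∀ x, HasDerivAt (fun x => gaussianPDFReal 0 1 x * P.eval x)
      (gaussianPDFReal 0 1 x * (P.derivative - Polynomial.X * P).eval x) x := by
    intro x
    have h1 : HasDerivAt (gaussianPDFReal 0 1) (-x * gaussianPDFReal 0 1 x) x := by
      have h2 : HasDerivAt (fun x : ℝ => -(x - 0) ^ 2 / (2 * (1 : NNReal))) (-x) x := by
        refine HasDerivAt.congr_deriv (f' := -(((2 : ℕ) : ℝ) * (x - 0) ^ (2 - 1) * 1) /
          (2 * ((1 : NNReal) : ℝ))) ?_ (by simp; ring)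
        exact (((hasDerivAt_id x).sub_const 0).pow 2).neg.div_const (2 * ((1 : NNReal) : ℝ))
      rw [gaussianPDFReal_def]
      exact ((h2.exp).const_mul (√(2 * Real.pi * (1 : NNReal)))⁻¹).congr_deriv (by ring)
    refine (h1.mul (P.hasDerivAt x)).congr_deriv ?_
    simp only [Polynomial.eval_sub, Polynomial.eval_mul, Polynomial.eval_X]
    ring
  have h0 := integral_eq_zero_of_hasDerivAt_of_integrable hd (hint _) (hint P)
  have h1 : Integrable (fun x => x * P.eval x) (gaussianReal 0 1) := by
    have h := ((hasAllMoments_id_gaussianReal 1).eval_polynomial (Polynomial.X * P)).integrable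
    simpa only [Polynomial.eval_mul, Polynomial.eval_X] using h
  have h2 := ((hasAllMoments_id_gaussianReal 1).eval_polynomial P.derivative).integrable
  have h3 : ∫ x, (P.derivative - Polynomial.X * P).eval x ∂gaussianReal 0 1 = 0 := by
    rw [integral_gaussianReal_eq_integral_smul one_ne_zero]
    simpa only [smul_eq_mul] using h0
  simp only [Polynomial.eval_sub, Polynomial.eval_mul, Polynomial.eval_X] at h3
  rw [integral_sub h2 h1] at h3
  linarith

theorem integral_pow_succ_gaussian (k : ℕ) :
    ∫ x, x ^ (k + 1) ∂gaussianReal 0 1 = k * ∫ x, x ^ (k - 1) ∂gaussianReal 0 1 := by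
  have h := integral_id_mul_polynomial_gaussian (Polynomial.X ^ k)
  simp only [Polynomial.derivative_X_pow, Polynomial.eval_mul, Polynomial.eval_pow,
    Polynomial.eval_X, Polynomial.eval_C] at h
  rw [integral_const_mul] at h
  rw [← h]
  simp_rw [pow_succ']

/-- Gaussian integration by parts for polynomials in several independent standard Gaussian
variables. -/
theorem integral_coord_mul_mvPolynomial_gaussian {ι : Type*} [Fintype ι] (j : ι)
    (P : MvPolynomial ι ℝ) :
    ∫ x, x j * MvPolynomial.eval x P ∂(Measure.pi fun _ : ι => gaussianReal 0 1)
      = ∫ x, MvPolynomial.eval x (MvPolynomial.pderiv j P)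
          ∂(Measure.pi fun _ : ι => gaussianReal 0 1) := by
  classical
  have hP : ∀ P : MvPolynomial ι ℝ, Integrable (fun x => MvPolynomial.eval x P)
      (Measure.pi fun _ : ι => gaussianReal 0 1) := fun P =>
    (HasAllMoments.eval_mvPolynomial (fun t => hasAllMoments_pi_gaussian t) P).integrable
  have hX : ∀ P : MvPolynomial ι ℝ, Integrable (fun x => x j * MvPolynomial.eval x P)
      (Measure.pi fun _ : ι => gaussianReal 0 1) := fun P =>
    ((hasAllMoments_pi_gaussian j).mul
      (HasAllMoments.eval_mvPolynomial (fun t => hasAllMoments_pi_gaussian t) P)).integrable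
  have hmon : ∀ s : ι →₀ ℕ, ∫ x : ι → ℝ, ∏ i, x i ^ s i ∂(Measure.pi fun _ : ι => gaussianReal 0 1)
      = ∏ i, ∫ x, x ^ s i ∂gaussianReal 0 1 := fun s =>
    integral_fintype_prod_eq_prod (fun i (x : ℝ) => x ^ s i)
  have hev : ∀ (s : ι →₀ ℕ) (a : ℝ) (x : ι → ℝ),
      MvPolynomial.eval x (MvPolynomial.monomial s a) = a * ∏ i, x i ^ s i := by
    intro s a x
    rw [MvPolynomial.eval_monomial, Finsupp.prod_fintype _ _ (by simp)]
  induction P using MvPolynomial.induction_on' with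
  | add p q hp hq =>
    simp only [map_add, mul_add]
    rw [integral_add (hX p) (hX q), integral_add (hP _) (hP _), hp, hq]
  | monomial s a =>
    have h1 : ∀ x : ι → ℝ, x j * MvPolynomial.eval x (MvPolynomial.monomial s a)
        = a * ∏ i, x i ^ (s + Finsupp.single j 1 : ι →₀ ℕ) i := by
      intro x
      rw [hev]
      simp only [Finsupp.add_apply, pow_add, Finset.prod_mul_distrib]
      rw [Finset.prod_eq_single j (f := fun i => x i ^ (Finsupp.single j 1 : ι →₀ ℕ) i)]
      · simp; ring
      · intro b _ hb; simp [hb.symm]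
      · simp
    simp_rw [h1, MvPolynomial.pderiv_monomial, hev]
    rw [integral_const_mul, integral_const_mul, hmon, hmon,
      ← Finset.mul_prod_erase _ _ (Finset.mem_univ j),
      ← Finset.mul_prod_erase _
        (fun i => ∫ x, x ^ (s - Finsupp.single j 1 : ι →₀ ℕ) i ∂gaussianReal 0 1)
        (Finset.mem_univ j)]
    have h2 : ∀ i ∈ Finset.univ.erase j,
        ∫ x, x ^ (s + Finsupp.single j 1 : ι →₀ ℕ) i ∂gaussianReal 0 1
        = ∫ x, x ^ (s - Finsupp.single j 1 : ι →₀ ℕ) i ∂gaussianReal 0 1 := by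
      intro i hi
      have : i ≠ j := (Finset.mem_erase.1 hi).1
      simp [this.symm]
    rw [Finset.prod_congr rfl h2]
    have h3 := integral_pow_succ_gaussian (s j)
    simp only [Finsupp.add_apply, Finsupp.single_eq_same, Finsupp.tsub_apply]
    rw [h3]
    ring

/-! ### Hermite polynomials -/

/-- The probabilists' Hermite polynomial with real coefficients. -/
noncomputable def realHermite (k : ℕ) : Polynomial ℝ :=
  (Polynomial.hermite k).map (Int.castRingHom ℝ)

theorem realHermite_zero : realHermite 0 = 1 := by simp [realHermite]

theorem realHermite_succ (k : ℕ) :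
    realHermite (k + 1) = Polynomial.X * realHermite k - Polynomial.derivative (realHermite k) := by
  simp [realHermite, Polynomial.derivative_map]

theorem realHermite_one : realHermite 1 = Polynomial.X := by
  simp [realHermite_succ, realHermite_zero]

theorem monic_realHermite (k : ℕ) : (realHermite k).Monic := (Polynomial.hermite_monic k).map _

theorem natDegree_realHermite (k : ℕ) : (realHermite k).natDegree = k := by
  rw [realHermite, (Polynomial.hermite_monic k).natDegree_map, Polynomial.natDegree_hermite]

theorem derivative_realHermite_succ (k : ℕ) :
    Polynomial.derivative (realHermite (k + 1)) = ((k : ℝ) + 1) • realHermite k := by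
  induction k with
  | zero => simp [realHermite_succ, realHermite_zero]
  | succ k ih =>
    rw [realHermite_succ (k + 1), Polynomial.derivative_sub, Polynomial.derivative_mul, ih,
      Polynomial.derivative_smul]
    conv_rhs => rw [realHermite_succ k]
    rw [realHermite_succ k, Polynomial.derivative_X]
    simp only [Polynomial.smul_eq_C_mul, map_add, map_natCast, map_one]
    push_cast
    ring

theorem realHermite_add_two (k : ℕ) :
    realHermite (k + 2) = Polynomial.X * realHermite (k + 1) - ((k : ℝ) + 1) • realHermite k := by
  rw [realHermite_succ, derivative_realHermite_succ]

theorem eval_neg_realHermite (k : ℕ) (x : ℝ) :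
    (realHermite k).eval (-x) = (-1) ^ k * (realHermite k).eval x := by
  induction k using Nat.strong_induction_on with
  | _ k ih =>
    match k with
    | 0 => simp [realHermite_zero]
    | 1 => simp [realHermite_succ, realHermite_zero]
    | k + 2 =>
      simp only [realHermite_add_two, Polynomial.eval_sub, Polynomial.eval_mul, Polynomial.eval_X,
        Polynomial.eval_smul, smul_eq_mul, ih (k + 1) (by omega), ih k (by omega)]
      ring

/-- A bound for Hermite polynomials that is within an exponential factor of their `L²` norm `√k!` at
bounded arguments. -/
theorem abs_eval_realHermite_le (k : ℕ) (x : ℝ) :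
    |(realHermite k).eval x| ≤ √(k.factorial : ℝ) * (1 + |x|) ^ k := by
  induction k using Nat.strong_induction_on with
  | _ k ih =>
    match k with
    | 0 => simp [realHermite_zero]
    | 1 => simp [realHermite_succ, realHermite_zero]
    | k + 2 =>
      have h1 := ih (k + 1) (by omega)
      have h0 := ih k (by omega)
      have hx := abs_nonneg x
      set a := |x|
      set s := √(k.factorial : ℝ) with hs
      have hs0 : 0 ≤ s := Real.sqrt_nonneg _
      have e1 : √((k + 1).factorial : ℝ) = √((k : ℝ) + 1) * s := by
        rw [hs, ← Real.sqrt_mul (by positivity), Nat.factorial_succ]; push_cast; ring_nf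
      have e2 : √((k + 2).factorial : ℝ) = √((k : ℝ) + 2) * (√((k : ℝ) + 1) * s) := by
        rw [← e1, ← Real.sqrt_mul (by positivity), Nat.factorial_succ (k + 1)]; push_cast; ring_nf
      rw [e1] at h1
      rw [e2]
      set r := √((k : ℝ) + 1) with hr
      set t := √((k : ℝ) + 2) with ht
      have hr0 : 0 ≤ r := Real.sqrt_nonneg _
      have hrr : r * r = (k : ℝ) + 1 := Real.mul_self_sqrt (by positivity)
      have hrt : r ≤ t := Real.sqrt_le_sqrt (by linarith)
      have ht1 : 1 ≤ t := Real.one_le_sqrt.2 (by linarith [(Nat.cast_nonneg k : (0 : ℝ) ≤ k)])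
      have hp : 0 ≤ (1 + a) ^ k := by positivity
      rw [realHermite_add_two]
      simp only [Polynomial.eval_sub, Polynomial.eval_mul, Polynomial.eval_X,
        Polynomial.eval_smul, smul_eq_mul]
      calc |x * (realHermite (k + 1)).eval x - ((k : ℝ) + 1) * (realHermite k).eval x|
          ≤ a * |(realHermite (k + 1)).eval x| + ((k : ℝ) + 1) * |(realHermite k).eval x| := by
            refine (abs_sub _ _).trans ?_
            rw [abs_mul, abs_mul, abs_of_nonneg (by positivity : (0 : ℝ) ≤ (k : ℝ) + 1)]
        _ ≤ a * (r * s * (1 + a) ^ (k + 1)) + ((k : ℝ) + 1) * (s * (1 + a) ^ k) := by gcongr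
        _ = r * s * (1 + a) ^ k * (a * (1 + a) + r) := by rw [← hrr]; ring
        _ ≤ r * s * (1 + a) ^ k * (t * (1 + a) ^ 2) := by
            gcongr
            nlinarith [mul_nonneg (sub_nonneg.2 ht1) hx,
              mul_nonneg (sub_nonneg.2 ht1) (sq_nonneg a)]
        _ = t * (r * s) * (1 + a) ^ (k + 2) := by ring

/-! ### Hermite polynomials under the one-dimensional Gaussian -/

theorem integral_realHermite_succ_mul (k : ℕ) (P : Polynomial ℝ) :
    ∫ x, (realHermite (k + 1)).eval x * P.eval x ∂gaussianReal 0 1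
      = ∫ x, (realHermite k).eval x * P.derivative.eval x ∂gaussianReal 0 1 := by
  have hint : ∀ Q : Polynomial ℝ, Integrable (fun x => Q.eval x) (gaussianReal 0 1) :=
    fun Q => ((hasAllMoments_id_gaussianReal 1).eval_polynomial Q).integrable
  have h := integral_id_mul_polynomial_gaussian (realHermite k * P)
  have e1 : ∀ x : ℝ, (realHermite (k + 1)).eval x * P.eval x
      = x * (realHermite k * P).eval x - ((realHermite k).derivative * P).eval x := by
    intro x
    simp only [realHermite_succ, Polynomial.eval_sub, Polynomial.eval_mul, Polynomial.eval_X]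
    ring
  have e2 : ∀ x : ℝ, (realHermite k).eval x * P.derivative.eval x
      = (realHermite k * P).derivative.eval x - ((realHermite k).derivative * P).eval x := by
    intro x
    simp only [Polynomial.derivative_mul, Polynomial.eval_add, Polynomial.eval_mul]
    ring
  have h1 : Integrable (fun x => x * (realHermite k * P).eval x) (gaussianReal 0 1) := by
    have h2 := hint (Polynomial.X * (realHermite k * P))
    simpa only [Polynomial.eval_mul, Polynomial.eval_X] using h2
  simp_rw [e1, e2]
  rw [integral_sub h1 (hint _), integral_sub (hint _) (hint _), h]

theorem integral_realHermite_mul_realHermite (k l : ℕ) :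
    ∫ x, (realHermite k).eval x * (realHermite l).eval x ∂gaussianReal 0 1
      = if k = l then (k.factorial : ℝ) else 0 := by
  induction k generalizing l with
  | zero =>
    cases l with
    | zero => simp [realHermite_zero]
    | succ l =>
      have h := integral_realHermite_succ_mul l 1
      simp only [Polynomial.derivative_one, Polynomial.eval_zero, mul_zero, integral_zero,
        Polynomial.eval_one, mul_one] at h
      simp [realHermite_zero, h]
  | succ k ih =>
    rw [integral_realHermite_succ_mul]
    cases l with
    | zero => simp [realHermite_zero]
    | succ l =>
      simp only [derivative_realHermite_succ, Polynomial.eval_smul, smul_eq_mul]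
      simp_rw [mul_left_comm _ ((l : ℝ) + 1)]
      rw [integral_const_mul, ih]
      by_cases hkl : k = l
      · simp [hkl, Nat.factorial_succ]
      · simp [hkl]

/-- A Hermite polynomial is orthogonal to all polynomials of smaller degree. -/
theorem integral_realHermite_mul_eq_zero {k : ℕ} {P : Polynomial ℝ} (h : P.natDegree < k) :
    ∫ x, (realHermite k).eval x * P.eval x ∂gaussianReal 0 1 = 0 := by
  induction k generalizing P with
  | zero => omega
  | succ k ih =>
    rw [integral_realHermite_succ_mul]
    rcases Nat.eq_zero_or_pos P.natDegree with h0 | h0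
    · rw [Polynomial.eq_C_of_natDegree_eq_zero h0]; simp
    · exact ih (lt_of_lt_of_le (Polynomial.natDegree_derivative_lt h0.ne') (by omega))

/-- The Hermite polynomials of degree at most `D` span the polynomials of degree at most `D`, as
they are monic. -/
theorem hermite_induction {motive : Polynomial ℝ → Prop} (D : ℕ)
    (add : ∀ p q, motive p → motive q → motive (p + q))
    (smul : ∀ (a : ℝ) p, motive p → motive (a • p))
    (hermite : ∀ k ≤ D, motive (realHermite k)) (q : Polynomial ℝ) (hq : q.natDegree ≤ D) :
    motive q := by
  induction D generalizing q with
  | zero =>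
    have h := smul (q.coeff 0) _ (hermite 0 le_rfl)
    rw [Polynomial.eq_C_of_natDegree_le_zero hq]
    simpa [realHermite_zero, Polynomial.smul_eq_C_mul] using h
  | succ D ih =>
    have h1 : (q - q.coeff (D + 1) • realHermite (D + 1)).natDegree ≤ D := by
      rw [Polynomial.natDegree_le_iff_coeff_eq_zero]
      intro N hN
      rw [Polynomial.coeff_sub, Polynomial.coeff_smul, smul_eq_mul]
      rcases (Nat.succ_le_of_lt hN).eq_or_lt with h | h
      · have : (realHermite (D + 1)).coeff (D + 1) = 1 := by
          have := (monic_realHermite (D + 1)).coeff_natDegree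
          rwa [natDegree_realHermite] at this
        rw [← h, Nat.succ_eq_add_one, this]; ring
      · rw [Polynomial.coeff_eq_zero_of_natDegree_lt (lt_of_le_of_lt hq h),
          Polynomial.coeff_eq_zero_of_natDegree_lt (p := realHermite (D + 1))
            (by rw [natDegree_realHermite]; exact h)]
        ring
    have h2 := add _ _ (ih (fun k hk => hermite k (by omega)) _ h1)
      (smul (q.coeff (D + 1)) _ (hermite (D + 1) le_rfl))
    simpa using h2

/-- On polynomials of degree at most `D`, a measure with finite moments has the density
`∑ k ≤ D, (E[He_k] / k!) He_k` with respect to the standard Gaussian. -/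
theorem integral_eq_sum_hermite {m : Measure ℝ} [IsFiniteMeasure m]
    (hm : HasAllMoments (fun x : ℝ => x) m) (D : ℕ) (q : Polynomial ℝ) (hq : q.natDegree ≤ D) :
    ∫ x, q.eval x ∂m = ∑ k ∈ Finset.range (D + 1), (∫ x, (realHermite k).eval x ∂m) / k.factorial
      * ∫ x, (realHermite k).eval x * q.eval x ∂gaussianReal 0 1 := by
  have hint : ∀ Q : Polynomial ℝ, Integrable (fun x => Q.eval x) m :=
    fun Q => (hm.eval_polynomial Q).integrable
  have hint' : ∀ k, ∀ Q : Polynomial ℝ, Integrable (fun x => (realHermite k).eval x * Q.eval x)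
      (gaussianReal 0 1) := fun k Q => by
    simpa only [Polynomial.eval_mul] using
      ((hasAllMoments_id_gaussianReal 1).eval_polynomial (realHermite k * Q)).integrable
  refine hermite_induction (motive := fun q => ∫ x, q.eval x ∂m = ∑ k ∈ Finset.range (D + 1),
    (∫ x, (realHermite k).eval x ∂m) / k.factorial
      * ∫ x, (realHermite k).eval x * q.eval x ∂gaussianReal 0 1) D ?_ ?_ ?_ q hq
  · intro p q hp hq
    simp only [Polynomial.eval_add, mul_add]
    rw [integral_add (hint p) (hint q), hp, hq, ← Finset.sum_add_distrib]
    refine Finset.sum_congr rfl fun k _ => ?_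
    rw [integral_add (hint' k p) (hint' k q), mul_add]
  · intro a p hp
    simp only [Polynomial.eval_smul, smul_eq_mul, mul_left_comm _ a]
    rw [integral_const_mul, hp, Finset.mul_sum]
    refine Finset.sum_congr rfl fun k _ => ?_
    rw [integral_const_mul, mul_left_comm]
  · intro j hj
    simp_rw [integral_realHermite_mul_realHermite]
    rw [Finset.sum_eq_single j]
    · rw [if_pos rfl, div_mul_cancel₀ _ (by positivity)]
    · intro k _ hk; simp [hk]
    · intro h; exact absurd (Finset.mem_range.2 (by omega)) h

/-! ### Hermite polynomials of linear forms -/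

section LinearForms

variable {ι : Type*} [Fintype ι]

/-- The linear form `x ↦ ∑ j, u j * x j` as a polynomial. -/
noncomputable def linForm (u : ι → ℝ) : MvPolynomial ι ℝ :=
  ∑ j, MvPolynomial.C (u j) * MvPolynomial.X j

theorem eval_linForm (u x : ι → ℝ) : MvPolynomial.eval x (linForm u) = u ⬝ᵥ x := by
  simp [linForm, dotProduct]

theorem pderiv_linForm (u : ι → ℝ) (j : ι) :
    MvPolynomial.pderiv j (linForm u) = MvPolynomial.C (u j) := by
  classical
  simp [linForm, MvPolynomial.pderiv_X, Pi.single_apply]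

theorem eval_aeval_linForm (P : Polynomial ℝ) (u x : ι → ℝ) :
    MvPolynomial.eval x (Polynomial.aeval (linForm u) P) = P.eval (u ⬝ᵥ x) := by
  rw [← eval_linForm, Polynomial.aeval_def, Polynomial.hom_eval₂]
  have : (MvPolynomial.eval x).comp (algebraMap ℝ (MvPolynomial ι ℝ)) = RingHom.id ℝ := by
    ext; simp
  rw [this]; rfl

theorem pderiv_aeval_linForm (P : Polynomial ℝ) (u : ι → ℝ) (j : ι) :
    MvPolynomial.pderiv j (Polynomial.aeval (linForm u) P)
      = MvPolynomial.C (u j) * Polynomial.aeval (linForm u) P.derivative := by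
  rw [Derivation.map_aeval, pderiv_linForm, smul_eq_mul, mul_comm]

/-- Gaussian integration by parts in the direction of a unit vector `u`. -/
theorem integral_realHermite_dotProduct_mul {u : ι → ℝ} (hu : u ⬝ᵥ u = 1) (k : ℕ)
    (P : MvPolynomial ι ℝ) :
    ∫ x, (realHermite (k + 1)).eval (u ⬝ᵥ x) * MvPolynomial.eval x P
        ∂(Measure.pi fun _ : ι => gaussianReal 0 1)
      = ∫ x, (realHermite k).eval (u ⬝ᵥ x) *
          MvPolynomial.eval x (∑ j, MvPolynomial.C (u j) * MvPolynomial.pderiv j P)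
        ∂(Measure.pi fun _ : ι => gaussianReal 0 1) := by
  set γ := Measure.pi fun _ : ι => gaussianReal 0 1 with hγ
  have hP : ∀ P : MvPolynomial ι ℝ, HasAllMoments (fun x => MvPolynomial.eval x P) γ := fun P =>
    HasAllMoments.eval_mvPolynomial (fun t => hasAllMoments_pi_gaussian t) P
  set H := Polynomial.aeval (linForm u) (realHermite k) with hH
  set H' := Polynomial.aeval (linForm u) (realHermite k).derivative with hH'
  have h := fun j => integral_coord_mul_mvPolynomial_gaussian j (H * P)
  have h1 : ∫ x, (u ⬝ᵥ x) * MvPolynomial.eval x (H * P) ∂γ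
      = ∫ x, MvPolynomial.eval x (H' * P) ∂γ + ∫ x, MvPolynomial.eval x
          (H * ∑ j, MvPolynomial.C (u j) * MvPolynomial.pderiv j P) ∂γ := by
    have e1 : ∀ x : ι → ℝ, (u ⬝ᵥ x) * MvPolynomial.eval x (H * P)
        = ∑ j, u j * (x j * MvPolynomial.eval x (H * P)) := by
      intro x; rw [dotProduct, Finset.sum_mul]; simp_rw [mul_assoc]
    have e2 : H' * P + H * ∑ j, MvPolynomial.C (u j) * MvPolynomial.pderiv j P
        = ∑ j, MvPolynomial.C (u j) * MvPolynomial.pderiv j (H * P) := by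
      have e3 : (∑ j, MvPolynomial.C (u j) * MvPolynomial.C (u j) : MvPolynomial ι ℝ) = 1 := by
        simp_rw [← map_mul]
        rw [← map_sum, ← dotProduct, hu, map_one]
      simp only [Derivation.leibniz, hH, pderiv_aeval_linForm, smul_eq_mul, mul_add,
        Finset.sum_add_distrib]
      rw [← hH', ← hH, ← one_mul (H' * P), ← e3, Finset.sum_mul, Finset.mul_sum, add_comm]
      congr 1 <;> exact Finset.sum_congr rfl fun j _ => by ring
    rw [← integral_add (hP _).integrable (hP _).integrable]
    simp_rw [← map_add, e2, e1, map_sum, map_mul, MvPolynomial.eval_C]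
    rw [integral_finsetSum, integral_finsetSum]
    · refine Finset.sum_congr rfl fun j _ => ?_
      rw [integral_const_mul, integral_const_mul, hγ, ← h j]
      simp_rw [map_mul]
    · intro j _
      exact ((hP _).integrable).const_mul _
    · intro j _
      simp_rw [← map_mul]
      exact ((hasAllMoments_pi_gaussian j).mul (hP (H * P))).integrable.const_mul _
  have hd : HasAllMoments (fun x => u ⬝ᵥ x) γ := by
    simpa only [eval_linForm] using hP (linForm u)
  have e4 : ∀ x, (realHermite (k + 1)).eval (u ⬝ᵥ x) * MvPolynomial.eval x P
      = (u ⬝ᵥ x) * MvPolynomial.eval x (H * P) - MvPolynomial.eval x (H' * P) := by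
    intro x
    simp only [realHermite_succ, Polynomial.eval_sub, Polynomial.eval_mul, Polynomial.eval_X,
      map_mul, hH, hH', eval_aeval_linForm]
    ring
  simp_rw [e4]
  rw [integral_sub (hd.mul (hP _)).integrable (hP _).integrable, h1, add_sub_cancel_left]
  simp_rw [map_mul, hH, eval_aeval_linForm]

theorem sum_pderiv_realHermite_dotProduct (u w : ι → ℝ) (l : ℕ) (x : ι → ℝ) :
    MvPolynomial.eval x (∑ j, MvPolynomial.C (u j) *
        MvPolynomial.pderiv j (Polynomial.aeval (linForm w) (realHermite (l + 1))))
      = (u ⬝ᵥ w) * ((l : ℝ) + 1) * (realHermite l).eval (w ⬝ᵥ x) := by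
  simp only [pderiv_aeval_linForm, map_sum, map_mul, MvPolynomial.eval_C, eval_aeval_linForm,
    derivative_realHermite_succ, Polynomial.eval_smul, smul_eq_mul, dotProduct, Finset.sum_mul]
  exact Finset.sum_congr rfl fun j _ => by ring

/-- The covariance of Hermite polynomials of two jointly Gaussian variables with unit variances. -/
theorem integral_realHermite_dotProduct_mul_realHermite {u w : ι → ℝ} (hu : u ⬝ᵥ u = 1)
    (hw : w ⬝ᵥ w = 1) (k l : ℕ) :
    ∫ x, (realHermite k).eval (u ⬝ᵥ x) * (realHermite l).eval (w ⬝ᵥ x)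
        ∂(Measure.pi fun _ : ι => gaussianReal 0 1)
      = if k = l then (k.factorial : ℝ) * (u ⬝ᵥ w) ^ k else 0 := by
  induction k generalizing l with
  | zero =>
    cases l with
    | zero => simp [realHermite_zero]
    | succ l =>
      have h := integral_realHermite_dotProduct_mul hw l 1
      simp only [map_one, mul_one] at h
      simp [realHermite_zero, h]
  | succ k ih =>
    have h := integral_realHermite_dotProduct_mul hu k
      (Polynomial.aeval (linForm w) (realHermite l))
    simp only [eval_aeval_linForm] at h
    rw [h]
    cases l with
    | zero => simp [realHermite_zero]
    | succ l =>
      simp_rw [sum_pderiv_realHermite_dotProduct, mul_left_comm _ ((u ⬝ᵥ w) * ((l : ℝ) + 1))]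
      rw [integral_const_mul, ih]
      by_cases hkl : k = l
      · simp only [hkl, if_true, Nat.factorial_succ]; push_cast; ring
      · simp [hkl]

end LinearForms

/-! ### Hermite moments of the noisy Bernoulli–Rademacher distribution -/

theorem integral_polynomial_gaussian_sq (σ : ℝ) (P : Polynomial ℝ) :
    ∫ x, P.eval x ∂gaussianReal 0 (σ ^ 2).toNNReal
      = ∫ x, P.eval (σ * x) ∂gaussianReal 0 1 := by
  have h : (gaussianReal 0 1).map (fun x => σ * x) = gaussianReal 0 (σ ^ 2).toNNReal := by
    rw [gaussianReal_map_const_mul, mul_zero, mul_one]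
    congr 1
    ext
    simp [sq_nonneg]
  rw [← h, integral_map (by fun_prop) P.continuous.aestronglyMeasurable]

theorem integral_realHermite_add_two_gaussian_sq (σ : ℝ) (k : ℕ) :
    ∫ x, (realHermite (k + 2)).eval x ∂gaussianReal 0 (σ ^ 2).toNNReal
      = (σ ^ 2 - 1) * ((k : ℝ) + 1) *
        ∫ x, (realHermite k).eval x ∂gaussianReal 0 (σ ^ 2).toNNReal := by
  have hint : ∀ Q : Polynomial ℝ, Integrable (fun x => Q.eval x)
      (gaussianReal 0 (σ ^ 2).toNNReal) :=
    fun Q => ((hasAllMoments_id_gaussianReal _).eval_polynomial Q).integrable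
  have h1 : ∫ x, (Polynomial.X * realHermite (k + 1)).eval x ∂gaussianReal 0 (σ ^ 2).toNNReal
      = σ ^ 2 * (((k : ℝ) + 1) *
        ∫ x, (realHermite k).eval x ∂gaussianReal 0 (σ ^ 2).toNNReal) := by
    rw [integral_polynomial_gaussian_sq, integral_polynomial_gaussian_sq]
    have h := integral_id_mul_polynomial_gaussian
      ((realHermite (k + 1)).comp (Polynomial.C σ * Polynomial.X))
    simp only [Polynomial.derivative_comp, derivative_realHermite_succ, Polynomial.eval_comp,
      Polynomial.eval_mul, Polynomial.eval_C, Polynomial.eval_X, Polynomial.smul_comp,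
      Polynomial.eval_smul, smul_eq_mul, Polynomial.derivative_mul, Polynomial.derivative_C,
      Polynomial.derivative_X, zero_mul, mul_one, zero_add] at h
    simp only [Polynomial.eval_mul, Polynomial.eval_X, mul_assoc]
    rw [integral_const_mul, h, integral_const_mul, integral_const_mul]
    ring
  rw [realHermite_add_two]
  simp only [Polynomial.eval_sub, Polynomial.eval_smul, smul_eq_mul]
  rw [integral_sub (hint _) ((hint _).const_mul _), h1, integral_const_mul]
  ring

theorem integral_realHermite_gaussian_sq_of_odd (σ : ℝ) {k : ℕ} (hk : Odd k) :
    ∫ x, (realHermite k).eval x ∂gaussianReal 0 (σ ^ 2).toNNReal = 0 := by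
  obtain ⟨j, rfl⟩ := hk
  induction j with
  | zero => simp only [Nat.mul_zero, zero_add, realHermite_one, Polynomial.eval_X,
      integral_id_gaussianReal]
  | succ j ih =>
    rw [show 2 * (j + 1) + 1 = (2 * j + 1) + 2 by ring, integral_realHermite_add_two_gaussian_sq,
      ih, mul_zero]

/-- Hermite moments of a centred Gaussian of variance at most one, from the recursion over the
degree. -/
theorem abs_integral_realHermite_gaussian_sq_le {σ : ℝ} (hσ : σ ^ 2 ≤ 1) (k : ℕ) :
    |∫ x, (realHermite k).eval x ∂gaussianReal 0 (σ ^ 2).toNNReal| ≤ √(k.factorial : ℝ) := by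
  induction k using Nat.strong_induction_on with
  | _ k ih =>
    match k with
    | 0 => simp [realHermite_zero]
    | 1 => rw [integral_realHermite_gaussian_sq_of_odd σ odd_one]; simp
    | k + 2 =>
      rw [integral_realHermite_add_two_gaussian_sq, abs_mul, abs_mul]
      have h1 : |σ ^ 2 - 1| ≤ 1 := abs_le.2 ⟨by nlinarith [sq_nonneg σ], by linarith⟩
      have h2 : |(k : ℝ) + 1| = (k : ℝ) + 1 := abs_of_nonneg (by positivity)
      rw [h2]
      calc _ ≤ 1 * ((k : ℝ) + 1) * √(k.factorial : ℝ) := by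
            gcongr; exact ih k (by omega)
        _ = √(((k : ℝ) + 1) ^ 2 * k.factorial) := by
            rw [Real.sqrt_mul (by positivity), Real.sqrt_sq (by positivity), one_mul]
        _ ≤ _ := by
            apply Real.sqrt_le_sqrt
            rw [Nat.factorial_succ, Nat.factorial_succ]
            push_cast
            have : (0 : ℝ) ≤ k.factorial := by positivity
            have hk : (0 : ℝ) ≤ k := by positivity
            have h3 : ((k : ℝ) + 1) * k.factorial ≥ 0 := by positivity
            nlinarith

section NoisyBernoulliRademacher

variable {ρ σ : ℝ}

theorem hasAllMoments_dirac (a : ℝ) : HasAllMoments (fun x : ℝ => x) (Measure.dirac a) :=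
  HasAllMoments.of_bounded (by fun_prop) ‖a‖ (by rw [ae_dirac_eq]; exact le_refl ‖a‖)

theorem hasAllMoments_noisyBernoulliRademacher :
    HasAllMoments (fun x : ℝ => x) (noisyBernoulliRademacher ρ σ) := by
  intro p
  rcases Nat.eq_zero_or_pos p with rfl | hp
  · rw [Nat.cast_zero, memLp_zero_iff_aestronglyMeasurable]
    exact (measurable_id (α := ℝ)).aestronglyMeasurable
  have hp0 : (p : ENNReal) ≠ 0 := by simpa using hp.ne'
  have key : ∀ {m : Measure ℝ}, MemLp (fun x : ℝ => x) p m ↔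
      Integrable (fun x : ℝ => ‖x‖ ^ (p : ENNReal).toReal) m := fun {m} =>
    (integrable_norm_rpow_iff (measurable_id (α := ℝ)).aestronglyMeasurable hp0 (by simp)).symm
  rw [key]
  have h1 := fun v => key.1 (hasAllMoments_id_gaussianReal v p)
  have h2 := fun a => key.1 (hasAllMoments_dirac a p)
  unfold noisyBernoulliRademacher
  exact (((h1 _).smul_measure ENNReal.ofReal_ne_top).add_measure
    ((h2 _).smul_measure ENNReal.ofReal_ne_top)).add_measure
    ((h2 _).smul_measure ENNReal.ofReal_ne_top)

theorem integral_noisyBernoulliRademacher (h0 : 0 ≤ ρ) (h1 : ρ ≤ 1) {f : ℝ → ℝ}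
    (hf : Integrable f (gaussianReal 0 (σ ^ 2).toNNReal)) :
    ∫ x, f x ∂noisyBernoulliRademacher ρ σ
      = (1 - ρ) * ∫ x, f x ∂gaussianReal 0 (σ ^ 2).toNNReal
        + ρ / 2 * f (1 / √(ρ / (1 - (1 - ρ) * σ ^ 2)))
        + ρ / 2 * f (-(1 / √(ρ / (1 - (1 - ρ) * σ ^ 2)))) := by
  have hd : ∀ a, Integrable f (ENNReal.ofReal (ρ / 2) • Measure.dirac a) := fun a =>
    Integrable.smul_measure (integrable_dirac (by simp)) ENNReal.ofReal_ne_top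
  have hg := Integrable.smul_measure hf (c := ENNReal.ofReal (1 - ρ)) ENNReal.ofReal_ne_top
  unfold noisyBernoulliRademacher
  rw [integral_add_measure (hg.add_measure (hd _)) (hd _), integral_add_measure hg (hd _),
    integral_smul_measure, integral_smul_measure, integral_smul_measure,
    integral_dirac, integral_dirac,
    ENNReal.toReal_ofReal (by linarith), ENNReal.toReal_ofReal (by linarith)]
  simp only [smul_eq_mul]

/-- The `k`-th Hermite moment of the noisy Bernoulli–Rademacher distribution. -/
noncomputable def hermiteMoment (ρ σ : ℝ) (k : ℕ) : ℝ :=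
  ∫ x, (realHermite k).eval x ∂noisyBernoulliRademacher ρ σ

theorem hermiteMoment_eq (h0 : 0 ≤ ρ) (h1 : ρ ≤ 1) (k : ℕ) :
    hermiteMoment ρ σ k = (1 - ρ) * ∫ x, (realHermite k).eval x ∂gaussianReal 0 (σ ^ 2).toNNReal
        + ρ / 2 * (1 + (-1) ^ k) * (realHermite k).eval (1 / √(ρ / (1 - (1 - ρ) * σ ^ 2))) := by
  rw [hermiteMoment, integral_noisyBernoulliRademacher h0 h1
    ((hasAllMoments_id_gaussianReal _).eval_polynomial _).integrable,
    eval_neg_realHermite]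
  ring

theorem hermiteMoment_of_odd (h0 : 0 ≤ ρ) (h1 : ρ ≤ 1) {k : ℕ} (hk : Odd k) :
    hermiteMoment ρ σ k = 0 := by
  rw [hermiteMoment_eq h0 h1, integral_realHermite_gaussian_sq_of_odd σ hk, hk.neg_one_pow]
  ring

theorem hermiteMoment_zero (h0 : 0 ≤ ρ) (h1 : ρ ≤ 1) : hermiteMoment ρ σ 0 = 1 := by
  rw [hermiteMoment_eq h0 h1]
  simp [realHermite_zero]
  ring

theorem sq_one_div_sqrt (h : 0 ≤ 1 - (1 - ρ) * σ ^ 2) (h0 : 0 < ρ) :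
    (1 / √(ρ / (1 - (1 - ρ) * σ ^ 2))) ^ 2 = (1 - (1 - ρ) * σ ^ 2) / ρ := by
  rw [div_pow, Real.sq_sqrt (by positivity), one_pow, one_div_div]

/-- The second Hermite moment vanishes because the distribution has unit variance. -/
theorem hermiteMoment_two (h0 : 0 < ρ) (h1 : ρ ≤ 1) (h : 0 ≤ 1 - (1 - ρ) * σ ^ 2) :
    hermiteMoment ρ σ 2 = 0 := by
  rw [hermiteMoment_eq h0.le h1, integral_realHermite_add_two_gaussian_sq σ 0]
  have e : (realHermite 2).eval (1 / √(ρ / (1 - (1 - ρ) * σ ^ 2)))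
      = (1 / √(ρ / (1 - (1 - ρ) * σ ^ 2))) ^ 2 - 1 := by
    rw [realHermite_add_two]; simp [realHermite_succ, realHermite_zero]; ring
  rw [e, sq_one_div_sqrt h h0]
  simp [realHermite_zero]
  field_simp
  ring

/-- The Hermite moments grow at most like powers of the squared atoms, which are at most `1 / ρ`.
The two atoms contribute the factor `ρ²`; the Gaussian part, of size one, is absorbed because
`ρ * (4 / ρ) ^ (k / 2) ≥ 1`. -/
theorem sq_hermiteMoment_le (h0 : 0 < ρ) (h1 : ρ ≤ 1) (hσ : σ ^ 2 ≤ 1) {k : ℕ} (hk : 2 ≤ k) :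
    hermiteMoment ρ σ k ^ 2 / k.factorial ≤ 4 * ρ ^ 2 * (4 / ρ) ^ k := by
  rcases Nat.even_or_odd k with hev | hodd
  swap
  · rw [hermiteMoment_of_odd h0.le h1 hodd]
    simp only [ne_eq, OfNat.ofNat_ne_zero, not_false_eq_true, zero_pow, zero_div]
    positivity
  obtain ⟨j, rfl⟩ := hev.two_dvd
  have hj : 1 ≤ j := by omega
  have hpos : 0 ≤ 1 - (1 - ρ) * σ ^ 2 := by nlinarith [sq_nonneg σ]
  set a := 1 / √(ρ / (1 - (1 - ρ) * σ ^ 2)) with ha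
  have ha0 : 0 ≤ a := by positivity
  have ha2 : a ^ 2 ≤ 1 / ρ := by
    rw [ha, sq_one_div_sqrt hpos h0]
    gcongr
    nlinarith [sq_nonneg σ]
  have hρ1 : 1 ≤ 1 / ρ := by rw [le_div_iff₀ h0]; linarith
  have ha3 : (1 + a) ^ 2 ≤ 4 / ρ := by
    have : 4 / ρ = 4 * (1 / ρ) := by ring
    rw [this]
    nlinarith [sq_nonneg (1 - a)]
  have hone : 1 ≤ ρ * (4 / ρ) ^ j := by
    have h4 : 1 ≤ 4 / ρ := by rw [le_div_iff₀ h0]; linarith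
    calc (1 : ℝ) ≤ ρ * (4 / ρ) ^ 1 := by rw [pow_one, mul_div_cancel₀ _ h0.ne']; norm_num
      _ ≤ _ := by gcongr
  set f := √((2 * j).factorial : ℝ) with hf
  have hf2 : f ^ 2 = ((2 * j).factorial : ℝ) := Real.sq_sqrt (by positivity)
  have hf0 : 0 ≤ f := Real.sqrt_nonneg _
  have hc : |hermiteMoment ρ σ (2 * j)| ≤ f * (2 * ρ * (4 / ρ) ^ j) := by
    rw [hermiteMoment_eq h0.le h1, Even.neg_one_pow (even_two_mul j)]
    have e1 := abs_integral_realHermite_gaussian_sq_le hσ (2 * j)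
    have e2 := abs_eval_realHermite_le (2 * j) a
    rw [abs_of_nonneg ha0, pow_mul] at e2
    refine (abs_add_le _ _).trans ?_
    rw [abs_mul, abs_mul, abs_of_nonneg (by linarith : 0 ≤ 1 - ρ),
      show ρ / 2 * (1 + 1) = ρ by ring, abs_of_nonneg h0.le]
    calc _ ≤ (1 - ρ) * f + ρ * (f * (4 / ρ) ^ j) := by
          refine add_le_add (mul_le_mul_of_nonneg_left e1 (by linarith))
            (mul_le_mul_of_nonneg_left (e2.trans ?_) h0.le)
          gcongr
      _ ≤ f * (ρ * (4 / ρ) ^ j) + ρ * (f * (4 / ρ) ^ j) := by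
          have h2 := mul_le_mul_of_nonneg_left hone hf0
          have h3 := mul_nonneg h0.le hf0
          refine add_le_add ?_ le_rfl
          linarith
      _ = _ := by ring
  rw [div_le_iff₀ (by positivity), ← sq_abs, ← hf2]
  calc |hermiteMoment ρ σ (2 * j)| ^ 2 ≤ (f * (2 * ρ * (4 / ρ) ^ j)) ^ 2 := by gcongr
    _ = _ := by rw [mul_comm 2 j, pow_mul]; ring

end NoisyBernoulliRademacher

/-! ### The conditional likelihood ratio given the hidden direction -/

section ConditionalRatio

variable {n d : ℕ}

/-- The multi-indices of total degree at most `D`. -/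
def hermiteIndices (n D : ℕ) : Finset (Fin n → ℕ) :=
  (Fintype.piFinset fun _ => Finset.range (D + 1)).filter fun k => ∑ i, k i ≤ D

/-- The linear form `A ↦ ∑ j, u j * A i j` of the `i`-th row. -/
noncomputable def rowForm (i : Fin n) (u : Fin d → ℝ) : MvPolynomial (Fin n × Fin d) ℝ :=
  ∑ j, MvPolynomial.C (u j) * MvPolynomial.X (i, j)

/-- The degree-`D` likelihood ratio of the planted distribution conditioned on the hidden direction
`u`: the truncation to total degree `D` of `∏ i, ∑ k, (E[He_k] / k!) He_k(⟨u, A i⟩)`. -/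
noncomputable def directionalRatio (n : ℕ) (ρ σ : ℝ) (D : ℕ) (u : Fin d → ℝ) :
    MvPolynomial (Fin n × Fin d) ℝ :=
  ∑ k ∈ hermiteIndices n D, ∏ i, MvPolynomial.C (hermiteMoment ρ σ (k i) / (k i).factorial) *
    Polynomial.aeval (rowForm i u) (realHermite (k i))

theorem evalMatrix_rowForm (i : Fin n) (u : Fin d → ℝ) (A : Fin n → Fin d → ℝ) :
    evalMatrix (rowForm i u) A = u ⬝ᵥ A i := by
  simp [evalMatrix, rowForm, dotProduct]

theorem evalMatrix_aeval_rowForm (P : Polynomial ℝ) (i : Fin n) (u : Fin d → ℝ)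
    (A : Fin n → Fin d → ℝ) :
    evalMatrix (Polynomial.aeval (rowForm i u) P) A = P.eval (u ⬝ᵥ A i) := by
  rw [← evalMatrix_rowForm, evalMatrix, evalMatrix, Polynomial.aeval_def, Polynomial.hom_eval₂]
  have : (MvPolynomial.eval fun e : Fin n × Fin d => A e.1 e.2).comp
      (algebraMap ℝ (MvPolynomial (Fin n × Fin d) ℝ)) = RingHom.id ℝ := by
    ext; simp
  rw [this]; rfl

theorem evalMatrix_directionalRatio (ρ σ : ℝ) (D : ℕ) (u : Fin d → ℝ)
    (A : Fin n → Fin d → ℝ) :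
    evalMatrix (directionalRatio n ρ σ D u) A = ∑ k ∈ hermiteIndices n D,
      ∏ i, (hermiteMoment ρ σ (k i) / (k i).factorial * (realHermite (k i)).eval (u ⬝ᵥ A i)) := by
  have h := fun (k : ℕ) (i : Fin n) => evalMatrix_aeval_rowForm (realHermite k) i u A
  simp only [evalMatrix] at h
  simp only [evalMatrix, directionalRatio, map_sum, map_prod, map_mul, MvPolynomial.eval_C, h]

theorem totalDegree_aeval_le {τ : Type*} {p : MvPolynomial τ ℝ} (hp : p.totalDegree ≤ 1)
    (P : Polynomial ℝ) : (Polynomial.aeval p P).totalDegree ≤ P.natDegree := by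
  rw [Polynomial.aeval_eq_sum_range]
  refine MvPolynomial.totalDegree_finsetSum_le fun i hi => ?_
  refine (MvPolynomial.totalDegree_smul_le _ _).trans
    ((MvPolynomial.totalDegree_pow _ _).trans ?_)
  have := Finset.mem_range.1 hi
  calc i * p.totalDegree ≤ i * 1 := by gcongr
    _ ≤ P.natDegree := by omega

theorem totalDegree_sum_C_mul_X_le {τ κ : Type*} [Fintype κ] (u : κ → ℝ) (e : κ → τ) :
    (∑ j, MvPolynomial.C (u j) * MvPolynomial.X (e j) : MvPolynomial τ ℝ).totalDegree ≤ 1 := by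
  refine MvPolynomial.totalDegree_finsetSum_le fun j _ => ?_
  refine (MvPolynomial.totalDegree_mul _ _).trans ?_
  simp

theorem totalDegree_directionalRatio_le (ρ σ : ℝ) (D : ℕ) (u : Fin d → ℝ) :
    (directionalRatio n ρ σ D u).totalDegree ≤ D := by
  refine MvPolynomial.totalDegree_finsetSum_le fun k hk => ?_
  refine (MvPolynomial.totalDegree_finsetProd _ _).trans
    (le_trans (Finset.sum_le_sum fun i _ => ?_) (Finset.mem_filter.1 hk).2)
  refine (MvPolynomial.totalDegree_mul _ _).trans ?_
  rw [MvPolynomial.totalDegree_C, zero_add]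
  refine (totalDegree_aeval_le (totalDegree_sum_C_mul_X_le u fun j => (i, j)) _).trans ?_
  rw [natDegree_realHermite]

theorem HasAllMoments.evalMatrix {m : Measure (Fin n → Fin d → ℝ)} [IsFiniteMeasure m]
    (h : ∀ i j, HasAllMoments (fun A => A i j) m) (p : MvPolynomial (Fin n × Fin d) ℝ) :
    HasAllMoments (fun A => evalMatrix p A) m := by
  have h2 := HasAllMoments.eval_mvPolynomial
    (F := fun (A : Fin n → Fin d → ℝ) (e : Fin n × Fin d) => A e.1 e.2) (fun e => h e.1 e.2) p
  exact h2

theorem hasAllMoments_evalMatrix_nullMeasure (p : MvPolynomial (Fin n × Fin d) ℝ) :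
    HasAllMoments (fun A => evalMatrix p A) (nullMeasure n d) :=
  HasAllMoments.evalMatrix hasAllMoments_nullMeasure p

/-- The covariance under the null distribution of the conditional likelihood ratios in two
directions: a polynomial in the overlap `⟨u, w⟩` with nonnegative coefficients. -/
theorem integral_directionalRatio_mul_directionalRatio (ρ σ : ℝ) (D : ℕ) {u w : Fin d → ℝ}
    (hu : u ⬝ᵥ u = 1) (hw : w ⬝ᵥ w = 1) :
    ∫ A, evalMatrix (directionalRatio n ρ σ D u) A * evalMatrix (directionalRatio n ρ σ D w) A
        ∂nullMeasure n d
      = ∑ k ∈ hermiteIndices n D,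
        (∏ i, hermiteMoment ρ σ (k i) ^ 2 / (k i).factorial) * (u ⬝ᵥ w) ^ ∑ i, k i := by
  simp only [evalMatrix_directionalRatio, Finset.sum_mul_sum, ← Finset.prod_mul_distrib]
  have hint : ∀ (v : Fin d → ℝ) (k : Fin n → ℕ), HasAllMoments (fun A : Fin n → Fin d → ℝ =>
      ∏ i, (hermiteMoment ρ σ (k i) / (k i).factorial * (realHermite (k i)).eval (v ⬝ᵥ A i)))
      (nullMeasure n d) := by
    intro v k
    refine HasAllMoments.prod _ fun i _ => (HasAllMoments.const _).mul ?_
    simpa only [evalMatrix_aeval_rowForm] using hasAllMoments_evalMatrix_nullMeasure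
      (Polynomial.aeval (rowForm i v) (realHermite (k i)))
  have hint2 := fun k l => ((hint u k).mul (hint w l)).integrable
  simp only [← Finset.prod_mul_distrib] at hint2
  rw [integral_finsetSum _ fun k _ => integrable_finsetSum _ fun l _ => hint2 k l]
  refine Finset.sum_congr rfl fun k hk => ?_
  rw [integral_finsetSum _ fun l _ => hint2 k l]
  have key : ∀ l : Fin n → ℕ, ∫ A : Fin n → Fin d → ℝ, ∏ i,
      (hermiteMoment ρ σ (k i) / (k i).factorial * (realHermite (k i)).eval (u ⬝ᵥ A i) *
        (hermiteMoment ρ σ (l i) / (l i).factorial * (realHermite (l i)).eval (w ⬝ᵥ A i)))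
        ∂nullMeasure n d
      = ∏ i, (hermiteMoment ρ σ (k i) / (k i).factorial *
          (hermiteMoment ρ σ (l i) / (l i).factorial) *
          if k i = l i then ((k i).factorial : ℝ) * (u ⬝ᵥ w) ^ (k i) else 0) := by
    intro l
    rw [nullMeasure, integral_fintype_prod_eq_prod (fun i (x : Fin d → ℝ) =>
      hermiteMoment ρ σ (k i) / (k i).factorial * (realHermite (k i)).eval (u ⬝ᵥ x) *
        (hermiteMoment ρ σ (l i) / (l i).factorial * (realHermite (l i)).eval (w ⬝ᵥ x)))]
    refine Finset.prod_congr rfl fun i _ => ?_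
    simp_rw [mul_mul_mul_comm]
    rw [integral_const_mul, integral_realHermite_dotProduct_mul_realHermite hu hw]
  simp_rw [key]
  rw [Finset.sum_eq_single k]
  · rw [← Finset.prod_pow_eq_pow_sum, ← Finset.prod_mul_distrib]
    refine Finset.prod_congr rfl fun i _ => ?_
    rw [if_pos rfl]
    have : ((k i).factorial : ℝ) ≠ 0 := by positivity
    field_simp
  · intro l _ hl
    obtain ⟨i, hi⟩ := Function.ne_iff.1 hl
    exact Finset.prod_eq_zero (Finset.mem_univ i) (by rw [if_neg hi.symm, mul_zero])
  · exact fun h => absurd hk h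

/-! ### Low-degree moments of the hidden matrix -/

theorem evalMatrix_monomial (s : Fin n × Fin d →₀ ℕ) (a : ℝ) (A : Fin n → Fin d → ℝ) :
    evalMatrix (MvPolynomial.monomial s a) A = a * ∏ i, ∏ j, A i j ^ s (i, j) := by
  rw [evalMatrix, MvPolynomial.eval_monomial, Finsupp.prod_fintype _ _ (by simp),
    Fintype.prod_prod_type]

variable {ρ σ : ℝ}

theorem isProbabilityMeasure_hiddenEntry (h0 : 0 ≤ ρ) (h1 : ρ ≤ 1) (j : Fin d) :
    IsProbabilityMeasure
      (if (j : ℕ) = 0 then noisyBernoulliRademacher ρ σ else gaussianReal 0 1) := by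
  have := isProbabilityMeasure_noisyBernoulliRademacher (σ := σ) h0 h1
  split_ifs <;> infer_instance

theorem isProbabilityMeasure_hiddenMeasure (h0 : 0 ≤ ρ) (h1 : ρ ≤ 1) :
    IsProbabilityMeasure (hiddenMeasure n d ρ σ) := by
  have := fun j : Fin d => isProbabilityMeasure_hiddenEntry (σ := σ) h0 h1 j
  unfold hiddenMeasure; infer_instance

theorem hasAllMoments_hiddenMeasure (h0 : 0 ≤ ρ) (h1 : ρ ≤ 1) (i : Fin n) (j : Fin d) :
    HasAllMoments (fun A : Fin n → Fin d → ℝ => A i j) (hiddenMeasure n d ρ σ) := by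
  have := fun j : Fin d => isProbabilityMeasure_hiddenEntry (σ := σ) h0 h1 j
  have h : HasAllMoments (fun x : ℝ => x)
      (if (j : ℕ) = 0 then noisyBernoulliRademacher ρ σ else gaussianReal 0 1) := by
    split_ifs
    · exact hasAllMoments_noisyBernoulliRademacher
    · exact hasAllMoments_id_gaussianReal 1
  exact (h.comp_measurePreserving (measurePreserving_eval (fun j : Fin d =>
    if (j : ℕ) = 0 then noisyBernoulliRademacher ρ σ else gaussianReal 0 1) j)
    ).comp_measurePreserving (measurePreserving_eval (fun _ : Fin n => Measure.pi fun j : Fin d =>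
    if (j : ℕ) = 0 then noisyBernoulliRademacher ρ σ else gaussianReal 0 1) i)

theorem hasAllMoments_evalMatrix_hiddenMeasure (h0 : 0 ≤ ρ) (h1 : ρ ≤ 1)
    (p : MvPolynomial (Fin n × Fin d) ℝ) :
    HasAllMoments (fun A => evalMatrix p A) (hiddenMeasure n d ρ σ) := by
  have := isProbabilityMeasure_hiddenMeasure (n := n) (d := d) (σ := σ) h0 h1
  exact HasAllMoments.evalMatrix (hasAllMoments_hiddenMeasure h0 h1) p

theorem integral_monomial_hiddenMeasure [NeZero d] (h0 : 0 ≤ ρ) (h1 : ρ ≤ 1)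
    (s : Fin n × Fin d →₀ ℕ) (a : ℝ) :
    ∫ A, evalMatrix (MvPolynomial.monomial s a) A ∂hiddenMeasure n d ρ σ
      = a * ∏ i, ((∫ x, x ^ s (i, 0) ∂noisyBernoulliRademacher ρ σ) *
        ∏ j ∈ Finset.univ.erase 0, ∫ x, x ^ s (i, j) ∂gaussianReal 0 1) := by
  have := fun j : Fin d => isProbabilityMeasure_hiddenEntry (σ := σ) h0 h1 j
  simp_rw [evalMatrix_monomial]
  rw [integral_const_mul, hiddenMeasure,
    integral_fintype_prod_eq_prod (fun i (x : Fin d → ℝ) => ∏ j, x j ^ s (i, j))]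
  congr 1
  refine Finset.prod_congr rfl fun i _ => ?_
  rw [integral_fintype_prod_eq_prod (fun j (x : ℝ) => x ^ s (i, j)),
    ← Finset.mul_prod_erase _ _ (Finset.mem_univ 0)]
  rw [if_pos (by simp)]
  congr 1
  refine Finset.prod_congr rfl fun j hj => ?_
  rw [if_neg (by simpa [Fin.val_eq_zero_iff] using hj)]

theorem integral_row_monomial_mul (d : ℕ) [NeZero d] (s : Fin d → ℕ) (P : Polynomial ℝ) :
    ∫ x : Fin d → ℝ, (∏ j, x j ^ s j) * P.eval (x 0) ∂(Measure.pi fun _ => gaussianReal 0 1)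
      = (∫ x, P.eval x * x ^ s 0 ∂gaussianReal 0 1) *
        ∏ j ∈ Finset.univ.erase 0, ∫ x, x ^ s j ∂gaussianReal 0 1 := by
  have e : ∀ x : Fin d → ℝ, (∏ j, x j ^ s j) * P.eval (x 0)
      = ∏ j, (if j = 0 then P.eval (x j) * x j ^ s j else x j ^ s j) := by
    intro x
    rw [← Finset.mul_prod_erase _ _ (Finset.mem_univ 0),
      ← Finset.mul_prod_erase _ (fun j => if j = 0 then P.eval (x j) * x j ^ s j else x j ^ s j)
        (Finset.mem_univ 0), if_pos rfl,
      Finset.prod_congr rfl fun j hj => if_neg (Finset.ne_of_mem_erase hj)]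
    ring
  simp_rw [e]
  rw [integral_fintype_prod_eq_prod (fun j (x : ℝ) =>
    if j = 0 then P.eval x * x ^ s j else x ^ s j), ← Finset.mul_prod_erase _ _ (Finset.mem_univ 0)]
  congr 1
  refine Finset.prod_congr rfl fun j hj => ?_
  simp only [if_neg (Finset.ne_of_mem_erase hj)]

/-- For the first coordinate vector as hidden direction, `directionalRatio` is the likelihood ratio
of the hidden matrix on monomials of degree at most `D`. -/
theorem integral_monomial_mul_directionalRatio [NeZero d] (h0 : 0 ≤ ρ) (h1 : ρ ≤ 1) {D : ℕ}
    (s : Fin n × Fin d →₀ ℕ) (a : ℝ) (hs : ∑ e, s e ≤ D) :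
    ∫ A, evalMatrix (MvPolynomial.monomial s a) A *
        evalMatrix (directionalRatio n ρ σ D (Pi.single 0 1)) A ∂nullMeasure n d
      = a * ∏ i, ((∫ x, x ^ s (i, 0) ∂noisyBernoulliRademacher ρ σ) *
        ∏ j ∈ Finset.univ.erase 0, ∫ x, x ^ s (i, j) ∂gaussianReal 0 1) := by
  have := isProbabilityMeasure_noisyBernoulliRademacher (σ := σ) h0 h1
  have hsi : ∑ i, s (i, 0) ≤ D := by
    refine le_trans (Finset.sum_le_sum fun i _ => ?_) ((Fintype.sum_prod_type _).symm.le.trans hs)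
    exact Finset.single_le_sum (f := fun j => s (i, j)) (fun _ _ => Nat.zero_le _)
      (Finset.mem_univ 0)
  simp_rw [evalMatrix_monomial, evalMatrix_directionalRatio, single_one_dotProduct, mul_assoc a]
  rw [integral_const_mul]
  simp_rw [Finset.mul_sum, ← Finset.prod_mul_distrib]
  congr 1
  have hint : ∀ k : Fin n → ℕ, Integrable (fun A : Fin n → Fin d → ℝ =>
      ∏ i, ((∏ j, A i j ^ s (i, j)) * (hermiteMoment ρ σ (k i) / (k i).factorial *
        (realHermite (k i)).eval (A i 0)))) (nullMeasure n d) := fun k =>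
    (HasAllMoments.prod _ fun i _ => (HasAllMoments.prod _ fun j _ =>
      (hasAllMoments_nullMeasure i j).pow _).mul ((HasAllMoments.const _).mul
        ((hasAllMoments_nullMeasure i 0).eval_polynomial _))).integrable
  rw [integral_finsetSum _ fun k _ => hint k]
  have key : ∀ k : Fin n → ℕ, ∫ A : Fin n → Fin d → ℝ,
      ∏ i, ((∏ j, A i j ^ s (i, j)) * (hermiteMoment ρ σ (k i) / (k i).factorial *
        (realHermite (k i)).eval (A i 0))) ∂nullMeasure n d
      = ∏ i, (hermiteMoment ρ σ (k i) / (k i).factorial *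
        (∫ x, (realHermite (k i)).eval x * x ^ s (i, 0) ∂gaussianReal 0 1) *
        ∏ j ∈ Finset.univ.erase 0, ∫ x, x ^ s (i, j) ∂gaussianReal 0 1) := by
    intro k
    rw [nullMeasure, integral_fintype_prod_eq_prod (fun i (x : Fin d → ℝ) =>
      (∏ j, x j ^ s (i, j)) * (hermiteMoment ρ σ (k i) / (k i).factorial *
        (realHermite (k i)).eval (x 0)))]
    refine Finset.prod_congr rfl fun i _ => ?_
    simp_rw [mul_left_comm _ (hermiteMoment ρ σ (k i) / (k i).factorial)]
    rw [integral_const_mul, integral_row_monomial_mul d (fun j => s (i, j))]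
    ring
  simp_rw [key]
  -- Multi-indices of total degree above `D` exceed the exponent of some entry of the first column.
  have hext : ∑ k ∈ hermiteIndices n D, ∏ i, (hermiteMoment ρ σ (k i) / (k i).factorial *
        (∫ x, (realHermite (k i)).eval x * x ^ s (i, 0) ∂gaussianReal 0 1) *
        ∏ j ∈ Finset.univ.erase 0, ∫ x, x ^ s (i, j) ∂gaussianReal 0 1)
      = ∑ k ∈ Fintype.piFinset fun _ : Fin n => Finset.range (D + 1),
        ∏ i, (hermiteMoment ρ σ (k i) / (k i).factorial *
        (∫ x, (realHermite (k i)).eval x * x ^ s (i, 0) ∂gaussianReal 0 1) *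
        ∏ j ∈ Finset.univ.erase 0, ∫ x, x ^ s (i, j) ∂gaussianReal 0 1) := by
    refine Finset.sum_filter_of_ne fun k _ hk => ?_
    by_contra hD
    have : ∃ i, s (i, 0) < k i := by
      by_contra hcon
      push Not at hcon
      exact hD ((Finset.sum_le_sum fun i _ => hcon i).trans hsi)
    obtain ⟨i, hi⟩ := this
    refine hk (Finset.prod_eq_zero (Finset.mem_univ i) ?_)
    have h2 := integral_realHermite_mul_eq_zero (k := k i) (P := Polynomial.X ^ s (i, 0))
      (by simpa using hi)
    simp only [Polynomial.eval_pow, Polynomial.eval_X] at h2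
    rw [h2]; ring
  rw [hext, ← Finset.prod_univ_sum (fun _ : Fin n => Finset.range (D + 1)) (fun i k =>
      hermiteMoment ρ σ k / k.factorial *
        (∫ x, (realHermite k).eval x * x ^ s (i, 0) ∂gaussianReal 0 1) *
        ∏ j ∈ Finset.univ.erase 0, ∫ x, x ^ s (i, j) ∂gaussianReal 0 1)]
  refine Finset.prod_congr rfl fun i _ => ?_
  rw [← Finset.sum_mul]
  congr 1
  have h2 := integral_eq_sum_hermite (m := noisyBernoulliRademacher ρ σ)
    hasAllMoments_noisyBernoulliRademacher D (Polynomial.X ^ s (i, 0))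
    (by
      rw [Polynomial.natDegree_X_pow]
      exact (Finset.single_le_sum (f := fun i => s (i, 0)) (fun _ _ => Nat.zero_le _)
        (Finset.mem_univ i)).trans hsi)
  simp only [Polynomial.eval_pow, Polynomial.eval_X] at h2
  exact h2.symm

/-- Integrals of low-degree polynomials of the hidden matrix, in terms of the null distribution. -/
theorem integral_hiddenMeasure_eq [NeZero d] (h0 : 0 ≤ ρ) (h1 : ρ ≤ 1) {D : ℕ}
    (p : MvPolynomial (Fin n × Fin d) ℝ) (hp : p.totalDegree ≤ D) :
    ∫ A, evalMatrix p A ∂hiddenMeasure n d ρ σ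
      = ∫ A, evalMatrix p A * evalMatrix (directionalRatio n ρ σ D (Pi.single 0 1)) A
        ∂nullMeasure n d := by
  have e : ∀ A : Fin n → Fin d → ℝ, evalMatrix p A
      = ∑ s ∈ p.support, evalMatrix (MvPolynomial.monomial s (p.coeff s)) A := by
    intro A
    conv_lhs => rw [p.as_sum]
    simp only [evalMatrix, map_sum]
  simp_rw [e, Finset.sum_mul]
  rw [integral_finsetSum _ fun s _ => (hasAllMoments_evalMatrix_hiddenMeasure h0 h1 _).integrable,
    integral_finsetSum _ fun s _ => ((hasAllMoments_evalMatrix_nullMeasure _).mul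
      (hasAllMoments_evalMatrix_nullMeasure _)).integrable]
  refine Finset.sum_congr rfl fun s hs => ?_
  rw [integral_monomial_hiddenMeasure h0 h1, integral_monomial_mul_directionalRatio h0 h1]
  have h2 := (MvPolynomial.le_totalDegree hs).trans hp
  rwa [Finsupp.sum_fintype _ _ (by simp)] at h2

end ConditionalRatio

/-! ### Rotations of Gaussian vectors and matrices -/

section Rotations

variable {n d : ℕ}

/-- The standard Gaussian on `ℝᵈ` is invariant under orthogonal matrices. -/
theorem measurePreserving_mulVec_gaussian {O : Matrix (Fin d) (Fin d) ℝ}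
    (hO : O ∈ Matrix.orthogonalGroup (Fin d) ℝ) :
    MeasurePreserving (fun x : Fin d → ℝ => O.mulVec x)
      (Measure.pi fun _ => gaussianReal 0 1) (Measure.pi fun _ => gaussianReal 0 1) := by
  have hmeas : Measurable fun x : Fin d → ℝ => O.mulVec x :=
    (Continuous.matrix_mulVec continuous_const continuous_id).measurable
  refine ⟨hmeas, ?_⟩
  let f₀ : EuclideanSpace ℝ (Fin d) →ₗᵢ[ℝ] EuclideanSpace ℝ (Fin d) :=
    { toLinearMap := O.toEuclideanLin
      norm_map' := by
        intro x
        have h := (Matrix.mem_orthogonalGroup_iff' _ _).1 hO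
        rw [← sq_eq_sq₀ (norm_nonneg _) (norm_nonneg _), EuclideanSpace.real_norm_sq_eq,
          EuclideanSpace.real_norm_sq_eq]
        have e : ∀ y : Fin d → ℝ, ∑ i, y i ^ 2 = y ⬝ᵥ y := fun y => by
          simp [dotProduct, sq]
        have h2 : O.mulVec x.ofLp ⬝ᵥ O.mulVec x.ofLp = x.ofLp ⬝ᵥ x.ofLp := by
          rw [Matrix.dotProduct_mulVec, Matrix.vecMul_mulVec, ← Matrix.dotProduct_mulVec]
          have h3 : O.transpose * O = 1 := h
          rw [h3, Matrix.one_mulVec]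
        rw [← e, ← e] at h2
        exact h2 }
  let f := f₀.toLinearIsometryEquiv rfl
  apply (MeasurableEquiv.toLp 2 (Fin d → ℝ)).map_measurableEquiv_injective
  have h1 : (Measure.pi fun _ : Fin d => gaussianReal 0 1).map
      (MeasurableEquiv.toLp 2 (Fin d → ℝ)) = stdGaussian (EuclideanSpace ℝ (Fin d)) :=
    map_pi_eq_stdGaussian
  rw [h1, Measure.map_map (MeasurableEquiv.measurable _) hmeas]
  have h2 : (MeasurableEquiv.toLp 2 (Fin d → ℝ)) ∘ (fun x : Fin d → ℝ => O.mulVec x)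
      = f ∘ (MeasurableEquiv.toLp 2 (Fin d → ℝ)) := by
    ext x i
    rfl
  rw [h2, ← Measure.map_map f.continuous.measurable (MeasurableEquiv.measurable _), h1,
    stdGaussian_map f]

theorem measurePreserving_mul_right_nullMeasure {Q : Matrix (Fin d) (Fin d) ℝ}
    (hQ : Q ∈ Matrix.orthogonalGroup (Fin d) ℝ) :
    MeasurePreserving (fun (A : Fin n → Fin d → ℝ) (i : Fin n) (k : Fin d) =>
      ∑ j, A i j * Q j k) (nullMeasure n d) (nullMeasure n d) := by
  have h : Q.transpose ∈ Matrix.orthogonalGroup (Fin d) ℝ := by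
    rw [Matrix.mem_orthogonalGroup_iff']
    simpa using (Matrix.mem_orthogonalGroup_iff _ _).1 hQ
  have h2 := measurePreserving_pi (fun _ : Fin n => Measure.pi fun _ : Fin d => gaussianReal 0 1)
    (fun _ : Fin n => Measure.pi fun _ : Fin d => gaussianReal 0 1)
    (fun _ : Fin n => measurePreserving_mulVec_gaussian h)
  have e : (fun (A : Fin n → Fin d → ℝ) (i : Fin n) (k : Fin d) => ∑ j, A i j * Q j k)
      = fun A i => Q.transpose.mulVec (A i) := by
    ext A i k
    simp [Matrix.mulVec, dotProduct, mul_comm]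
  rw [e]
  exact h2

/-- Orthogonal matrices act transitively on spheres, by Householder reflections. -/
theorem exists_orthogonal_mulVec_eq (x y : Fin d → ℝ) (h : x ⬝ᵥ x = y ⬝ᵥ y) :
    ∃ O ∈ Matrix.orthogonalGroup (Fin d) ℝ, O.mulVec x = y := by
  set v := x - y with hv
  rcases eq_or_ne (v ⬝ᵥ v) 0 with h0 | h0
  · have : v = 0 := dotProduct_self_eq_zero.1 h0
    exact ⟨1, one_mem _, by rw [Matrix.one_mulVec, ← sub_eq_zero, ← hv, this]⟩
  set c := 2 / (v ⬝ᵥ v) with hc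
  have hcv : c * (v ⬝ᵥ v) = 2 := by rw [hc]; field_simp
  refine ⟨1 - c • Matrix.vecMulVec v v, ?_, ?_⟩
  · rw [Matrix.mem_orthogonalGroup_iff]
    have ht : (1 - c • Matrix.vecMulVec v v).transpose = 1 - c • Matrix.vecMulVec v v := by
      simp [Matrix.transpose_vecMulVec]
    rw [ht]
    have h2 : Matrix.vecMulVec v v * Matrix.vecMulVec v v = (v ⬝ᵥ v) • Matrix.vecMulVec v v := by
      rw [Matrix.vecMulVec_mul_vecMulVec]
      ext i j
      simp [Matrix.vecMulVec_apply]
      ring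
    rw [sub_mul, one_mul, mul_sub, mul_one, smul_mul_smul_comm, h2, smul_smul,
      show c * c * (v ⬝ᵥ v) = c + c by rw [mul_assoc, hcv]; ring, add_smul]
    abel
  · have h3 : c * (v ⬝ᵥ x) = 1 := by
      have : v ⬝ᵥ v = 2 * (v ⬝ᵥ x) := by
        simp only [hv, sub_dotProduct, dotProduct_sub]
        rw [dotProduct_comm x y, ← h]; ring
      rw [this] at hcv; linarith
    rw [Matrix.sub_mulVec, Matrix.one_mulVec, Matrix.smul_mulVec, Matrix.vecMulVec_mulVec]
    ext i
    have h4 := congrArg (· * v i) h3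
    simp at h4 ⊢
    simp only [hv, Pi.sub_apply] at h4 ⊢
    linarith

theorem measurePreserving_dotProduct_gaussian [NeZero d] {u : Fin d → ℝ} (hu : u ⬝ᵥ u = 1) :
    MeasurePreserving (fun x : Fin d → ℝ => u ⬝ᵥ x) (Measure.pi fun _ => gaussianReal 0 1)
      (gaussianReal 0 1) := by
  obtain ⟨O, hO, hOu⟩ := exists_orthogonal_mulVec_eq u (Pi.single 0 1) (by rw [hu]; simp)
  have e : (fun x : Fin d → ℝ => u ⬝ᵥ x) = fun x => O.mulVec x 0 := by
    ext x
    have h : O.mulVec u ⬝ᵥ O.mulVec x = u ⬝ᵥ x := by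
      rw [Matrix.dotProduct_mulVec, Matrix.vecMul_mulVec, ← Matrix.dotProduct_mulVec,
        show O.transpose * O = 1 from (Matrix.mem_orthogonalGroup_iff' _ _).1 hO,
        Matrix.one_mulVec]
    rw [← h, hOu, single_one_dotProduct]
  rw [e]
  exact (measurePreserving_eval (fun _ : Fin d => gaussianReal 0 1) 0).comp
    (measurePreserving_mulVec_gaussian hO)

theorem integral_comp_dotProduct_gaussian [NeZero d] (u : Fin d → ℝ) {f : ℝ → ℝ}
    (hf : Measurable f) :
    ∫ x : Fin d → ℝ, f (u ⬝ᵥ x) ∂(Measure.pi fun _ => gaussianReal 0 1)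
      = ∫ x, f (√(u ⬝ᵥ u) * x) ∂gaussianReal 0 1 := by
  have hu : 0 ≤ u ⬝ᵥ u := Finset.sum_nonneg fun i _ => mul_self_nonneg _
  obtain ⟨v, hv, huv⟩ : ∃ v : Fin d → ℝ, v ⬝ᵥ v = 1 ∧ u = √(u ⬝ᵥ u) • v := by
    rcases eq_or_ne (u ⬝ᵥ u) 0 with h0 | h0
    · exact ⟨Pi.single 0 1, by simp, by rw [h0, dotProduct_self_eq_zero.1 h0]; simp⟩
    · have hs : √(u ⬝ᵥ u) ≠ 0 := (Real.sqrt_pos.2 (lt_of_le_of_ne hu h0.symm)).ne'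
      refine ⟨(√(u ⬝ᵥ u))⁻¹ • u, ?_, by rw [smul_smul, mul_inv_cancel₀ hs, one_smul]⟩
      rw [smul_dotProduct, dotProduct_smul, smul_eq_mul, smul_eq_mul, ← mul_assoc, ← mul_inv,
        Real.mul_self_sqrt hu, inv_mul_cancel₀ h0]
  have hmp := measurePreserving_dotProduct_gaussian hv
  have h := integral_map (μ := Measure.pi fun _ : Fin d => gaussianReal 0 1)
    hmp.measurable.aemeasurable (f := fun y => f (√(u ⬝ᵥ u) * y))
    (hf.comp (measurable_const_mul _)).aestronglyMeasurable
  rw [hmp.map_eq] at h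
  rw [h]
  refine integral_congr_ae (ae_of_all _ fun x => ?_)
  simp only
  conv_lhs => rw [huv, smul_dotProduct, smul_eq_mul]

theorem integral_dotProduct_pow_gaussian [NeZero d] {u : Fin d → ℝ} (hu : u ⬝ᵥ u = 1) (k : ℕ) :
    ∫ x : Fin d → ℝ, (u ⬝ᵥ x) ^ k ∂(Measure.pi fun _ => gaussianReal 0 1)
      = ∫ x, x ^ k ∂gaussianReal 0 1 := by
  rw [integral_comp_dotProduct_gaussian u (f := fun x => x ^ k) (by fun_prop), hu]
  simp

/-! ### The uniform distribution on the orthogonal group -/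

theorem ae_mem_orthogonalGroup_haarOrthogonal :
    ∀ᵐ Q ∂haarOrthogonal d, Matrix.of Q ∈ Matrix.orthogonalGroup (Fin d) ℝ := by
  let : MeasurableSpace (Matrix.orthogonalGroup (Fin d) ℝ) := borel _
  have : BorelSpace (Matrix.orthogonalGroup (Fin d) ℝ) := ⟨rfl⟩
  have hm : Measurable (fun (Q : Matrix.orthogonalGroup (Fin d) ℝ) (i j : Fin d) =>
      (Q : Matrix (Fin d) (Fin d) ℝ) i j) :=
    (continuous_pi fun i => continuous_pi fun j =>
      continuous_subtype_val.matrix_elem i j).measurable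
  refine (ae_map_iff hm.aemeasurable ?_).2 (ae_of_all _ fun Q => Q.2)
  exact ((isClosed_unitary (R := Matrix (Fin d) (Fin d) ℝ)).preimage (f := Matrix.of)
    (continuous_id : Continuous fun Q : Fin d → Fin d → ℝ => Q)).measurableSet

/-- The uniform distribution on the orthogonal group is invariant under right multiplication. -/
theorem measurePreserving_mul_right_haarOrthogonal {O : Matrix (Fin d) (Fin d) ℝ}
    (hO : O ∈ Matrix.orthogonalGroup (Fin d) ℝ) :
    MeasurePreserving (fun (Q : Fin d → Fin d → ℝ) (i k : Fin d) => ∑ j, Q i j * O j k)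
      (haarOrthogonal d) (haarOrthogonal d) := by
  let : MeasurableSpace (Matrix.orthogonalGroup (Fin d) ℝ) := borel _
  have : BorelSpace (Matrix.orthogonalGroup (Fin d) ℝ) := ⟨rfl⟩
  have hm : Measurable (fun (Q : Matrix.orthogonalGroup (Fin d) ℝ) (i j : Fin d) =>
      (Q : Matrix (Fin d) (Fin d) ℝ) i j) :=
    (continuous_pi fun i => continuous_pi fun j =>
      continuous_subtype_val.matrix_elem i j).measurable
  set μ := Measure.haarMeasure (⊤ : TopologicalSpace.PositiveCompacts
      (Matrix.orthogonalGroup (Fin d) ℝ)) with hμ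
  have hprob : IsProbabilityMeasure μ := by
    have h := Measure.haarMeasure_self
      (K₀ := (⊤ : TopologicalSpace.PositiveCompacts (Matrix.orthogonalGroup (Fin d) ℝ)))
    rw [TopologicalSpace.PositiveCompacts.coe_top] at h
    exact ⟨h⟩
  have hr : μ.map (fun Q => Q * (⟨O, hO⟩ : Matrix.orthogonalGroup (Fin d) ℝ)) = μ := by
    have hp : IsProbabilityMeasure
        (μ.map (fun Q => Q * (⟨O, hO⟩ : Matrix.orthogonalGroup (Fin d) ℝ))) :=
      Measure.isProbabilityMeasure_map (measurable_mul_const _).aemeasurable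
    have h := Measure.isMulInvariant_eq_smul_of_compactSpace
      (μ.map (fun Q => Q * (⟨O, hO⟩ : Matrix.orthogonalGroup (Fin d) ℝ))) μ
    have h1 := congrArg (fun m => m Set.univ) h
    simp only [Measure.smul_apply, measure_univ] at h1
    rw [h]
    rw [ENNReal.smul_def, smul_eq_mul, mul_one] at h1
    have h2 : (Measure.haarScalarFactor
      (μ.map (fun Q => Q * (⟨O, hO⟩ : Matrix.orthogonalGroup (Fin d) ℝ))) μ) = 1 := by
      exact_mod_cast h1.symm
    rw [h2, one_smul]
  have hf : Measurable fun (Q : Fin d → Fin d → ℝ) (i k : Fin d) => ∑ j, Q i j * O j k := by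
    fun_prop
  refine ⟨hf, ?_⟩
  have hdef : haarOrthogonal d = μ.map
      (fun (Q : Matrix.orthogonalGroup (Fin d) ℝ) (i j : Fin d) =>
        (Q : Matrix (Fin d) (Fin d) ℝ) i j) := rfl
  rw [hdef, Measure.map_map hf hm]
  conv_rhs => rw [← hr, Measure.map_map hm (measurable_mul_const _)]
  rfl

theorem hasAllMoments_haarOrthogonal (i j : Fin d) :
    HasAllMoments (fun Q : Fin d → Fin d → ℝ => Q i j) (haarOrthogonal d) := by
  refine HasAllMoments.of_bounded (Measurable.aestronglyMeasurable (by fun_prop)) 1 ?_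
  filter_upwards [ae_mem_orthogonalGroup_haarOrthogonal] with Q hQ
  exact entry_norm_bound_of_unitary hQ i j

theorem dotProduct_row_of_mem_orthogonalGroup {Q : Fin d → Fin d → ℝ}
    (hQ : Matrix.of Q ∈ Matrix.orthogonalGroup (Fin d) ℝ) (i k : Fin d) :
    Q i ⬝ᵥ Q k = if i = k then 1 else 0 := by
  have h := congrFun (congrFun ((Matrix.mem_orthogonalGroup_iff _ _).1 hQ) i) k
  rw [Matrix.one_apply] at h
  rw [← h]
  simp [Matrix.mul_apply, dotProduct]

theorem integral_row_dotProduct_pow_haarOrthogonal_eq [NeZero d] {x y : Fin d → ℝ}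
    (h : x ⬝ᵥ x = y ⬝ᵥ y) (k : ℕ) :
    ∫ Q, (Q 0 ⬝ᵥ x) ^ k ∂haarOrthogonal d = ∫ Q, (Q 0 ⬝ᵥ y) ^ k ∂haarOrthogonal d := by
  obtain ⟨O, hO, hOx⟩ := exists_orthogonal_mulVec_eq x y h
  have hmp := measurePreserving_mul_right_haarOrthogonal hO
  have h1 := integral_map (μ := haarOrthogonal d) hmp.measurable.aemeasurable
    (f := fun Q => (Q 0 ⬝ᵥ x) ^ k)
    (Measurable.aestronglyMeasurable (by unfold dotProduct; fun_prop))
  rw [hmp.map_eq] at h1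
  rw [h1]
  congr 1
  ext Q
  congr 1
  rw [← hOx, Matrix.dotProduct_mulVec]
  rfl

/-- The one-dimensional marginals of a uniformly random unit vector have smaller even moments than
a centred Gaussian of variance `1 / d`. The inner product with an independent Gaussian vector `g`
has a standard Gaussian law given the unit vector, and is `|g|` times the marginal given `g`. -/
theorem integral_row_dotProduct_pow_haarOrthogonal_le [NeZero d] {w : Fin d → ℝ}
    (hw : w ⬝ᵥ w = 1) (j : ℕ) :
    (∫ Q, (Q 0 ⬝ᵥ w) ^ (2 * j) ∂haarOrthogonal d) * (d : ℝ) ^ j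
      ≤ ∫ x, x ^ (2 * j) ∂gaussianReal 0 1 := by
  set T := ∫ Q, (Q 0 ⬝ᵥ w) ^ (2 * j) ∂haarOrthogonal d with hT
  have hT0 : 0 ≤ T := integral_nonneg fun Q => Even.pow_nonneg (even_two_mul j) _
  set γ : Measure (Fin d → ℝ) := Measure.pi fun _ => gaussianReal 0 1 with hγ
  have h1 : ∀ g : Fin d → ℝ, ∫ Q, (Q 0 ⬝ᵥ g) ^ (2 * j) ∂haarOrthogonal d = (g ⬝ᵥ g) ^ j * T := by
    intro g
    have hg : 0 ≤ g ⬝ᵥ g := Finset.sum_nonneg fun i _ => mul_self_nonneg _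
    rw [integral_row_dotProduct_pow_haarOrthogonal_eq (y := √(g ⬝ᵥ g) • w), hT,
      ← integral_const_mul]
    · congr 1; ext Q
      rw [dotProduct_smul, smul_eq_mul, mul_pow, pow_mul, Real.sq_sqrt hg]
    · rw [dotProduct_smul, smul_dotProduct, hw, smul_eq_mul, smul_eq_mul, mul_one,
        Real.mul_self_sqrt hg]
  have hint : Integrable (fun P : (Fin d → ℝ) × (Fin d → Fin d → ℝ) =>
      (P.2 0 ⬝ᵥ P.1) ^ (2 * j)) (γ.prod (haarOrthogonal d)) := by
    unfold dotProduct
    refine (HasAllMoments.pow (HasAllMoments.sum _ fun i _ => HasAllMoments.mul ?_ ?_) _).integrable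
    · exact (hasAllMoments_haarOrthogonal 0 i).comp_measurePreserving measurePreserving_snd
    · exact (hasAllMoments_pi_gaussian i).comp_measurePreserving measurePreserving_fst
  have h2 : ∫ g, (g ⬝ᵥ g) ^ j * T ∂γ = ∫ x, x ^ (2 * j) ∂gaussianReal 0 1 := by
    simp_rw [← h1]
    rw [integral_integral_swap hint]
    have : ∀ᵐ Q ∂haarOrthogonal d, ∫ g, (Q 0 ⬝ᵥ g) ^ (2 * j) ∂γ
        = ∫ x, x ^ (2 * j) ∂gaussianReal 0 1 := by
      filter_upwards [ae_mem_orthogonalGroup_haarOrthogonal] with Q hQ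
      exact integral_dotProduct_pow_gaussian
        (by rw [dotProduct_row_of_mem_orthogonalGroup hQ, if_pos rfl]) _
    rw [integral_congr_ae this]
    simp
  have hd : (0 : ℝ) < d := by exact_mod_cast NeZero.pos d
  have hgg : HasAllMoments (fun g : Fin d → ℝ => g ⬝ᵥ g) γ := by
    unfold dotProduct
    exact HasAllMoments.sum _ fun i _ =>
      (hasAllMoments_pi_gaussian i).mul (hasAllMoments_pi_gaussian i)
  have hE : ∫ g, g ⬝ᵥ g ∂γ = d := by
    unfold dotProduct
    rw [integral_finsetSum _ fun i _ =>
      ((hasAllMoments_pi_gaussian i).mul (hasAllMoments_pi_gaussian i)).integrable]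
    have : ∀ i : Fin d, ∫ g : Fin d → ℝ, g i * g i ∂γ = 1 := by
      intro i
      have h3 := integral_coord_mul_mvPolynomial_gaussian i (MvPolynomial.X i)
      simpa only [MvPolynomial.eval_X, MvPolynomial.pderiv_X_self, map_one, integral_const,
        probReal_univ, smul_eq_mul, mul_one] using h3
    rw [Finset.sum_congr rfl fun i _ => this i]
    simp
  -- Bernoulli's inequality is the tangent-line form of Jensen's inequality here.
  have h3 : (d : ℝ) ^ j ≤ ∫ g, (g ⬝ᵥ g) ^ j ∂γ := by
    have h4 : ∀ g : Fin d → ℝ,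
        (d : ℝ) ^ j * ((1 - j) + j / d * (g ⬝ᵥ g)) ≤ (g ⬝ᵥ g) ^ j := by
      intro g
      have hg : 0 ≤ g ⬝ᵥ g := Finset.sum_nonneg fun i _ => mul_self_nonneg _
      have h5 := one_add_mul_le_pow (a := g ⬝ᵥ g / d - 1)
        (by have : 0 ≤ g ⬝ᵥ g / d := by positivity
            linarith) j
      calc _ = (d : ℝ) ^ j * (1 + j * (g ⬝ᵥ g / d - 1)) := by ring
        _ ≤ (d : ℝ) ^ j * (1 + (g ⬝ᵥ g / d - 1)) ^ j := by gcongr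
        _ = (g ⬝ᵥ g) ^ j := by
          rw [← mul_pow]; congr 1; field_simp; ring
    have hi := hgg.integrable.const_mul ((j : ℝ) / d)
    have h6 : ∫ g, (d : ℝ) ^ j * ((1 - j) + j / d * (g ⬝ᵥ g)) ∂γ = (d : ℝ) ^ j := by
      rw [integral_const_mul, integral_add (integrable_const _) hi, integral_const_mul, hE]
      simp [hd.ne']
    rw [← h6]
    exact integral_mono (((integrable_const _).add hi).const_mul _) (hgg.pow j).integrable h4
  rw [integral_mul_const] at h2
  rw [← h2, mul_comm T]
  gcongr

end Rotations

/-! ### Low-degree moments of the planted distribution -/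

section Planted

variable {n d : ℕ} {ρ σ : ℝ}

theorem measurable_mulMatrix : Measurable
    fun (P : (Fin n → Fin d → ℝ) × (Fin d → Fin d → ℝ)) (i : Fin n) (k : Fin d) =>
      ∑ j, P.1 i j * P.2 j k := by fun_prop

theorem measurable_evalMatrix (p : MvPolynomial (Fin n × Fin d) ℝ) :
    Measurable (fun A => evalMatrix p A) := by
  have h : Measurable (fun A : Fin n → Fin d → ℝ => fun e : Fin n × Fin d => A e.1 e.2) := by
    fun_prop
  exact (MvPolynomial.continuous_eval p).measurable.comp h

theorem hasAllMoments_mulMatrix (h0 : 0 ≤ ρ) (h1 : ρ ≤ 1) (i : Fin n) (k : Fin d) :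
    HasAllMoments (fun P : (Fin n → Fin d → ℝ) × (Fin d → Fin d → ℝ) => ∑ j, P.1 i j * P.2 j k)
      ((hiddenMeasure n d ρ σ).prod (haarOrthogonal d)) := by
  have := isProbabilityMeasure_hiddenMeasure (n := n) (d := d) (σ := σ) h0 h1
  exact HasAllMoments.sum _ fun j _ =>
    ((hasAllMoments_hiddenMeasure h0 h1 i j).comp_measurePreserving measurePreserving_fst).mul
      ((hasAllMoments_haarOrthogonal j k).comp_measurePreserving measurePreserving_snd)

theorem hasAllMoments_evalMatrix_plantedMeasure (h0 : 0 ≤ ρ) (h1 : ρ ≤ 1)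
    (p : MvPolynomial (Fin n × Fin d) ℝ) :
    HasAllMoments (fun A => evalMatrix p A) (plantedMeasure n d ρ σ) := by
  have := isProbabilityMeasure_plantedMeasure n d (σ := σ) h0 h1
  refine HasAllMoments.evalMatrix (fun i k q => ?_) p
  rw [plantedMeasure, memLp_map_measure_iff (Measurable.aestronglyMeasurable (by fun_prop))
    measurable_mulMatrix.aemeasurable]
  exact hasAllMoments_mulMatrix h0 h1 i k q

/-- Substituting `A * Q` for the matrix in a polynomial. -/
noncomputable def substMul (p : MvPolynomial (Fin n × Fin d) ℝ) (Q : Fin d → Fin d → ℝ) :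
    MvPolynomial (Fin n × Fin d) ℝ :=
  MvPolynomial.bind₁ (fun e : Fin n × Fin d =>
    ∑ j, MvPolynomial.C (Q j e.2) * MvPolynomial.X (e.1, j)) p

theorem evalMatrix_substMul (p : MvPolynomial (Fin n × Fin d) ℝ) (Q : Fin d → Fin d → ℝ)
    (A : Fin n → Fin d → ℝ) :
    evalMatrix (substMul p Q) A = evalMatrix p (fun i k => ∑ j, A i j * Q j k) := by
  have h : (fun e : Fin n × Fin d => MvPolynomial.eval (fun e : Fin n × Fin d => A e.1 e.2)
      (∑ j, MvPolynomial.C (Q j e.2) * MvPolynomial.X (e.1, j)))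
      = fun e => ∑ j, A e.1 j * Q j e.2 := by
    ext e; simp [mul_comm]
  rw [evalMatrix, evalMatrix, substMul, MvPolynomial.eval, MvPolynomial.eval₂Hom_bind₁]
  exact congrArg (fun F => MvPolynomial.eval F p) h

theorem totalDegree_substMul_le (p : MvPolynomial (Fin n × Fin d) ℝ) (Q : Fin d → Fin d → ℝ) :
    (substMul p Q).totalDegree ≤ p.totalDegree := by
  rw [substMul, MvPolynomial.bind₁, MvPolynomial.aeval_def, MvPolynomial.eval₂_eq']
  refine MvPolynomial.totalDegree_finsetSum_le fun s hs => ?_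
  refine (MvPolynomial.totalDegree_mul _ _).trans ?_
  rw [MvPolynomial.algebraMap_eq, MvPolynomial.totalDegree_C, zero_add]
  refine (MvPolynomial.totalDegree_finsetProd _ _).trans ?_
  have h := MvPolynomial.le_totalDegree hs
  rw [Finsupp.sum_fintype _ _ (by simp)] at h
  refine le_trans (Finset.sum_le_sum fun e _ => ?_) h
  refine (MvPolynomial.totalDegree_pow _ _).trans ?_
  calc s e * _ ≤ s e * 1 := by
        gcongr
        exact totalDegree_sum_C_mul_X_le (fun j => Q j e.2) fun j => (e.1, j)
    _ = s e := mul_one _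

/-- Given the rotation `Q`, the hidden direction of `Y Q` is the first row of `Q`. -/
theorem integral_hiddenMeasure_mul_eq [NeZero d] (h0 : 0 ≤ ρ) (h1 : ρ ≤ 1) {D : ℕ}
    (p : MvPolynomial (Fin n × Fin d) ℝ) (hp : p.totalDegree ≤ D) {Q : Fin d → Fin d → ℝ}
    (hQ : Matrix.of Q ∈ Matrix.orthogonalGroup (Fin d) ℝ) :
    ∫ Y, evalMatrix p (fun i k => ∑ j, Y i j * Q j k) ∂hiddenMeasure n d ρ σ
      = ∫ A, evalMatrix p A * evalMatrix (directionalRatio n ρ σ D (Q 0)) A ∂nullMeasure n d := by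
  simp_rw [← evalMatrix_substMul]
  rw [integral_hiddenMeasure_eq h0 h1 _ ((totalDegree_substMul_le p Q).trans hp)]
  have hmp := measurePreserving_mul_right_nullMeasure (n := n) hQ
  have h := integral_map (μ := nullMeasure n d) hmp.measurable.aemeasurable
    (f := fun A => evalMatrix p A * evalMatrix (directionalRatio n ρ σ D (Q 0)) A)
    ((measurable_evalMatrix _).mul (measurable_evalMatrix _)).aestronglyMeasurable
  rw [hmp.map_eq] at h
  rw [h]
  refine integral_congr_ae (ae_of_all _ fun A => ?_)
  have e : ∀ i, Q 0 ⬝ᵥ (fun k => ∑ j, A i j * Matrix.of Q j k)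
      = (Pi.single 0 1 : Fin d → ℝ) ⬝ᵥ A i := by
    intro i
    calc Q 0 ⬝ᵥ (fun k => ∑ j, A i j * Matrix.of Q j k)
        = ∑ j, A i j * (Q 0 ⬝ᵥ Q j) := by
          simp only [dotProduct, Finset.mul_sum, Matrix.of_apply]
          rw [Finset.sum_comm]
          exact Finset.sum_congr rfl fun j _ => Finset.sum_congr rfl fun k _ => by ring
      _ = _ := by
          simp [dotProduct_row_of_mem_orthogonalGroup hQ]
  simp only [Matrix.of_apply] at e
  simp only [evalMatrix_directionalRatio, e, evalMatrix_substMul, Matrix.of_apply]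

/-- Low-degree moments of the planted distribution, as averages over the hidden direction. -/
theorem integral_plantedMeasure_eq [NeZero d] (h0 : 0 ≤ ρ) (h1 : ρ ≤ 1) {D : ℕ}
    (p : MvPolynomial (Fin n × Fin d) ℝ) (hp : p.totalDegree ≤ D) :
    ∫ A, evalMatrix p A ∂plantedMeasure n d ρ σ
      = ∫ Q, ∫ A, evalMatrix p A * evalMatrix (directionalRatio n ρ σ D (Q 0)) A
          ∂nullMeasure n d ∂haarOrthogonal d := by
  have := isProbabilityMeasure_hiddenMeasure (n := n) (d := d) (σ := σ) h0 h1
  rw [plantedMeasure, integral_map measurable_mulMatrix.aemeasurable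
    (measurable_evalMatrix p).aestronglyMeasurable]
  rw [integral_prod_symm]
  · refine integral_congr_ae ?_
    filter_upwards [ae_mem_orthogonalGroup_haarOrthogonal] with Q hQ
    exact integral_hiddenMeasure_mul_eq h0 h1 p hp hQ
  · have h := HasAllMoments.eval_mvPolynomial
      (F := fun (P : (Fin n → Fin d → ℝ) × (Fin d → Fin d → ℝ)) (e : Fin n × Fin d) =>
        ∑ j, P.1 e.1 j * P.2 j e.2)
      (fun e => hasAllMoments_mulMatrix (σ := σ) h0 h1 e.1 e.2) p
    exact h.integrable

/-! ### Existence and norm of the low-degree likelihood ratio -/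

/-- The low-degree likelihood ratio exists whenever the planted expectation vanishes on the
polynomials that vanish almost surely under the null distribution: the Riesz representation
theorem for the (possibly degenerate) inner product on polynomials of bounded degree. -/
theorem exists_isLowDegreeLikelihoodRatio {ν μ : Measure (Fin n → Fin d → ℝ)} {D : ℕ}
    (hν : ∀ p q : MvPolynomial (Fin n × Fin d) ℝ,
      Integrable (fun A => evalMatrix p A * evalMatrix q A) ν)
    (hμ : ∀ p : MvPolynomial (Fin n × Fin d) ℝ, Integrable (fun A => evalMatrix p A) μ)
    (hker : ∀ p : MvPolynomial (Fin n × Fin d) ℝ, p.totalDegree ≤ D →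
      ∫ A, evalMatrix p A * evalMatrix p A ∂ν = 0 → ∫ A, evalMatrix p A ∂μ = 0) :
    ∃ L, IsLowDegreeLikelihoodRatio ν μ D L := by
  let V := MvPolynomial.restrictTotalDegree (Fin n × Fin d) ℝ D
  let B : V →ₗ[ℝ] V →ₗ[ℝ] ℝ := LinearMap.mk₂ ℝ
    (fun p q => ∫ A, evalMatrix p.1 A * evalMatrix q.1 A ∂ν)
    (fun p p' q => by
      simp only [evalMatrix, Submodule.coe_add, map_add, add_mul]
      exact integral_add (hν _ _) (hν _ _))
    (fun c p q => by
      simp only [evalMatrix, Submodule.coe_smul, MvPolynomial.smul_eval, mul_assoc, smul_eq_mul]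
      exact integral_const_mul _ _)
    (fun p q q' => by
      simp only [evalMatrix, Submodule.coe_add, map_add, mul_add]
      exact integral_add (hν _ _) (hν _ _))
    (fun c p q => by
      simp only [evalMatrix, Submodule.coe_smul, MvPolynomial.smul_eval, mul_left_comm _ c,
        smul_eq_mul]
      exact integral_const_mul _ _)
  let ℓ : V →ₗ[ℝ] ℝ :=
    { toFun := fun p => ∫ A, evalMatrix p.1 A ∂μ
      map_add' := fun p q => by
        simp only [evalMatrix, Submodule.coe_add, map_add]
        exact integral_add (hμ _) (hμ _)
      map_smul' := fun c p => by
        simp only [evalMatrix, Submodule.coe_smul, MvPolynomial.smul_eval, RingHom.id_apply,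
          smul_eq_mul]
        exact integral_const_mul _ _ }
  have hℓ : ℓ ∈ LinearMap.range (LinearMap.dualMap B) := by
    rw [LinearMap.range_dualMap_eq_dualAnnihilator_ker, Submodule.mem_dualAnnihilator]
    intro p hp
    have h := LinearMap.congr_fun (LinearMap.mem_ker.1 hp) p
    exact hker p.1 ((MvPolynomial.mem_restrictTotalDegree _ _ _).1 p.2) h
  obtain ⟨φ, hφ⟩ := hℓ
  obtain ⟨L, hL⟩ := (Module.evalEquiv ℝ V).surjective φ
  refine ⟨L.1, (MvPolynomial.mem_restrictTotalDegree _ _ _).1 L.2, fun p _ => hμ p,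
    fun p _ => hν _ _, fun p hp => ?_⟩
  have h := LinearMap.congr_fun hφ ⟨p, (MvPolynomial.mem_restrictTotalDegree _ _ _).2 hp⟩
  rw [← hL] at h
  have h2 : ∫ A, evalMatrix p A * evalMatrix L.1 A ∂ν = ∫ A, evalMatrix p A ∂μ := h
  rw [← h2]
  simp_rw [mul_comm]

theorem exists_isLowDegreeLikelihoodRatio_plantedMeasure [NeZero d] (h0 : 0 ≤ ρ) (h1 : ρ ≤ 1)
    (D : ℕ) : ∃ L, IsLowDegreeLikelihoodRatio (nullMeasure n d) (plantedMeasure n d ρ σ) D L := by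
  refine exists_isLowDegreeLikelihoodRatio
    (fun p q => ((hasAllMoments_evalMatrix_nullMeasure p).mul
      (hasAllMoments_evalMatrix_nullMeasure q)).integrable)
    (fun p => (hasAllMoments_evalMatrix_plantedMeasure h0 h1 p).integrable) fun p hp h => ?_
  have hae := (integral_eq_zero_iff_of_nonneg (fun A => mul_self_nonneg _)
    ((hasAllMoments_evalMatrix_nullMeasure p).mul
      (hasAllMoments_evalMatrix_nullMeasure p)).integrable).1 h
  rw [integral_plantedMeasure_eq h0 h1 p hp]
  have : ∀ Q : Fin d → Fin d → ℝ, ∫ A, evalMatrix p A *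
      evalMatrix (directionalRatio n ρ σ D (Q 0)) A ∂nullMeasure n d = 0 := by
    intro Q
    rw [← integral_zero (Fin n → Fin d → ℝ) ℝ (μ := nullMeasure n d)]
    refine integral_congr_ae ?_
    filter_upwards [hae] with A hA
    rw [mul_self_eq_zero.1 hA, zero_mul]
  simp [this]

/-- The squared norm of the low-degree likelihood ratio is bounded by the series in the moments of
the overlap of two independent uniformly random directions. -/
theorem integral_sq_lowDegreeLikelihoodRatio_le [NeZero d] (h0 : 0 ≤ ρ) (h1 : ρ ≤ 1) {D : ℕ}
    {L : MvPolynomial (Fin n × Fin d) ℝ}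
    (hL : IsLowDegreeLikelihoodRatio (nullMeasure n d) (plantedMeasure n d ρ σ) D L) {K : ℝ}
    (hK0 : 0 ≤ K)
    (hK : ∀ w : Fin d → ℝ, w ⬝ᵥ w = 1 → ∑ k ∈ hermiteIndices n D,
      (∏ i, hermiteMoment ρ σ (k i) ^ 2 / (k i).factorial) *
        ∫ Q, (Q 0 ⬝ᵥ w) ^ ∑ i, k i ∂haarOrthogonal d ≤ K) :
    ∫ A, evalMatrix L A ^ 2 ∂nullMeasure n d ≤ K := by
  have hLdeg := hL.totalDegree_le
  have e1 : ∫ A, evalMatrix L A ^ 2 ∂nullMeasure n d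
      = ∫ A, evalMatrix L A ∂plantedMeasure n d ρ σ := by
    rw [← hL.integral_eq L hLdeg]; simp_rw [sq]
  rw [e1, integral_plantedMeasure_eq h0 h1 L hLdeg]
  have hbound : ∀ᵐ Q ∂haarOrthogonal d, ∫ A, evalMatrix L A *
      evalMatrix (directionalRatio n ρ σ D (Q 0)) A ∂nullMeasure n d ≤ K := by
    filter_upwards [ae_mem_orthogonalGroup_haarOrthogonal] with Q hQ
    have hw : Q 0 ⬝ᵥ Q 0 = 1 := by
      rw [dotProduct_row_of_mem_orthogonalGroup hQ, if_pos rfl]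
    -- The conditional ratio has degree at most `D`, so it can serve as a test polynomial for `L`.
    rw [hL.integral_eq _ (totalDegree_directionalRatio_le ρ σ D (Q 0)),
      integral_plantedMeasure_eq h0 h1 _ (totalDegree_directionalRatio_le ρ σ D (Q 0))]
    refine le_trans (le_of_eq ?_) (hK _ hw)
    have hint : ∀ m : ℕ, Integrable (fun Q' : Fin d → Fin d → ℝ => (Q' 0 ⬝ᵥ Q 0) ^ m)
        (haarOrthogonal d) := by
      intro m
      unfold dotProduct
      exact (HasAllMoments.pow (HasAllMoments.sum _ fun i _ =>
        (hasAllMoments_haarOrthogonal 0 i).mul (HasAllMoments.const _)) m).integrable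
    simp_rw [← integral_const_mul]
    rw [← integral_finsetSum _ fun k _ => (hint _).const_mul _]
    refine integral_congr_ae ?_
    filter_upwards [ae_mem_orthogonalGroup_haarOrthogonal] with Q' hQ'
    have hw' : Q' 0 ⬝ᵥ Q' 0 = 1 := by
      rw [dotProduct_row_of_mem_orthogonalGroup hQ', if_pos rfl]
    rw [integral_directionalRatio_mul_directionalRatio ρ σ D hw hw', dotProduct_comm]
  -- If the average over `Q` is not integrable, its integral is zero by convention.
  by_cases hi : Integrable (fun Q : Fin d → Fin d → ℝ => ∫ A, evalMatrix L A *
      evalMatrix (directionalRatio n ρ σ D (Q 0)) A ∂nullMeasure n d) (haarOrthogonal d)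
  · calc _ ≤ ∫ _Q, K ∂haarOrthogonal d := integral_mono_ae hi (integrable_const _) hbound
      _ = K := by simp
  · rw [integral_undef hi]; exact hK0

theorem integral_pow_two_mul_gaussian_le {j D : ℕ} (h : 2 * j ≤ D) :
    ∫ x, x ^ (2 * j) ∂gaussianReal 0 1 ≤ (D : ℝ) ^ j := by
  induction j with
  | zero => simp
  | succ j ih =>
    have h2 := integral_pow_succ_gaussian (2 * j + 1)
    rw [show 2 * (j + 1) = 2 * j + 1 + 1 by ring, h2, pow_succ']
    have h3 : ((2 * j + 1 : ℕ) : ℝ) ≤ D := by exact_mod_cast (by omega)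
    have h4 : 0 ≤ ∫ x, x ^ (2 * j) ∂gaussianReal 0 1 :=
      integral_nonneg fun x => Even.pow_nonneg (even_two_mul j) _
    exact mul_le_mul h3 (ih (by omega)) h4 (by positivity)

theorem sum_hermiteIndices_le {D : ℕ} {f : ℕ → ℝ} (hf : ∀ k, 0 ≤ f k) :
    ∑ k ∈ hermiteIndices n D, ∏ i, f (k i) ≤ (∑ k ∈ Finset.range (D + 1), f k) ^ n := by
  have h : (∑ k ∈ Finset.range (D + 1), f k) ^ n
      = ∑ k ∈ Fintype.piFinset fun _ : Fin n => Finset.range (D + 1), ∏ i, f (k i) := by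
    rw [← Finset.prod_univ_sum (fun _ : Fin n => Finset.range (D + 1)) (fun _ k => f k)]
    simp
  rw [h]
  exact Finset.sum_le_sum_of_subset_of_nonneg (Finset.filter_subset _ _)
    fun k _ _ => Finset.prod_nonneg fun i _ => hf _

/-- The low-degree likelihood ratio has bounded norm as soon as `D / d` is small against `ρ²` and
`n * (D / d)²` is at most of order `ρ²`. The Hermite moments of orders one, two and three vanish,
so that the first contribution of each row is of order four. -/
theorem integral_sq_lowDegreeLikelihoodRatio_le_three [NeZero d] (h0 : 0 < ρ) (h1 : ρ ≤ 1)
    (hσ : σ ^ 2 ≤ 1) {D : ℕ} {L : MvPolynomial (Fin n × Fin d) ℝ}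
    (hL : IsLowDegreeLikelihoodRatio (nullMeasure n d) (plantedMeasure n d ρ σ) D L)
    (hsmall : 64 * (D : ℝ) ≤ d * ρ ^ 2) (hn : 2048 * (n : ℝ) * D ^ 2 ≤ d ^ 2 * ρ ^ 2) :
    ∫ A, evalMatrix L A ^ 2 ∂nullMeasure n d ≤ 3 := by
  have hd : (0 : ℝ) < d := by exact_mod_cast NeZero.pos d
  set β := √((D : ℝ) / d) with hβ
  have hβ0 : 0 ≤ β := Real.sqrt_nonneg _
  have hβ2 : β ^ 2 = D / d := Real.sq_sqrt (by positivity)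
  set y := 4 / ρ * β with hy
  have hy0 : 0 ≤ y := by positivity
  have hy2 : y ^ 2 = 16 * D / (d * ρ ^ 2) := by
    rw [hy, mul_pow, hβ2]; field_simp; ring
  have hyhalf : y ≤ 1 / 2 := by
    have : y ^ 2 ≤ (1 / 2) ^ 2 := by
      rw [hy2, div_le_iff₀ (by positivity)]; linarith
    exact (sq_le_sq₀ hy0 (by norm_num)).1 this
  have hny : 8 * (n : ℝ) * ρ ^ 2 * y ^ 4 ≤ 1 := by
    have : y ^ 4 = (16 * D / (d * ρ ^ 2)) ^ 2 := by rw [← hy2]; ring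
    rw [this, div_pow, mul_div_assoc', div_le_one (by positivity)]
    nlinarith [sq_nonneg ρ]
  have hpos : 0 ≤ 1 - (1 - ρ) * σ ^ 2 := by nlinarith [sq_nonneg σ]
  set f : ℕ → ℝ := fun k => hermiteMoment ρ σ k ^ 2 / k.factorial * β ^ k with hf
  have hf0 : ∀ k, 0 ≤ f k := fun k => by positivity
  have hsum : ∑ k ∈ Finset.range (D + 1), f k ≤ 1 + 8 * ρ ^ 2 * y ^ 4 := by
    have hf1 : f 1 = 0 := by simp [hf, hermiteMoment_of_odd h0.le h1 odd_one]
    have hf2 : f 2 = 0 := by simp [hf, hermiteMoment_two h0 h1 hpos]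
    have hf3 : f 3 = 0 := by
      simp [hf, hermiteMoment_of_odd h0.le h1 (show Odd 3 by decide)]
    have hf00 : f 0 = 1 := by simp [hf, hermiteMoment_zero h0.le h1]
    have htail : ∀ k, f (4 + k) ≤ 4 * ρ ^ 2 * y ^ 4 * (1 / 2) ^ k := by
      intro k
      calc f (4 + k) ≤ 4 * ρ ^ 2 * (4 / ρ) ^ (4 + k) * β ^ (4 + k) := by
            simp only [hf]
            gcongr
            exact sq_hermiteMoment_le h0 h1 hσ (by omega)
        _ = 4 * ρ ^ 2 * y ^ 4 * y ^ k := by rw [hy, mul_assoc, ← mul_pow]; ring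
        _ ≤ _ := by gcongr
    calc ∑ k ∈ Finset.range (D + 1), f k ≤ ∑ k ∈ Finset.range (4 + D), f k :=
          Finset.sum_le_sum_of_subset_of_nonneg
            (Finset.range_mono (by omega)) fun k _ _ => hf0 k
      _ = 1 + ∑ k ∈ Finset.range D, f (4 + k) := by
          rw [Finset.sum_range_add]
          simp [Finset.sum_range_succ, hf00, hf1, hf2, hf3]
      _ ≤ 1 + ∑ k ∈ Finset.range D, 4 * ρ ^ 2 * y ^ 4 * (1 / 2) ^ k := by
          gcongr with k _; exact htail k
      _ ≤ 1 + 4 * ρ ^ 2 * y ^ 4 * 2 := by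
          rw [← Finset.mul_sum]
          gcongr
          exact sum_geometric_two_le D
      _ = _ := by ring
  refine integral_sq_lowDegreeLikelihoodRatio_le h0.le h1 hL (by norm_num) fun w hw => ?_
  have hterm : ∀ k ∈ hermiteIndices n D,
      (∏ i, hermiteMoment ρ σ (k i) ^ 2 / (k i).factorial) *
        ∫ Q, (Q 0 ⬝ᵥ w) ^ ∑ i, k i ∂haarOrthogonal d ≤ ∏ i, f (k i) := by
    intro k hk
    have hkD : ∑ i, k i ≤ D := (Finset.mem_filter.1 hk).2
    by_cases hodd : ∃ i, Odd (k i)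
    · obtain ⟨i, hi⟩ := hodd
      rw [Finset.prod_eq_zero (Finset.mem_univ i)
        (by rw [hermiteMoment_of_odd h0.le h1 hi]; simp), zero_mul]
      exact Finset.prod_nonneg fun i _ => hf0 _
    · push Not at hodd
      have hev : Even (∑ i, k i) :=
        Finset.even_sum _ fun i _ => Nat.not_odd_iff_even.1 (hodd i)
      obtain ⟨j, hj⟩ := hev.two_dvd
      simp only [hf, Finset.prod_mul_distrib]
      rw [Finset.prod_pow_eq_pow_sum, hj]
      have h2 : ∫ Q, (Q 0 ⬝ᵥ w) ^ (2 * j) ∂haarOrthogonal d ≤ β ^ (2 * j) := by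
        rw [pow_mul, hβ2, div_pow, le_div_iff₀ (by positivity)]
        exact (integral_row_dotProduct_pow_haarOrthogonal_le hw j).trans
          (integral_pow_two_mul_gaussian_le (hj ▸ hkD))
      gcongr
  calc _ ≤ ∑ k ∈ hermiteIndices n D, ∏ i, f (k i) := Finset.sum_le_sum hterm
    _ ≤ (∑ k ∈ Finset.range (D + 1), f k) ^ n := sum_hermiteIndices_le hf0
    _ ≤ (1 + 8 * ρ ^ 2 * y ^ 4) ^ n :=
        pow_le_pow_left₀ (Finset.sum_nonneg fun k _ => hf0 k) hsum n
    _ ≤ Real.exp (8 * ρ ^ 2 * y ^ 4) ^ n := by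
        gcongr
        rw [add_comm]; exact Real.add_one_le_exp _
    _ = Real.exp (8 * n * ρ ^ 2 * y ^ 4) := by rw [← Real.exp_nat_mul]; ring_nf
    _ ≤ Real.exp 1 := Real.exp_le_exp.2 hny
    _ ≤ 3 := Real.exp_one_lt_three.le

end Planted

/-! ### Nets of Euclidean balls -/

/-- A maximal separated subset of the ball is a net; its cardinality is bounded by comparing
volumes. -/
theorem exists_net_ball_two (d : ℕ) : ∃ s : Finset (EuclideanSpace ℝ (Fin d)),
    s.card ≤ 5 ^ d ∧ ∀ x, ‖x‖ ≤ 2 → ∃ c ∈ s, ‖x - c‖ < 1 := by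
  classical
  let P : ℕ → Prop := fun k => ∃ s : Finset (EuclideanSpace ℝ (Fin d)), s.card = k ∧
    (∀ c ∈ s, ‖c‖ ≤ 2) ∧ ∀ c ∈ s, ∀ e ∈ s, c ≠ e → 1 ≤ ‖c - e‖
  have hle : ∀ k, P k → k ≤ 5 ^ d := by
    rintro k ⟨s, rfl, h1, h2⟩
    simpa using Besicovitch.card_le_of_separated s h1 h2
  have h0 : P 0 := ⟨∅, by simp⟩
  obtain ⟨s, hcard, h1, h2⟩ := Nat.findGreatest_spec (P := P) (Nat.zero_le (5 ^ d)) h0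
  refine ⟨s, hcard ▸ Nat.findGreatest_le _, fun x hx => ?_⟩
  by_contra! hcon
  have hxs : x ∉ s := fun h => by
    have := hcon x h
    simp at this
    linarith
  have hP : P (Nat.findGreatest P (5 ^ d) + 1) := by
    refine ⟨insert x s, by rw [Finset.card_insert_of_notMem hxs, hcard], ?_, ?_⟩
    · intro c hc
      rcases Finset.mem_insert.1 hc with rfl | hc
      exacts [hx, h1 c hc]
    · intro c hc e he hce
      rcases Finset.mem_insert.1 hc with hc' | hc' <;>
        rcases Finset.mem_insert.1 he with he' | he'
      · exact absurd (hc'.trans he'.symm) hce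
      · rw [hc']; exact hcon e he'
      · rw [he', norm_sub_rev]; exact hcon c hc'
      · exact h2 c hc' e he' hce
  have := Nat.le_findGreatest (hle _ hP) hP
  omega

/-- Finer nets arise by iteration: the ball of radius `2 ^ (-k)` around each point of a net is
covered by a scaled copy of the net of the ball of radius two. -/
theorem exists_net_unitBall (d k : ℕ) : ∃ s : Finset (EuclideanSpace ℝ (Fin d)),
    s.card ≤ 5 ^ (k * d) ∧ ∀ x, ‖x‖ ≤ 1 → ∃ c ∈ s, ‖x - c‖ ≤ (1 / 2) ^ k := by
  classical
  obtain ⟨N, hN, hcov⟩ := exists_net_ball_two d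
  induction k with
  | zero => exact ⟨{0}, by simp, fun x hx => ⟨0, by simp, by simpa using hx⟩⟩
  | succ k ih =>
    obtain ⟨s, hs, hsc⟩ := ih
    refine ⟨Finset.image₂ (fun c e => c + ((1 / 2 : ℝ) ^ (k + 1)) • e) s N, ?_, fun x hx => ?_⟩
    · refine (Finset.card_image₂_le _ _ _).trans ((Nat.mul_le_mul hs hN).trans ?_)
      rw [← pow_add]; ring_nf; exact le_rfl
    · obtain ⟨c, hc, hxc⟩ := hsc x hx
      obtain ⟨e, he, hxe⟩ := hcov ((2 : ℝ) ^ (k + 1) • (x - c)) (by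
        rw [norm_smul, Real.norm_of_nonneg (by positivity)]
        calc (2 : ℝ) ^ (k + 1) * ‖x - c‖ ≤ 2 ^ (k + 1) * (1 / 2) ^ k := by gcongr
          _ = 2 := by rw [pow_succ, mul_right_comm, ← mul_pow]; norm_num)
      refine ⟨_, Finset.mem_image₂_of_mem hc he, ?_⟩
      have h2 : x - (c + ((1 / 2 : ℝ) ^ (k + 1)) • e)
          = ((1 / 2 : ℝ) ^ (k + 1)) • ((2 : ℝ) ^ (k + 1) • (x - c) - e) := by
        rw [smul_sub, smul_smul, ← mul_pow]
        norm_num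
        abel
      rw [h2, norm_smul, Real.norm_of_nonneg (by positivity)]
      exact mul_le_of_le_one_right (by positivity) hxe.le

/-! ### Spreadness from bounds on a net -/

section NetArgument

variable {n d : ℕ}

/-- Spreadness of a matrix with bounded operator norm all of whose submatrices with half of the
rows are well conditioned, both properties being tested on a fine net only. -/
theorem matrixSpread_of_net {A : Fin n → Fin d → ℝ} {s : Finset (EuclideanSpace ℝ (Fin d))}
    (hnet : ∀ x, ‖x‖ ≤ 1 → ∃ c ∈ s, ‖x - c‖ ≤ (1 / 2) ^ 12)
    (hup : ∀ c ∈ s, ‖c‖ ≤ 3 / 2 → ∑ i, (c.ofLp ⬝ᵥ A i) ^ 2 ≤ 18 * n)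
    (hlow : ∀ T : Finset (Fin n), n ≤ 2 * T.card → ∀ c ∈ s, 1 / 2 ≤ ‖c‖ →
      (1 / 2) ^ 14 * (n : ℝ) ≤ ∑ i ∈ T, (c.ofLp ⬝ᵥ A i) ^ 2)
    {m δ : ℝ} (hm : 2 * m ≤ n) (hδ : 1 - (1 / 2) ^ 24 ≤ δ) : MatrixSpread m δ A := by
  classical
  let F : Finset (Fin n) → (EuclideanSpace ℝ (Fin d) →L[ℝ] EuclideanSpace ℝ (Fin n)) := fun T =>
    LinearMap.toContinuousLinearMap (Matrix.toEuclideanLin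
      (Matrix.of fun i j => if i ∈ T then A i j else 0))
  have hF : ∀ T x, ‖F T x‖ ^ 2 = ∑ i ∈ T, (x.ofLp ⬝ᵥ A i) ^ 2 := by
    intro T x
    have h : ∀ i, (F T x).ofLp i = if i ∈ T then x.ofLp ⬝ᵥ A i else 0 := by
      intro i
      have h2 : (F T x).ofLp i
          = (Matrix.of fun i j => if i ∈ T then A i j else 0).mulVec x.ofLp i := rfl
      rw [h2]
      by_cases hi : i ∈ T <;> simp [Matrix.mulVec, hi, dotProduct, mul_comm]
    rw [EuclideanSpace.real_norm_sq_eq]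
    simp [h, ite_pow]
  have hFle : ∀ T x, ‖F T x‖ ≤ ‖F Finset.univ x‖ := by
    intro T x
    rw [← sq_le_sq₀ (norm_nonneg _) (norm_nonneg _), hF, hF]
    exact Finset.sum_le_sum_of_subset_of_nonneg (Finset.subset_univ _) fun _ _ _ => sq_nonneg _
  set r := √(n : ℝ) with hr
  have hr0 : 0 ≤ r := Real.sqrt_nonneg _
  have hr2 : r ^ 2 = n := Real.sq_sqrt (Nat.cast_nonneg n)
  have hsmall : ((1 : ℝ) / 2) ^ 12 ≤ 1 / 2 := by norm_num
  have hupF : ∀ c ∈ s, ‖c‖ ≤ 3 / 2 → ‖F Finset.univ c‖ ≤ 5 * r := by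
    intro c hc hc2
    rw [← sq_le_sq₀ (norm_nonneg _) (by positivity), hF, mul_pow, hr2]
    refine (hup c hc hc2).trans ?_
    nlinarith [(Nat.cast_nonneg n : (0 : ℝ) ≤ n)]
  -- Approximating unit vectors by the net bounds the norm by half of itself plus the bound
  -- on the net.
  have hop : ‖F Finset.univ‖ ≤ 10 * r := by
    have : ‖F Finset.univ‖ ≤ ‖F Finset.univ‖ / 2 + 5 * r := by
      refine ContinuousLinearMap.opNorm_le_of_unit_norm (by positivity) fun x hx => ?_
      obtain ⟨c, hc, hxc⟩ := hnet x hx.le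
      have hc2 : ‖c‖ ≤ 3 / 2 := by
        calc ‖c‖ = ‖x - (x - c)‖ := by rw [sub_sub_cancel]
          _ ≤ ‖x‖ + ‖x - c‖ := norm_sub_le _ _
          _ ≤ 3 / 2 := by rw [hx]; linarith
      calc ‖F Finset.univ x‖ = ‖F Finset.univ (x - c) + F Finset.univ c‖ := by
            rw [← map_add, sub_add_cancel]
        _ ≤ ‖F Finset.univ (x - c)‖ + ‖F Finset.univ c‖ := norm_add_le _ _
        _ ≤ ‖F Finset.univ‖ * ‖x - c‖ + 5 * r :=
            add_le_add ((F Finset.univ).le_opNorm _) (hupF c hc hc2)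
        _ ≤ ‖F Finset.univ‖ * (1 / 2) + 5 * r := by gcongr; linarith
        _ = _ := by ring
    linarith
  -- Passing from the net to the sphere costs at most `10 √n / 2 ^ 12`, less than half of the lower
  -- bound `√n / 2 ^ 7` on the net.
  have hlowF : ∀ T : Finset (Fin n), n ≤ 2 * T.card → ∀ x, ‖x‖ = 1 → (1 / 256) * r ≤ ‖F T x‖ := by
    intro T hT x hx
    obtain ⟨c, hc, hxc⟩ := hnet x hx.le
    have hc2 : 1 / 2 ≤ ‖c‖ := by
      have : ‖x‖ ≤ ‖x - c‖ + ‖c‖ := by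
        simpa using norm_add_le (x - c) c
      rw [hx] at this; linarith
    have h1 : (1 / 128) * r ≤ ‖F T c‖ := by
      rw [← sq_le_sq₀ (by positivity) (norm_nonneg _), hF, mul_pow, hr2]
      refine le_trans (le_of_eq ?_) (hlow T hT c hc hc2)
      norm_num
    have h2 : ‖F T (x - c)‖ ≤ 10 * r * (1 / 2) ^ 12 := by
      refine (hFle T _).trans (((F Finset.univ).le_opNorm _).trans ?_)
      gcongr
    have h3 : ‖F T c‖ ≤ ‖F T x‖ + ‖F T (x - c)‖ := by
      have : F T c = F T x - F T (x - c) := by rw [← map_sub, sub_sub_cancel]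
      rw [this]; exact norm_sub_le _ _
    rw [show ((1 : ℝ) / 2) ^ 12 = 1 / 4096 by norm_num] at h2
    linarith
  have hlowF' : ∀ T : Finset (Fin n), n ≤ 2 * T.card → ∀ x,
      (1 / 256 * (r * ‖x‖)) ^ 2 ≤ ‖F T x‖ ^ 2 := by
    intro T hT x
    rcases eq_or_ne x 0 with rfl | hx
    · simp
    have hx0 : ‖x‖ ≠ 0 := norm_ne_zero_iff.2 hx
    have h1 := hlowF T hT (‖x‖⁻¹ • x) (by
      rw [norm_smul, norm_inv, norm_norm, inv_mul_cancel₀ hx0])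
    rw [map_smul, norm_smul, norm_inv, norm_norm] at h1
    gcongr
    calc 1 / 256 * (r * ‖x‖) = (1 / 256 * r) * ‖x‖ := by ring
      _ ≤ (‖x‖⁻¹ * ‖F T x‖) * ‖x‖ := by gcongr
      _ = ‖F T x‖ := by field_simp
  intro v hv S hS
  obtain ⟨y, rfl⟩ := (Submodule.mem_span_range_iff_exists_fun ℝ).1 hv
  have hvi : ∀ i, (∑ j, y j • fun i => A i j) i = y ⬝ᵥ A i := by
    intro i; simp [dotProduct]
  simp only [hvi]
  set x : EuclideanSpace ℝ (Fin d) := WithLp.toLp 2 y with hx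
  have hy : y = x.ofLp := rfl
  have hcard : n ≤ 2 * Sᶜ.card := by
    have h1 : (2 * S.card : ℝ) ≤ n := by linarith
    have h2 : 2 * S.card ≤ n := by exact_mod_cast h1
    rw [Finset.card_compl, Fintype.card_fin]; omega
  have h1 := hlowF' Sᶜ hcard x
  have h2 : ‖F Finset.univ x‖ ^ 2 ≤ (10 * (r * ‖x‖)) ^ 2 := by
    gcongr
    calc _ ≤ ‖F Finset.univ‖ * ‖x‖ := (F Finset.univ).le_opNorm _
      _ ≤ 10 * r * ‖x‖ := by gcongr
      _ = _ := by ring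
  rw [hF] at h1 h2
  have h3 := Finset.sum_add_sum_compl S fun i => (x.ofLp ⬝ᵥ A i) ^ 2
  have hδ0 : 0 ≤ δ := le_trans (by norm_num) hδ
  rw [← Real.sqrt_sq hδ0, ← Real.sqrt_mul (sq_nonneg _)]
  apply Real.sqrt_le_sqrt
  rw [hy]
  have hδ2 : (1 - (1 / 2) ^ 24) ^ 2 ≤ δ ^ 2 := by
    apply pow_le_pow_left₀ _ hδ; norm_num
  have htot : 0 ≤ ∑ i, (x.ofLp ⬝ᵥ A i) ^ 2 := Finset.sum_nonneg fun _ _ => sq_nonneg _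
  calc ∑ i ∈ S, (x.ofLp ⬝ᵥ A i) ^ 2 ≤ (1 - (1 / 2) ^ 24) ^ 2 * ∑ i, (x.ofLp ⬝ᵥ A i) ^ 2 := by
        rw [mul_pow] at h1 h2
        norm_num at h1 h2 ⊢
        linarith
    _ ≤ _ := by gcongr

end NetArgument

/-! ### Chernoff bounds for Gaussian matrices -/

section Chernoff

variable {n d : ℕ} [NeZero d]

theorem integral_exp_sq_gaussian {t : ℝ} (ht : t < 1 / 2) :
    ∫ x, Real.exp (t * x ^ 2) ∂gaussianReal 0 1 = 1 / √(1 - 2 * t) := by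
  rw [integral_gaussianReal_eq_integral_smul one_ne_zero]
  have e : ∀ x : ℝ, gaussianPDFReal 0 1 x • Real.exp (t * x ^ 2)
      = (√(2 * Real.pi))⁻¹ * Real.exp (-(1 / 2 - t) * x ^ 2) := by
    intro x
    rw [gaussianPDFReal, smul_eq_mul, mul_assoc, ← Real.exp_add]
    simp only [NNReal.coe_one, mul_one, sub_zero]
    congr 2
    ring
  simp_rw [e]
  rw [integral_const_mul, integral_gaussian, ← Real.sqrt_inv, ← Real.sqrt_mul (by positivity),
    one_div (√_), ← Real.sqrt_inv]
  congr 1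
  have : 1 - 2 * t ≠ 0 := by linarith
  have : 1 / 2 - t ≠ 0 := by linarith
  have := Real.pi_pos.ne'
  field_simp

/-- The moment generating function of the squared norm of some rows of `A u`. -/
theorem mgf_sum_sq_dotProduct_nullMeasure (T : Finset (Fin n)) (u : Fin d → ℝ) {t : ℝ}
    (ht : t * (u ⬝ᵥ u) < 1 / 2) :
    mgf (fun A => ∑ i ∈ T, (u ⬝ᵥ A i) ^ 2) (nullMeasure n d) t
      = (1 / √(1 - 2 * (t * (u ⬝ᵥ u)))) ^ T.card := by
  classical
  have hu : 0 ≤ u ⬝ᵥ u := Finset.sum_nonneg fun i _ => mul_self_nonneg _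
  have e : ∀ A : Fin n → Fin d → ℝ, Real.exp (t * ∑ i ∈ T, (u ⬝ᵥ A i) ^ 2)
      = ∏ i, (if i ∈ T then Real.exp (t * (u ⬝ᵥ A i) ^ 2) else 1) := by
    intro A
    rw [Finset.mul_sum, Real.exp_sum, Finset.prod_ite_mem, Finset.univ_inter]
  rw [mgf]
  simp_rw [e]
  rw [nullMeasure, integral_fintype_prod_eq_prod (fun i (x : Fin d → ℝ) =>
    if i ∈ T then Real.exp (t * (u ⬝ᵥ x) ^ 2) else 1)]
  have h : ∀ i, (∫ x : Fin d → ℝ, (if i ∈ T then Real.exp (t * (u ⬝ᵥ x) ^ 2) else 1)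
      ∂(Measure.pi fun _ => gaussianReal 0 1))
      = if i ∈ T then 1 / √(1 - 2 * (t * (u ⬝ᵥ u))) else 1 := by
    intro i
    split_ifs
    · rw [integral_comp_dotProduct_gaussian u (f := fun y => Real.exp (t * y ^ 2)) (by fun_prop)]
      simp_rw [mul_pow, Real.sq_sqrt hu, ← mul_assoc t]
      rw [integral_exp_sq_gaussian ht]
    · simp
  rw [Finset.prod_congr rfl fun i _ => h i, Finset.prod_ite_mem, Finset.univ_inter,
    Finset.prod_const]

theorem integrable_exp_sum_sq_dotProduct (T : Finset (Fin n)) (u : Fin d → ℝ) {t : ℝ}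
    (ht : t * (u ⬝ᵥ u) < 1 / 2) :
    Integrable (fun A => Real.exp (t * ∑ i ∈ T, (u ⬝ᵥ A i) ^ 2)) (nullMeasure n d) := by
  have h := mgf_sum_sq_dotProduct_nullMeasure T u ht
  -- A nonzero Bochner integral forces integrability.
  by_contra hcon
  rw [mgf, integral_undef hcon] at h
  have : 0 < (1 / √(1 - 2 * (t * (u ⬝ᵥ u)))) ^ T.card := by
    have : 0 < √(1 - 2 * (t * (u ⬝ᵥ u))) := Real.sqrt_pos.2 (by linarith)
    positivity
  linarith

/-- Chernoff's bound with parameter `1 / 9`. -/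
theorem nullMeasure_sum_sq_ge_le {u : Fin d → ℝ} (hu : u ⬝ᵥ u ≤ 9 / 4) :
    (nullMeasure n d).real {A | 18 * (n : ℝ) ≤ ∑ i, (u ⬝ᵥ A i) ^ 2} ≤ (3 / 8) ^ n := by
  have ht : 1 / 9 * (u ⬝ᵥ u) < 1 / 2 := by linarith
  refine (measure_ge_le_exp_mul_mgf _ (by norm_num : (0 : ℝ) ≤ 1 / 9)
    (integrable_exp_sum_sq_dotProduct Finset.univ u ht)).trans ?_
  rw [mgf_sum_sq_dotProduct_nullMeasure Finset.univ u ht, Finset.card_univ, Fintype.card_fin,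
    show -(1 / 9) * (18 * (n : ℝ)) = n * (-2) by ring, Real.exp_nat_mul, ← mul_pow]
  refine pow_le_pow_left₀ (by positivity) ?_ n
  have h1 : Real.exp (-2) ≤ 1 / 4 := by
    rw [Real.exp_neg, one_div]
    gcongr
    calc (4 : ℝ) = 2 ^ 2 := by norm_num
      _ ≤ Real.exp 1 ^ 2 := by
        gcongr
        have := Real.add_one_le_exp 1
        linarith
      _ = Real.exp 2 := by rw [← Real.exp_nat_mul]; norm_num
  have h2 : 2 / 3 ≤ √(1 - 2 * (1 / 9 * (u ⬝ᵥ u))) := by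
    apply Real.le_sqrt_of_sq_le
    linarith
  calc Real.exp (-2) * (1 / √(1 - 2 * (1 / 9 * (u ⬝ᵥ u)))) ≤ 1 / 4 * (1 / (2 / 3)) := by gcongr
    _ = 3 / 8 := by norm_num

/-- Chernoff's bound with parameter `-2 ^ 14`: large enough to beat the number `2 ^ n` of sets of
rows times the cardinality of a net. -/
theorem nullMeasure_sum_sq_le_le {u : Fin d → ℝ} (hu : 1 / 4 ≤ u ⬝ᵥ u) {T : Finset (Fin n)}
    (hT : n ≤ 2 * T.card) :
    (nullMeasure n d).real {A | ∑ i ∈ T, (u ⬝ᵥ A i) ^ 2 ≤ (1 / 2) ^ 14 * (n : ℝ)}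
      ≤ (Real.exp 1 / 9) ^ n := by
  have ht : -(2 ^ 14) * (u ⬝ᵥ u) < 1 / 2 := by linarith
  refine (measure_le_le_exp_mul_mgf _ (by norm_num : (-(2 ^ 14) : ℝ) ≤ 0)
    (integrable_exp_sum_sq_dotProduct T u ht)).trans ?_
  rw [mgf_sum_sq_dotProduct_nullMeasure T u ht,
    show -(-(2 ^ 14)) * ((1 / 2) ^ 14 * (n : ℝ)) = n * 1 by ring, Real.exp_nat_mul,
    div_eq_mul_one_div (Real.exp 1), mul_pow (Real.exp 1)]
  refine mul_le_mul_of_nonneg_left ?_ (by positivity)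
  have h1 : 81 ≤ √(1 - 2 * (-(2 ^ 14) * (u ⬝ᵥ u))) := by
    apply Real.le_sqrt_of_sq_le
    linarith
  calc (1 / √(1 - 2 * (-(2 ^ 14) * (u ⬝ᵥ u)))) ^ T.card ≤ (1 / 81) ^ T.card := by gcongr
    _ = (1 / 9) ^ (2 * T.card) := by rw [pow_mul]; norm_num
    _ ≤ (1 / 9) ^ n := pow_le_pow_of_le_one (by norm_num) (by norm_num) hT

/-- A Gaussian matrix with `50 d ≤ n` fails to be spread with exponentially small probability. -/
theorem nullMeasure_not_matrixSpread_le (hd : 50 * d ≤ n) {m δ : ℝ} (hm : 2 * m ≤ n)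
    (hδ : 1 - (1 / 2) ^ 24 ≤ δ) :
    (nullMeasure n d).real {A | ¬ MatrixSpread m δ A} ≤ (9 / 16) ^ n + (Real.exp 1 / 3) ^ n := by
  classical
  obtain ⟨s, hs, hnet⟩ := exists_net_unitBall d 12
  -- The net is small because `5 ^ 12 ≤ (3 / 2) ^ 50`.
  have hcard : (s.card : ℝ) ≤ (3 / 2) ^ n := by
    calc (s.card : ℝ) ≤ (5 : ℝ) ^ (12 * d) := by exact_mod_cast hs
      _ = (5 ^ 12) ^ d := by rw [pow_mul]
      _ ≤ ((3 / 2) ^ 50) ^ d := by gcongr; norm_num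
      _ = (3 / 2) ^ (50 * d) := by rw [pow_mul]
      _ ≤ (3 / 2) ^ n := pow_le_pow_right₀ (by norm_num) hd
  set ν := nullMeasure n d
  have hnorm : ∀ c : EuclideanSpace ℝ (Fin d), c.ofLp ⬝ᵥ c.ofLp = ‖c‖ ^ 2 := by
    intro c; rw [EuclideanSpace.real_norm_sq_eq]; simp [dotProduct, sq]
  let U : EuclideanSpace ℝ (Fin d) → Set (Fin n → Fin d → ℝ) := fun c =>
    {A | 18 * (n : ℝ) ≤ ∑ i, (c.ofLp ⬝ᵥ A i) ^ 2}
  let W : Finset (Fin n) → EuclideanSpace ℝ (Fin d) → Set (Fin n → Fin d → ℝ) := fun T c =>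
    {A | ∑ i ∈ T, (c.ofLp ⬝ᵥ A i) ^ 2 ≤ (1 / 2) ^ 14 * (n : ℝ)}
  let s₁ := s.filter fun c => ‖c‖ ≤ 3 / 2
  let s₂ := s.filter fun c => 1 / 2 ≤ ‖c‖
  let 𝒯 := (Finset.univ : Finset (Finset (Fin n))).filter fun T => n ≤ 2 * T.card
  have hsub : {A | ¬ MatrixSpread m δ A}
      ⊆ (⋃ c ∈ s₁, U c) ∪ ⋃ P ∈ 𝒯 ×ˢ s₂, W P.1 P.2 := by
    intro A hA
    by_contra hcon
    simp only [Set.mem_union, Set.mem_iUnion, not_or, not_exists] at hcon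
    refine hA (matrixSpread_of_net hnet (fun c hc hc2 => ?_) (fun T hT c hc hc2 => ?_) hm hδ)
    · exact (not_le.1 (hcon.1 c (Finset.mem_filter.2 ⟨hc, hc2⟩))).le
    · exact (not_le.1 (hcon.2 (T, c) (Finset.mem_product.2
        ⟨Finset.mem_filter.2 ⟨Finset.mem_univ _, hT⟩, Finset.mem_filter.2 ⟨hc, hc2⟩⟩))).le
  have hU : ν.real (⋃ c ∈ s₁, U c) ≤ (9 / 16) ^ n := by
    calc ν.real (⋃ c ∈ s₁, U c) ≤ ∑ c ∈ s₁, ν.real (U c) := measureReal_biUnion_finset_le _ _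
      _ ≤ ∑ c ∈ s₁, (3 / 8) ^ n := by
          refine Finset.sum_le_sum fun c hc => nullMeasure_sum_sq_ge_le ?_
          rw [hnorm]
          have := (Finset.mem_filter.1 hc).2
          nlinarith [norm_nonneg c]
      _ ≤ (3 / 2) ^ n * (3 / 8) ^ n := by
          rw [Finset.sum_const, nsmul_eq_mul]
          gcongr
          exact (Nat.cast_le.2 (Finset.card_filter_le _ _)).trans hcard
      _ = (9 / 16) ^ n := by rw [← mul_pow]; norm_num
  have hW : ν.real (⋃ P ∈ 𝒯 ×ˢ s₂, W P.1 P.2) ≤ (Real.exp 1 / 3) ^ n := by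
    calc ν.real (⋃ P ∈ 𝒯 ×ˢ s₂, W P.1 P.2) ≤ ∑ P ∈ 𝒯 ×ˢ s₂, ν.real (W P.1 P.2) :=
          measureReal_biUnion_finset_le _ _
      _ ≤ ∑ P ∈ 𝒯 ×ˢ s₂, (Real.exp 1 / 9) ^ n := by
          refine Finset.sum_le_sum fun P hP => nullMeasure_sum_sq_le_le ?_ ?_
          · rw [hnorm]
            have := (Finset.mem_filter.1 (Finset.mem_product.1 hP).2).2
            nlinarith [norm_nonneg P.2]
          · exact (Finset.mem_filter.1 (Finset.mem_product.1 hP).1).2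
      _ ≤ (2 ^ n * (3 / 2) ^ n) * (Real.exp 1 / 9) ^ n := by
          rw [Finset.sum_const, nsmul_eq_mul, Finset.card_product]
          push_cast
          gcongr
          · have : 𝒯.card ≤ 2 ^ n := by
              refine (Finset.card_filter_le _ _).trans ?_
              simp
            exact_mod_cast this
          · exact (Nat.cast_le.2 (Finset.card_filter_le _ _)).trans hcard
      _ = (Real.exp 1 / 3) ^ n := by rw [← mul_pow, ← mul_pow]; congr 1; ring
  exact (measureReal_mono hsub).trans ((measureReal_union_le _ _).trans (add_le_add hU hW))

end Chernoff

/-! ### The hidden sparse direction violates spreadness -/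

section Hidden

variable {n d : ℕ} {ρ σ : ℝ}

/-- The indicator that an entry is one of the two atoms `± a`. -/
noncomputable def atomIndicator (a x : ℝ) : ℝ := if |x| = a then 1 else 0

/-- The square of an entry, unless it is one of the two atoms `± a`. -/
noncomputable def noiseSq (a x : ℝ) : ℝ := if |x| = a then 0 else x ^ 2

theorem measurableSet_abs_eq (a : ℝ) : MeasurableSet {x : ℝ | |x| = a} :=
  (isClosed_eq continuous_abs continuous_const).measurableSet

theorem measurable_atomIndicator (a : ℝ) : Measurable (atomIndicator a) :=
  Measurable.ite (measurableSet_abs_eq a) measurable_const measurable_const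

theorem measurable_noiseSq (a : ℝ) : Measurable (noiseSq a) :=
  Measurable.ite (measurableSet_abs_eq a) measurable_const (by fun_prop)

theorem abs_atomIndicator_le (a x : ℝ) : |atomIndicator a x| ≤ 1 := by
  unfold atomIndicator; split_ifs <;> simp

theorem noiseSq_nonneg (a x : ℝ) : 0 ≤ noiseSq a x := by
  unfold noiseSq; split_ifs <;> positivity

theorem noiseSq_le (a x : ℝ) : noiseSq a x ≤ x ^ 2 := by
  unfold noiseSq; split_ifs <;> [positivity; exact le_rfl]

theorem integral_atomIndicator_gaussian {a : ℝ} (ha : 0 < a) (v : NNReal) :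
    ∫ x, atomIndicator a x ∂gaussianReal 0 v = 0 := by
  refine integral_eq_zero_of_ae ?_
  have h : ∀ b : ℝ, b ≠ 0 → gaussianReal 0 v {b} = 0 := by
    intro b hb
    rcases eq_or_ne v 0 with rfl | hv
    · rw [gaussianReal_zero_var, Measure.dirac_apply' _ (measurableSet_singleton b)]
      simp [hb.symm]
    · have := nullSingletonClass_gaussianReal (μ := 0) hv
      exact measure_singleton b
  have h2 : ∀ b : ℝ, b ≠ 0 → ∀ᵐ x ∂gaussianReal 0 v, x ≠ b := fun b hb => by
    rw [ae_iff]; simpa using h b hb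
  filter_upwards [h2 a ha.ne', h2 (-a) (neg_ne_zero.2 ha.ne')] with x hx hx'
  have : ¬ |x| = a := by
    rw [abs_eq ha.le]; tauto
  simp [atomIndicator, this]

theorem integral_atomIndicator_noisyBernoulliRademacher (h0 : 0 < ρ) (h1 : ρ ≤ 1)
    (hpos : 0 < 1 - (1 - ρ) * σ ^ 2) :
    ∫ x, atomIndicator (1 / √(ρ / (1 - (1 - ρ) * σ ^ 2))) x ∂noisyBernoulliRademacher ρ σ
      = ρ := by
  set a := 1 / √(ρ / (1 - (1 - ρ) * σ ^ 2)) with ha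
  have ha0 : 0 < a := by positivity
  rw [integral_noisyBernoulliRademacher h0.le h1, integral_atomIndicator_gaussian ha0, ← ha]
  · simp [atomIndicator, abs_of_pos ha0]
  · exact Integrable.of_bound (measurable_atomIndicator a).aestronglyMeasurable 1
      (ae_of_all _ fun x => abs_atomIndicator_le a x)

theorem integrable_noiseSq {m : Measure ℝ} [IsFiniteMeasure m]
    (hm : HasAllMoments (fun x : ℝ => x) m) (a : ℝ) : Integrable (noiseSq a) m :=
  (hm.pow 2).integrable.mono' (measurable_noiseSq a).aestronglyMeasurable
    (ae_of_all _ fun x => by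
      rw [Real.norm_of_nonneg (noiseSq_nonneg a x)]; exact noiseSq_le a x)

theorem integral_noiseSq_noisyBernoulliRademacher_le (h0 : 0 < ρ) (h1 : ρ ≤ 1)
    (hpos : 0 < 1 - (1 - ρ) * σ ^ 2) :
    ∫ x, noiseSq (1 / √(ρ / (1 - (1 - ρ) * σ ^ 2))) x ∂noisyBernoulliRademacher ρ σ
      ≤ σ ^ 2 := by
  set a := 1 / √(ρ / (1 - (1 - ρ) * σ ^ 2)) with ha
  have ha0 : 0 < a := by positivity
  have hg := hasAllMoments_id_gaussianReal (σ ^ 2).toNNReal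
  rw [integral_noisyBernoulliRademacher h0.le h1 (integrable_noiseSq hg a), ← ha]
  have e : ∫ x, noiseSq a x ∂gaussianReal 0 (σ ^ 2).toNNReal ≤ σ ^ 2 := by
    calc _ ≤ ∫ x, (Polynomial.X ^ 2 : Polynomial ℝ).eval x ∂gaussianReal 0 (σ ^ 2).toNNReal := by
          refine integral_mono (integrable_noiseSq hg a) (hg.eval_polynomial _).integrable
            fun x => ?_
          simpa using noiseSq_le a x
      _ = σ ^ 2 := by
          rw [integral_polynomial_gaussian_sq]
          have h2 := integral_pow_succ_gaussian 1
          simp only [Polynomial.eval_pow, Polynomial.eval_X, mul_pow]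
          rw [integral_const_mul, h2]
          simp
  have e0 : 0 ≤ ∫ x, noiseSq a x ∂gaussianReal 0 (σ ^ 2).toNNReal :=
    integral_nonneg (noiseSq_nonneg a)
  have e1 : noiseSq a a = 0 := by simp [noiseSq, abs_of_pos ha0]
  have e2 : noiseSq a (-a) = 0 := by simp [noiseSq, abs_of_pos ha0]
  rw [e1, e2]
  nlinarith

/-- The law of a row of the hidden matrix. -/
noncomputable def hiddenRow (d : ℕ) (ρ σ : ℝ) : Measure (Fin d → ℝ) :=
  Measure.pi fun j : Fin d =>
    if (j : ℕ) = 0 then noisyBernoulliRademacher ρ σ else gaussianReal 0 1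

theorem isProbabilityMeasure_hiddenRow (h0 : 0 ≤ ρ) (h1 : ρ ≤ 1) :
    IsProbabilityMeasure (hiddenRow d ρ σ) := by
  have := fun j : Fin d => isProbabilityMeasure_hiddenEntry (σ := σ) h0 h1 j
  unfold hiddenRow; infer_instance

variable [NeZero d]

theorem measurePreserving_hiddenRow (h0 : 0 ≤ ρ) (h1 : ρ ≤ 1) :
    MeasurePreserving (fun x : Fin d → ℝ => x 0) (hiddenRow d ρ σ)
      (noisyBernoulliRademacher ρ σ) := by
  have := fun j : Fin d => isProbabilityMeasure_hiddenEntry (σ := σ) h0 h1 j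
  have h := measurePreserving_eval (fun j : Fin d =>
    if (j : ℕ) = 0 then noisyBernoulliRademacher ρ σ else gaussianReal 0 1) 0
  have e : (if ((0 : Fin d) : ℕ) = 0 then noisyBernoulliRademacher ρ σ else gaussianReal 0 1)
      = noisyBernoulliRademacher ρ σ := if_pos (by simp)
  rw [e] at h
  exact h

theorem measurePreserving_hiddenMeasure (h0 : 0 ≤ ρ) (h1 : ρ ≤ 1) (i : Fin n) :
    MeasurePreserving (fun Y : Fin n → Fin d → ℝ => Y i 0) (hiddenMeasure n d ρ σ)
      (noisyBernoulliRademacher ρ σ) := by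
  have := isProbabilityMeasure_hiddenRow (d := d) (σ := σ) h0 h1
  exact (measurePreserving_hiddenRow h0 h1).comp
    (measurePreserving_eval (fun _ : Fin n => hiddenRow d ρ σ) i)

theorem integral_comp_measurePreserving {Ω Ω' : Type*} [MeasurableSpace Ω] [MeasurableSpace Ω']
    {m : Measure Ω} {m' : Measure Ω'} {T : Ω → Ω'} (hT : MeasurePreserving T m m') {f : Ω' → ℝ}
    (hf : Measurable f) : ∫ x, f (T x) ∂m = ∫ y, f y ∂m' := by
  rw [← hT.map_eq, integral_map hT.measurable.aemeasurable hf.aestronglyMeasurable]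

/-- The number of atoms in the first column has mean `ρ n` and variance at most `ρ n`, so
Chebyshev's inequality applies. -/
theorem hiddenMeasure_atoms_le (h0 : 0 < ρ) (h1 : ρ ≤ 1) (hpos : 0 < 1 - (1 - ρ) * σ ^ 2)
    (hn : 0 < n) :
    (hiddenMeasure n d ρ σ).real {Y | ρ * n / 2 ≤
      |∑ i, atomIndicator (1 / √(ρ / (1 - (1 - ρ) * σ ^ 2))) (Y i 0) - ρ * n|} ≤ 4 / (ρ * n) := by
  set a := 1 / √(ρ / (1 - (1 - ρ) * σ ^ 2)) with ha
  have := isProbabilityMeasure_noisyBernoulliRademacher (σ := σ) h0.le h1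
  have := isProbabilityMeasure_hiddenRow (d := d) (σ := σ) h0.le h1
  have hprob := isProbabilityMeasure_hiddenMeasure (n := n) (d := d) (σ := σ) h0.le h1
  have hn' : (0 : ℝ) < n := by exact_mod_cast hn
  let X : (Fin n → Fin d → ℝ) → ℝ := ∑ i, fun Y => atomIndicator a (Y i 0)
  have hX : ∀ Y, X Y = ∑ i, atomIndicator a (Y i 0) := fun Y => by simp [X]
  have hmeas : ∀ i : Fin n, Measurable fun Y : Fin n → Fin d → ℝ => atomIndicator a (Y i 0) :=
    fun i => (measurable_atomIndicator a).comp (measurePreserving_hiddenMeasure h0.le h1 i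
      (σ := σ)).measurable
  have hbd : ∀ i : Fin n, MemLp (fun Y : Fin n → Fin d → ℝ => atomIndicator a (Y i 0)) 2
      (hiddenMeasure n d ρ σ) := fun i =>
    MemLp.of_bound (hmeas i).aestronglyMeasurable 1 (ae_of_all _ fun Y => abs_atomIndicator_le a _)
  have hXL : MemLp X 2 (hiddenMeasure n d ρ σ) := memLp_finsetSum' _ fun i _ => hbd i
  have hmean : ∫ Y, X Y ∂hiddenMeasure n d ρ σ = ρ * n := by
    simp_rw [hX]
    rw [integral_finsetSum _ fun i _ => (hbd i).integrable (by norm_num)]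
    have : ∀ i : Fin n, ∫ Y, atomIndicator a (Y i 0) ∂hiddenMeasure n d ρ σ = ρ := fun i => by
      rw [integral_comp_measurePreserving (measurePreserving_hiddenMeasure h0.le h1 i)
        (measurable_atomIndicator a), integral_atomIndicator_noisyBernoulliRademacher h0 h1 hpos]
    rw [Finset.sum_congr rfl fun i _ => this i]
    simp [mul_comm]
  have hrow : MemLp (fun x : Fin d → ℝ => atomIndicator a (x 0)) 2 (hiddenRow d ρ σ) :=
    MemLp.of_bound ((measurable_atomIndicator a).comp (measurePreserving_hiddenRow h0.le h1
      (σ := σ)).measurable).aestronglyMeasurable 1 (ae_of_all _ fun Y => abs_atomIndicator_le a _)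
  have hvar : variance X (hiddenMeasure n d ρ σ) ≤ ρ * n := by
    have h := variance_sum_pi (μ := fun _ : Fin n => hiddenRow d ρ σ)
      (X := fun _ x => atomIndicator a (x 0)) fun _ => hrow
    have h2 : variance X (hiddenMeasure n d ρ σ)
        = ∑ _i : Fin n, variance (fun x : Fin d → ℝ => atomIndicator a (x 0)) (hiddenRow d ρ σ) := h
    rw [h2]
    have h3 : variance (fun x : Fin d → ℝ => atomIndicator a (x 0)) (hiddenRow d ρ σ) ≤ ρ := by
      refine (variance_le_expectation_sq hrow.aestronglyMeasurable).trans (le_of_eq ?_)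
      have e : ∀ x : Fin d → ℝ, ((fun x : Fin d → ℝ => atomIndicator a (x 0)) ^ 2) x
          = atomIndicator a (x 0) := by
        intro x
        simp only [Pi.pow_apply, atomIndicator]
        split_ifs <;> simp
      simp_rw [e]
      rw [integral_comp_measurePreserving (measurePreserving_hiddenRow h0.le h1)
        (measurable_atomIndicator a), integral_atomIndicator_noisyBernoulliRademacher h0 h1 hpos]
    calc _ ≤ ∑ _i : Fin n, ρ := Finset.sum_le_sum fun _ _ => h3
      _ = ρ * n := by simp [mul_comm]
  have hc := meas_ge_le_variance_div_sq hXL (c := ρ * n / 2) (by positivity)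
  rw [hmean] at hc
  simp_rw [hX] at hc
  refine (ENNReal.toReal_mono ENNReal.ofReal_ne_top hc).trans ?_
  rw [ENNReal.toReal_ofReal (div_nonneg (variance_nonneg _ _) (by positivity))]
  calc _ ≤ ρ * n / (ρ * n / 2) ^ 2 := by gcongr
    _ = 4 / (ρ * n) := by field_simp; norm_num

/-- Markov's inequality for the total mass of the entries of the first column that are not atoms. -/
theorem hiddenMeasure_noise_le (h0 : 0 < ρ) (h1 : ρ ≤ 1) (hpos : 0 < 1 - (1 - ρ) * σ ^ 2)
    (hn : 0 < n) {c : ℝ} (hc : 0 < c) :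
    (hiddenMeasure n d ρ σ).real {Y | c * n ≤
      ∑ i, noiseSq (1 / √(ρ / (1 - (1 - ρ) * σ ^ 2))) (Y i 0)} ≤ σ ^ 2 / c := by
  set a := 1 / √(ρ / (1 - (1 - ρ) * σ ^ 2)) with ha
  have := isProbabilityMeasure_noisyBernoulliRademacher (σ := σ) h0.le h1
  have hn' : (0 : ℝ) < n := by exact_mod_cast hn
  have hint : ∀ i : Fin n, Integrable (fun Y : Fin n → Fin d → ℝ => noiseSq a (Y i 0))
      (hiddenMeasure n d ρ σ) := fun i =>
    (measurePreserving_hiddenMeasure h0.le h1 i).integrable_comp_of_integrable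
      (integrable_noiseSq hasAllMoments_noisyBernoulliRademacher a)
  have h := mul_meas_ge_le_integral_of_nonneg (μ := hiddenMeasure n d ρ σ)
    (f := fun Y => ∑ i, noiseSq a (Y i 0))
    (ae_of_all _ fun Y => Finset.sum_nonneg fun i _ => noiseSq_nonneg a _)
    (integrable_finsetSum _ fun i _ => hint i) (c * n)
  rw [integral_finsetSum _ fun i _ => hint i] at h
  have h2 : ∑ i : Fin n, ∫ Y, noiseSq a (Y i 0) ∂hiddenMeasure n d ρ σ ≤ n * σ ^ 2 := by
    calc _ ≤ ∑ i : Fin n, σ ^ 2 := by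
          refine Finset.sum_le_sum fun i _ => ?_
          rw [integral_comp_measurePreserving (measurePreserving_hiddenMeasure h0.le h1 i)
            (measurable_noiseSq a)]
          exact integral_noiseSq_noisyBernoulliRademacher_le h0 h1 hpos
      _ = n * σ ^ 2 := by simp
  rw [le_div_iff₀ hc]
  have h3 := h.trans h2
  have : (n : ℝ) * ((hiddenMeasure n d ρ σ).real {Y | c * n ≤ ∑ i, noiseSq a (Y i 0)} * c)
      ≤ n * σ ^ 2 := by linarith
  exact le_of_mul_le_mul_left this hn'

/-- If the number of atoms in the first column of `Y` is close to its mean and the remaining entries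
of that column are small, then the set of atoms shows that the column span of `Y Q` is not spread.
-/
theorem not_matrixSpread_mul {Y : Fin n → Fin d → ℝ} {Q : Fin d → Fin d → ℝ}
    (hQ : Matrix.of Q ∈ Matrix.orthogonalGroup (Fin d) ℝ) (h0 : 0 < ρ)
    (hσ : σ ^ 2 ≤ 1 / 2) {m δ : ℝ} (hδ0 : 0 ≤ δ) (hδ1 : δ ≤ 1) (hm : 1.5 * ρ * n < m)
    (hatoms : |∑ i, atomIndicator (1 / √(ρ / (1 - (1 - ρ) * σ ^ 2))) (Y i 0) - ρ * n| < ρ * n / 2)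
    (hnoise : ∑ i, noiseSq (1 / √(ρ / (1 - (1 - ρ) * σ ^ 2))) (Y i 0) < (1 - δ ^ 2) / 4 * n) :
    ¬ MatrixSpread m δ (fun i k => ∑ j, Y i j * Q j k) := by
  classical
  set a := 1 / √(ρ / (1 - (1 - ρ) * σ ^ 2)) with ha
  intro hspread
  have hpos : 1 / 2 ≤ 1 - (1 - ρ) * σ ^ 2 := by nlinarith [sq_nonneg σ]
  have ha2 : a ^ 2 = (1 - (1 - ρ) * σ ^ 2) / ρ := sq_one_div_sqrt (by linarith) h0
  let S := Finset.univ.filter fun i : Fin n => |Y i 0| = a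
  have hS : ∑ i, atomIndicator a (Y i 0) = S.card := by
    simp [atomIndicator, S]
  have hmem : (fun i => Y i 0) ∈ Submodule.span ℝ (Set.range fun (k : Fin d) (i : Fin n) =>
      ∑ j, Y i j * Q j k) := by
    rw [Submodule.mem_span_range_iff_exists_fun]
    refine ⟨Q 0, ?_⟩
    ext i
    calc (∑ k, Q 0 k • fun i => ∑ j, Y i j * Q j k) i
        = ∑ k, Q 0 k * ∑ j, Y i j * Q j k := by simp
      _ = ∑ j, Y i j * (Q 0 ⬝ᵥ Q j) := by
          simp only [dotProduct, Finset.mul_sum]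
          rw [Finset.sum_comm]
          exact Finset.sum_congr rfl fun j _ => Finset.sum_congr rfl fun k _ => by ring
      _ = Y i 0 := by simp [dotProduct_row_of_mem_orthogonalGroup hQ]
  rw [hS, abs_lt] at hatoms
  have h := hspread _ hmem S (by linarith)
  have hsumS : ∑ i ∈ S, Y i 0 ^ 2 = S.card * a ^ 2 := by
    rw [Finset.sum_congr rfl fun i hi => show Y i 0 ^ 2 = a ^ 2 by
      rw [← sq_abs, (Finset.mem_filter.1 hi).2]]
    simp
  have hsum : ∑ i, Y i 0 ^ 2 = S.card * a ^ 2 + ∑ i, noiseSq a (Y i 0) := by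
    rw [← hsumS, Finset.sum_filter, ← Finset.sum_add_distrib]
    refine Finset.sum_congr rfl fun i _ => ?_
    unfold noiseSq
    split_ifs <;> simp
  rw [hsumS, hsum, ← Real.sqrt_sq hδ0, ← Real.sqrt_mul (sq_nonneg _)] at h
  have hZ : 0 ≤ ∑ i, noiseSq a (Y i 0) := Finset.sum_nonneg fun i _ => noiseSq_nonneg a _
  have h2 := (Real.sqrt_le_sqrt_iff (by positivity)).1 h
  have h3 : (n : ℝ) / 4 ≤ S.card * a ^ 2 := by
    calc (n : ℝ) / 4 = (ρ * n / 2) * ((1 / 2) / ρ) := by field_simp; norm_num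
      _ ≤ S.card * a ^ 2 := by
        rw [ha2]
        gcongr
        linarith
  have hδ2 : δ ^ 2 ≤ 1 := pow_le_one₀ hδ0 hδ1
  nlinarith [mul_le_mul_of_nonneg_left h3 (sub_nonneg.2 hδ2),
    mul_nonneg (sub_nonneg.2 hδ2) hZ]

/-- A lower bound for the probability that the planted matrix is not spread. -/
theorem plantedMeasure_not_matrixSpread_ge (h0 : 0 < ρ) (h1 : ρ ≤ 1) (hσ : σ ^ 2 ≤ 1 / 2)
    (hn : 0 < n) {m δ : ℝ} (hδ0 : 0 ≤ δ) (hδ1 : δ < 1) (hm : 1.5 * ρ * n < m) :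
    1 - ENNReal.ofReal (4 / (ρ * n) + σ ^ 2 / ((1 - δ ^ 2) / 4))
      ≤ plantedMeasure n d ρ σ {A | ¬ MatrixSpread m δ A} := by
  set a := 1 / √(ρ / (1 - (1 - ρ) * σ ^ 2)) with ha
  have hprob := isProbabilityMeasure_hiddenMeasure (n := n) (d := d) (σ := σ) h0.le h1
  have hpos : 0 < 1 - (1 - ρ) * σ ^ 2 := by nlinarith [sq_nonneg σ]
  have hδ2 : 0 < (1 - δ ^ 2) / 4 := by nlinarith
  let E₁ : Set (Fin n → Fin d → ℝ) := {Y | ρ * n / 2 ≤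
      |∑ i, atomIndicator a (Y i 0) - ρ * n|}
  let E₂ : Set (Fin n → Fin d → ℝ) := {Y | (1 - δ ^ 2) / 4 * n ≤ ∑ i, noiseSq a (Y i 0)}
  let O : Set (Fin d → Fin d → ℝ) := {Q | Matrix.of Q ∈ Matrix.orthogonalGroup (Fin d) ℝ}
  have hO : haarOrthogonal d O = 1 := by
    rw [← measure_univ (μ := haarOrthogonal d)]
    exact measure_congr (eventuallyEq_univ.2 ae_mem_orthogonalGroup_haarOrthogonal)
  have hE : (hiddenMeasure n d ρ σ) (E₁ ∪ E₂)
      ≤ ENNReal.ofReal (4 / (ρ * n) + σ ^ 2 / ((1 - δ ^ 2) / 4)) := by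
    rw [← ofReal_measureReal]
    exact ENNReal.ofReal_le_ofReal ((measureReal_union_le _ _).trans (add_le_add
      (hiddenMeasure_atoms_le h0 h1 hpos hn) (hiddenMeasure_noise_le h0 h1 hpos hn hδ2)))
  calc 1 - ENNReal.ofReal (4 / (ρ * n) + σ ^ 2 / ((1 - δ ^ 2) / 4))
      ≤ 1 - (hiddenMeasure n d ρ σ) (E₁ ∪ E₂) := tsub_le_tsub_left hE _
    _ ≤ (hiddenMeasure n d ρ σ) (E₁ ∪ E₂)ᶜ := by
        rw [tsub_le_iff_right, add_comm, ← measure_univ (μ := hiddenMeasure n d ρ σ),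
          ← Set.union_compl_self (E₁ ∪ E₂)]
        exact measure_union_le _ _
    _ = ((hiddenMeasure n d ρ σ).prod (haarOrthogonal d)) ((E₁ ∪ E₂)ᶜ ×ˢ O) := by
        rw [Measure.prod_prod, hO, mul_one]
    _ ≤ ((hiddenMeasure n d ρ σ).prod (haarOrthogonal d))
        ((fun (P : (Fin n → Fin d → ℝ) × (Fin d → Fin d → ℝ)) (i : Fin n) (k : Fin d) =>
          ∑ j, P.1 i j * P.2 j k) ⁻¹' {A | ¬ MatrixSpread m δ A}) := by
        refine measure_mono ?_
        rintro ⟨Y, Q⟩ ⟨hY, hQ⟩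
        simp only [Set.compl_union, Set.mem_inter_iff, Set.mem_compl_iff] at hY
        exact not_matrixSpread_mul hQ h0 hσ hδ0 hδ1.le hm (not_le.1 hY.1) (not_le.1 hY.2)
    _ ≤ _ := Measure.le_map_apply measurable_mulMatrix.aemeasurable _

end Hidden

/-! ### Events of probability tending to one -/

theorem tendsto_measure_one_of_ge {Ω : ℕ → Type*} [∀ n, MeasurableSpace (Ω n)]
    {m : ∀ n, Measure (Ω n)} {S : ∀ n, Set (Ω n)} {ε : ℕ → ℝ}
    (hm : ∀ᶠ n in atTop, IsProbabilityMeasure (m n)) (hε : Tendsto ε atTop (𝓝 0))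
    (h : ∀ᶠ n in atTop, 1 - ENNReal.ofReal (ε n) ≤ m n (S n)) :
    Tendsto (fun n => m n (S n)) atTop (𝓝 1) := by
  have h1 : Tendsto (fun n => 1 - ENNReal.ofReal (ε n)) atTop (𝓝 (1 - 0)) := by
    refine ENNReal.Tendsto.sub tendsto_const_nhds ?_ (Or.inl ENNReal.one_ne_top)
    simpa using ENNReal.tendsto_ofReal hε
  rw [tsub_zero] at h1
  refine tendsto_of_tendsto_of_tendsto_of_le_of_le' h1 tendsto_const_nhds h ?_
  filter_upwards [hm] with n hn
  exact prob_le_one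

theorem tendsto_nullMeasure_matrixSpread {d : ℕ → ℕ} {m : ℕ → ℝ} {δ : ℝ}
    (hd : ∀ᶠ n in atTop, 0 < d n ∧ 50 * d n ≤ n) (hm : ∀ᶠ n : ℕ in atTop, 2 * m n ≤ n)
    (hδ : 1 - (1 / 2) ^ 24 ≤ δ) :
    Tendsto (fun n => nullMeasure n (d n) {A | MatrixSpread (m n) δ A}) atTop (𝓝 1) := by
  refine tendsto_measure_one_of_ge (ε := fun n => (9 / 16) ^ n + (Real.exp 1 / 3) ^ n)
    (Eventually.of_forall fun n => inferInstance) ?_ ?_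
  · have he : Real.exp 1 / 3 < 1 := by
      rw [div_lt_one (by norm_num)]
      exact Real.exp_one_lt_d9.trans (by norm_num)
    simpa using (tendsto_pow_atTop_nhds_zero_of_lt_one (by norm_num : (0 : ℝ) ≤ 9 / 16)
      (by norm_num)).add (tendsto_pow_atTop_nhds_zero_of_lt_one (by positivity) he)
  · filter_upwards [hd, hm] with n hdn hmn
    have : NeZero (d n) := ⟨hdn.1.ne'⟩
    have h := nullMeasure_not_matrixSpread_le hdn.2 hmn hδ
    have h2 := ENNReal.ofReal_le_ofReal h
    rw [ofReal_measureReal] at h2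
    rw [tsub_le_iff_right]
    calc (1 : ENNReal) = nullMeasure n (d n)
          ({A | MatrixSpread (m n) δ A} ∪ {A | ¬ MatrixSpread (m n) δ A}) := by
          rw [← measure_univ (μ := nullMeasure n (d n))]
          congr 1
          ext A
          simp [em]
      _ ≤ _ := (measure_union_le _ _).trans (add_le_add_right h2 _)

theorem tendsto_plantedMeasure_not_matrixSpread {d : ℕ → ℕ} {ρ σ m : ℕ → ℝ} {δ : ℝ}
    (hρ : ∀ᶠ n in atTop, 0 < ρ n ∧ ρ n ≤ 1) (hd : ∀ᶠ n in atTop, 0 < d n)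
    (hρn : Tendsto (fun n : ℕ => ρ n * n) atTop atTop)
    (hσ : Tendsto (fun n => σ n ^ 2) atTop (𝓝 0))
    (hm : ∀ᶠ n : ℕ in atTop, 1.5 * ρ n * n < m n) (hδ : δ ∈ Set.Ico (0 : ℝ) 1) :
    Tendsto (fun n => plantedMeasure n (d n) (ρ n) (σ n) {A | ¬ MatrixSpread (m n) δ A})
      atTop (𝓝 1) := by
  refine tendsto_measure_one_of_ge
    (ε := fun n => 4 / (ρ n * n) + σ n ^ 2 / ((1 - δ ^ 2) / 4)) ?_ ?_ ?_
  · filter_upwards [hρ] with n h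
    exact isProbabilityMeasure_plantedMeasure _ _ h.1.le h.2
  · simpa using (hρn.const_div_atTop 4).add (hσ.div_const ((1 - δ ^ 2) / 4))
  · filter_upwards [hρ, hd, hm, hσ.eventually_le_const (by norm_num : (0 : ℝ) < 1 / 2),
      eventually_gt_atTop 0] with n h h2 h3 h4 h5
    have : NeZero (d n) := ⟨h2.ne'⟩
    exact plantedMeasure_not_matrixSpread_ge h.1 h.2 h4 h5 hδ.1 hδ.2 h3

/-! ### Low-degree polynomials cannot distinguish the two distributions -/

/-- The bound on the second moment of the likelihood ratio applies as soon as `(d ρ)²` dominates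
`n D⁴`; the bound `D ≤ d ρ² / 64` is then automatic, as `d ≤ n`. -/
theorem integral_sq_lowDegreeLikelihoodRatio_le_three_of_le {n d D : ℕ} {ρ σ x : ℝ} (hd : 0 < d)
    (hdn : d ≤ n) (h0 : 0 < ρ) (h1 : ρ ≤ 1) (hσ : σ ^ 2 ≤ 1) (hx : 1 ≤ x) (hD : (D : ℝ) ≤ x)
    (h : 4096 * (n : ℝ) * x ^ 4 ≤ (d * ρ) ^ 2) {L : MvPolynomial (Fin n × Fin d) ℝ}
    (hL : IsLowDegreeLikelihoodRatio (nullMeasure n d) (plantedMeasure n d ρ σ) D L) :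
    ∫ A, evalMatrix L A ^ 2 ∂nullMeasure n d ≤ 3 := by
  have : NeZero d := ⟨hd.ne'⟩
  have hd' : (0 : ℝ) < d := by exact_mod_cast hd
  have hdn' : (d : ℝ) ≤ n := by exact_mod_cast hdn
  have hx4 : x ≤ x ^ 4 := le_self_pow₀ hx (by norm_num)
  have hD2 : (D : ℝ) ^ 2 ≤ x ^ 4 := by
    calc (D : ℝ) ^ 2 ≤ x ^ 2 := by gcongr
      _ ≤ x ^ 4 := pow_le_pow_right₀ hx (by norm_num)
  refine integral_sq_lowDegreeLikelihoodRatio_le_three h0 h1 hσ hL ?_ ?_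
  · refine le_of_mul_le_mul_left (a := (d : ℝ)) ?_ hd'
    calc (d : ℝ) * (64 * D) ≤ n * (64 * x ^ 4) := by gcongr; linarith
      _ ≤ 4096 * (n : ℝ) * x ^ 4 := by
          nlinarith [mul_nonneg (hd'.le.trans hdn') (by positivity : 0 ≤ x ^ 4)]
      _ ≤ _ := h.trans (le_of_eq (by ring))
  · calc 2048 * (n : ℝ) * D ^ 2 ≤ 4096 * n * x ^ 4 := by gcongr; norm_num
      _ ≤ _ := h.trans (le_of_eq (by ring))

theorem sq_integral_mul_le {Ω : Type*} [MeasurableSpace Ω] {m : Measure Ω} {f g : Ω → ℝ}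
    (hf : Integrable (fun x => f x ^ 2) m) (hg : Integrable (fun x => g x ^ 2) m)
    (hfg : Integrable (fun x => f x * g x) m) :
    (∫ x, f x * g x ∂m) ^ 2 ≤ (∫ x, f x ^ 2 ∂m) * ∫ x, g x ^ 2 ∂m := by
  have h : ∀ t : ℝ, 0 ≤ (∫ x, g x ^ 2 ∂m) * (t * t) + (2 * ∫ x, f x * g x ∂m) * t
      + ∫ x, f x ^ 2 ∂m := by
    intro t
    calc 0 ≤ ∫ x, (f x + t * g x) ^ 2 ∂m := integral_nonneg fun x => sq_nonneg _
      _ = ∫ x, (t * t * g x ^ 2 + 2 * t * (f x * g x)) + f x ^ 2 ∂m := by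
          congr 1; ext x; ring
      _ = _ := by
          have h1 := hg.const_mul (t * t)
          have h2 := hfg.const_mul (2 * t)
          rw [integral_add (f := fun x => t * t * g x ^ 2 + 2 * t * (f x * g x)) (h1.add h2) hf,
            integral_add h1 h2, integral_const_mul, integral_const_mul]
          ring
  have := discrim_le_zero h
  unfold discrim at this
  nlinarith

/-- By Cauchy–Schwarz, the second moment of the low-degree likelihood ratio controls the advantage
of every low-degree polynomial. -/
theorem IsLowDegreeLikelihoodRatio.integral_sub_integral_le {n d D : ℕ}
    {ν μ : Measure (Fin n → Fin d → ℝ)} [IsProbabilityMeasure ν] [IsProbabilityMeasure μ]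
    (hν : ∀ p : MvPolynomial (Fin n × Fin d) ℝ, HasAllMoments (fun A => evalMatrix p A) ν)
    {L : MvPolynomial (Fin n × Fin d) ℝ} (hL : IsLowDegreeLikelihoodRatio ν μ D L)
    {p : MvPolynomial (Fin n × Fin d) ℝ} (hp : p.totalDegree ≤ D) :
    ∫ A, evalMatrix p A ∂ν - ∫ A, evalMatrix p A ∂μ
      ≤ √(∫ A, evalMatrix L A ^ 2 ∂ν) * √(variance (fun A => evalMatrix p A) ν) := by
  set c := ∫ A, evalMatrix p A ∂ν with hc
  have heval : ∀ A, evalMatrix (p - MvPolynomial.C c) A = evalMatrix p A - c := fun A => by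
    simp [evalMatrix]
  have h1 := hL.integral_eq (p - MvPolynomial.C c)
    ((MvPolynomial.totalDegree_sub_C_le _ _).trans hp)
  have h2 : ∫ A, evalMatrix (p - MvPolynomial.C c) A ∂μ = ∫ A, evalMatrix p A ∂μ - c := by
    simp_rw [heval]
    rw [integral_sub (hL.integrable_planted p hp) (integrable_const _)]
    simp
  have h3 : variance (fun A => evalMatrix p A) ν
      = ∫ A, evalMatrix (p - MvPolynomial.C c) A ^ 2 ∂ν := by
    rw [variance_eq_integral (hν p).integrable.aemeasurable]
    simp_rw [heval]
    rfl
  have hCS := sq_integral_mul_le ((hν L).pow 2).integrable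
    ((hν (p - MvPolynomial.C c)).pow 2).integrable
    ((hν L).mul (hν (p - MvPolynomial.C c))).integrable
  rw [h1, h2, ← h3] at hCS
  rw [← Real.sqrt_mul (integral_nonneg fun A => sq_nonneg _)]
  have := Real.abs_le_sqrt hCS
  linarith [neg_abs_le (∫ A, evalMatrix p A ∂μ - c)]

/-! ### Choice of parameters -/

theorem tendsto_log_natCast : Tendsto (fun n : ℕ => Real.log n) atTop atTop :=
  Real.tendsto_log_atTop.comp tendsto_natCast_atTop_atTop

/-- With planting density `ρ = d / (α² n ℓ)`, where `ℓ` plays the role of `log n`, the two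
assumptions on `n`, with `ℓ x²` for the polylogarithmic factor, give everything that the bounds for
the null and the planted distribution need. -/
theorem sparsity_bounds {n d : ℕ} {α ℓ x : ℝ} (hn : 0 < n) (hα : α ∈ Set.Ioo (0 : ℝ) 1)
    (hℓ : 4096 ≤ ℓ) (hx : 1 ≤ x) (hs : (d : ℝ) / α ^ 2 ≤ n / (ℓ * x ^ 2))
    (hy : (n : ℝ) ≤ ((d : ℝ) / α) ^ (4 / 3 : ℝ) / (ℓ * x ^ 2)) :
    0 < d ∧ 50 * d ≤ n ∧ 0 < (d : ℝ) / α ^ 2 / (n * ℓ) ∧ (d : ℝ) / α ^ 2 / (n * ℓ) ≤ 1 ∧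
      4096 * (n : ℝ) * x ^ 4 ≤ (d * ((d : ℝ) / α ^ 2 / (n * ℓ))) ^ 2 ∧
      √n ≤ (d : ℝ) / α ^ 2 ∧ ℓ * ((d : ℝ) / α ^ 2) ≤ n := by
  obtain ⟨hα0, hα1⟩ := hα
  have hn' : (1 : ℝ) ≤ n := by exact_mod_cast hn
  have hℓ0 : 0 < ℓ := by linarith
  have hx0 : 0 < x := by linarith
  have hx2 : 1 ≤ x ^ 2 := one_le_pow₀ hx
  set y := (d : ℝ) / α with hyd
  set s := (d : ℝ) / α ^ 2 with hsd
  have hy0 : 0 ≤ y := by positivity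
  have hs0 : 0 ≤ s := by positivity
  have hdy : (d : ℝ) ≤ y := by
    rw [hyd, le_div_iff₀ hα0]
    exact mul_le_of_le_one_right (by positivity) hα1.le
  have hys : y ≤ s := by
    have : s = y / α := by rw [hsd, hyd, div_div, sq]
    rw [this, le_div_iff₀ hα0]
    exact mul_le_of_le_one_right hy0 hα1.le
  have hds : (d : ℝ) * s = y ^ 2 := by rw [hsd, hyd]; field_simp
  rw [le_div_iff₀ (by positivity)] at hs hy
  -- The upper bound on `n`, raised to the third power, is the form in which it is used throughout.
  have hy4 : ((n : ℝ) * (ℓ * x ^ 2)) ^ 3 ≤ y ^ 4 := by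
    calc ((n : ℝ) * (ℓ * x ^ 2)) ^ 3 ≤ (y ^ (4 / 3 : ℝ)) ^ 3 := by gcongr
      _ = y ^ 4 := by
          rw [← Real.rpow_natCast, ← Real.rpow_mul hy0, ← Real.rpow_natCast]
          norm_num
  have hn4 : (n : ℝ) ^ 2 ≤ y ^ 4 := by
    refine le_trans ?_ hy4
    calc (n : ℝ) ^ 2 ≤ (n : ℝ) ^ 3 := pow_le_pow_right₀ hn' (by norm_num)
      _ ≤ _ := by
        gcongr
        exact le_mul_of_one_le_right (by positivity)
          (one_le_mul_of_one_le_of_one_le (by linarith) hx2)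
  have hny : (n : ℝ) ≤ y ^ 2 := by
    refine (sq_le_sq₀ (by positivity) (by positivity)).1 (hn4.trans (le_of_eq (by ring)))
  have hy1 : 0 < y := by
    rcases hy0.eq_or_lt with h | h
    · rw [← h] at hny; norm_num at hny; linarith
    · exact h
  have hd : 0 < d := by
    rcases Nat.eq_zero_or_pos d with h | h
    · rw [hyd, h] at hy1; simp at hy1
    · exact h
  have hℓs : ℓ * s ≤ n := by
    refine le_trans ?_ hs
    rw [mul_comm]
    exact mul_le_mul_of_nonneg_left (le_mul_of_one_le_right hℓ0.le hx2) hs0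
  refine ⟨hd, ?_, by positivity, ?_, ?_, ?_, hℓs⟩
  · have : (50 : ℝ) * d ≤ n := by nlinarith
    exact_mod_cast this
  · rw [div_le_one (by positivity)]
    nlinarith
  · rw [mul_div_assoc', hds, div_pow, le_div_iff₀ (by positivity)]
    calc 4096 * (n : ℝ) * x ^ 4 * (n * ℓ) ^ 2 ≤ ℓ * n * (x ^ 4 * x ^ 2) * (n * ℓ) ^ 2 := by
          gcongr
          exact le_mul_of_one_le_right (by positivity) hx2
      _ = (n * (ℓ * x ^ 2)) ^ 3 := by ring
      _ ≤ y ^ 4 := hy4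
      _ = (y ^ 2) ^ 2 := by ring
  · exact (Real.sqrt_le_left hy0).2 hny |>.trans hys

theorem mainTheorem3 :
    -- Hardness for the hidden noisy Bernoulli–Rademacher direction.
    (∃ c₁ ∈ Set.Ioo (0 : ℝ) 1, ∃ c₂ ∈ Set.Ioo (0 : ℝ) 1, ∃ c₃ ∈ Set.Ioo (0 : ℝ) 1,
      ∃ C₄ : ℝ, 1 < C₄ ∧ ∃ K : ℝ, ∀ C : ℝ, 1 < C →
      ∀ (ρ σ m : ℕ → ℝ) (d D : ℕ → ℕ) (δ : ℝ), δ ∈ Set.Ioo c₂ 1 →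
        (∀ᶠ n in atTop, ρ n ∈ Set.Ioo (0 : ℝ) 1) →
        Tendsto (fun n : ℕ => ρ n * n) atTop atTop →
        (∀ᶠ n in atTop, σ n ∈ Set.Ico 0 (1 / Real.sqrt (1 - ρ n))) →
        (∀ᶠ n : ℕ in atTop, σ n ^ 2 ≤ 1 / 2 * (Real.log n) ^ (-C)) →
        (∀ᶠ n : ℕ in atTop, (d n : ℝ) ∈
          Set.Icc (C₄ * (ρ n)⁻¹ * Real.sqrt n * (Real.log n) ^ (2 * C)) (c₃ * n)) →
        (∀ᶠ n : ℕ in atTop, m n ∈ Set.Ioo (1.5 * ρ n * n) (c₁ * n)) →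
        (∀ᶠ n : ℕ in atTop, (D n : ℝ) ≤ (Real.log n) ^ C) →
        Tendsto (fun n => nullMeasure n (d n) {A | MatrixSpread (m n) δ A}) atTop (𝓝 1) ∧
        Tendsto (fun n => plantedMeasure n (d n) (ρ n) (σ n)
          {A | ¬ MatrixSpread (m n) δ A}) atTop (𝓝 1) ∧
        ∀ᶠ n in atTop,
          (∃ L, IsLowDegreeLikelihoodRatio (nullMeasure n (d n))
            (plantedMeasure n (d n) (ρ n) (σ n)) (D n) L) ∧
          ∀ L, IsLowDegreeLikelihoodRatio (nullMeasure n (d n))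
              (plantedMeasure n (d n) (ρ n) (σ n)) (D n) L →
            ∫ A, evalMatrix L A ^ 2 ∂(nullMeasure n (d n)) ≤ K) ∧
    -- The resulting lower bound against low-degree polynomials.
    (∃ δ₀ ∈ Set.Ioo (0 : ℝ) 1, ∃ K : ℝ, ∀ C : ℝ, 1 < C → ∃ q : ℝ, 0 < q ∧
      ∀ (α : ℕ → ℝ) (d t : ℕ → ℕ) (B : ℝ),
        (∀ᶠ n in atTop, α n ∈ Set.Ioo (0 : ℝ) 1) →
        (∀ᶠ n : ℕ in atTop, (d n : ℝ) / α n ^ 2 ≤ n / (Real.log n) ^ q) →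
        (∀ᶠ n : ℕ in atTop,
          (n : ℝ) ≤ ((d n : ℝ) / α n) ^ (4 / 3 : ℝ) / (Real.log n) ^ q) →
        (∀ᶠ n : ℕ in atTop, (t n : ℝ) ≤ B * (Real.log n) ^ C) →
        ∃ μ : ∀ n : ℕ, Measure (Fin n → Fin (d n) → ℝ),
          (∀ n, IsProbabilityMeasure (μ n)) ∧
          (∀ κ : ℝ, 0 < κ → Tendsto (fun n => nullMeasure n (d n)
            {A | MatrixSpread (κ * (d n / α n ^ 2)) δ₀ A}) atTop (𝓝 1)) ∧
          (∀ κ : ℝ, 0 < κ → ∀ δ ∈ Set.Ioo (0 : ℝ) 1, Tendsto (fun n => μ n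
            {A | ¬ MatrixSpread (κ * (d n / α n ^ 2)) δ A}) atTop (𝓝 1)) ∧
          ∀ᶠ n in atTop, ∀ p : MvPolynomial (Fin n × Fin (d n)) ℝ, p.totalDegree ≤ t n →
            Integrable (fun A => evalMatrix p A) (μ n) ∧
            ∫ A, evalMatrix p A ∂(nullMeasure n (d n)) - ∫ A, evalMatrix p A ∂(μ n)
              ≤ K * Real.sqrt (variance (fun A => evalMatrix p A) (nullMeasure n (d n)))) := by
  refine ⟨⟨1 / 2, by norm_num, 1 - (1 / 2) ^ 24, by norm_num, 1 / 50, by norm_num, 64,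
    by norm_num, 3, ?_⟩, 1 - (1 / 2) ^ 24, by norm_num, 2, ?_⟩
  · intro C hC ρ σ m d D δ hδ hρ hρn hσ0 hσ hd hm hD
    have hlog := tendsto_log_natCast.eventually_ge_atTop 1
    have hbounds : ∀ᶠ n : ℕ in atTop, 0 < d n ∧ 50 * d n ≤ n ∧
        1 ≤ (Real.log n) ^ C ∧ 4096 * (n : ℝ) * ((Real.log n) ^ C) ^ 4 ≤ (d n * ρ n) ^ 2 := by
      filter_upwards [hρ, hd, hlog, eventually_gt_atTop 0] with n hρ hd hlog hn
      have hn' : (0 : ℝ) < n := by exact_mod_cast hn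
      have hx : 1 ≤ (Real.log n) ^ C := Real.one_le_rpow hlog (by linarith)
      have hx2 : (Real.log n) ^ (2 * C) = ((Real.log n) ^ C) ^ 2 := by
        rw [mul_comm, Real.rpow_mul (by linarith), Real.rpow_two]
      rw [hx2] at hd
      set x := (Real.log n) ^ C
      have hρ0 := hρ.1
      refine ⟨?_, ?_, hx, ?_⟩
      · have : (0 : ℝ) < d n := lt_of_lt_of_le (by positivity) hd.1
        exact_mod_cast this
      · have : (50 : ℝ) * d n ≤ n := by linarith [hd.2]
        exact_mod_cast this
      -- Here `4096` is the square of the constant `C₄ = 64`.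
      · calc 4096 * (n : ℝ) * x ^ 4 = (64 * √n * x ^ 2) ^ 2 := by
              rw [mul_pow, mul_pow, Real.sq_sqrt hn'.le]; ring
          _ = (64 * (ρ n)⁻¹ * √n * x ^ 2 * ρ n) ^ 2 := by field_simp
          _ ≤ (d n * ρ n) ^ 2 := by
              gcongr
              exact hd.1
    have hσ' : Tendsto (fun n => σ n ^ 2) atTop (𝓝 0) := by
      refine squeeze_zero' (Eventually.of_forall fun n => sq_nonneg _) hσ ?_
      have h := ((tendsto_rpow_neg_atTop (by linarith : 0 < C)).comp
        tendsto_log_natCast).const_mul (1 / 2)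
      rwa [mul_zero] at h
    refine ⟨tendsto_nullMeasure_matrixSpread (hbounds.mono fun n h => ⟨h.1, h.2.1⟩)
        (hm.mono fun n h => by linarith [h.2]) hδ.1.le,
      tendsto_plantedMeasure_not_matrixSpread (hρ.mono fun n h => ⟨h.1, h.2.le⟩)
        (hbounds.mono fun n h => h.1) hρn hσ' (hm.mono fun n h => h.1)
        ⟨le_trans (by norm_num) hδ.1.le, hδ.2⟩, ?_⟩
    filter_upwards [hρ, hbounds, hD, hσ'.eventually_le_const zero_lt_one]
      with n hρ hb hD hσ
    have : NeZero (d n) := ⟨hb.1.ne'⟩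
    exact ⟨exists_isLowDegreeLikelihoodRatio_plantedMeasure hρ.1.le hρ.2.le (D n), fun L hL =>
      integral_sq_lowDegreeLikelihoodRatio_le_three_of_le hb.1 (by linarith [hb.2.1]) hρ.1 hρ.2.le
        hσ hb.2.2.1 hD hb.2.2.2 hL⟩
  · intro C hC
    -- The polylogarithmic factor is `ℓ x²`, where `ℓ = log n` and where `x = ℓ ^ (C + 1)` bounds
    -- the degree `t`.
    refine ⟨1 + 2 * (C + 1), by linarith, ?_⟩
    intro α d t B hα hs hy ht
    let ρ : ℕ → ℝ := fun n => (d n : ℝ) / α n ^ 2 / (n * Real.log n)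
    have hlog : ∀ c : ℝ, ∀ᶠ n : ℕ in atTop, c ≤ Real.log n := fun c =>
      tendsto_log_natCast.eventually_ge_atTop c
    have hb : ∀ᶠ n : ℕ in atTop, 0 < d n ∧ 50 * d n ≤ n ∧ 0 < ρ n ∧ ρ n ≤ 1 ∧
        4096 * (n : ℝ) * ((Real.log n) ^ (C + 1)) ^ 4 ≤ (d n * ρ n) ^ 2 ∧
        √n ≤ (d n : ℝ) / α n ^ 2 ∧ Real.log n * ((d n : ℝ) / α n ^ 2) ≤ n := by
      filter_upwards [hα, hs, hy, hlog 4096, eventually_gt_atTop 0] with n hα hs hy hl hn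
      have e : (Real.log n) ^ (1 + 2 * (C + 1)) = Real.log n * ((Real.log n) ^ (C + 1)) ^ 2 := by
        rw [Real.rpow_add (by linarith), Real.rpow_one, mul_comm 2, Real.rpow_mul (by linarith),
          Real.rpow_two]
      rw [e] at hs hy
      exact sparsity_bounds hn hα hl (Real.one_le_rpow (by linarith) (by linarith)) hs hy
    have hρn : ∀ᶠ n : ℕ in atTop, ρ n * n = (d n : ℝ) / α n ^ 2 / Real.log n := by
      filter_upwards [eventually_gt_atTop 0, hlog 1] with n hn hl
      have hn' : (n : ℝ) ≠ 0 := by exact_mod_cast hn.ne'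
      simp only [ρ]
      field_simp
    have hρ_top : Tendsto (fun n : ℕ => ρ n * n) atTop atTop := by
      have h : Tendsto (fun n : ℕ => √(n : ℝ) / Real.log n) atTop atTop := by
        have h0 : Tendsto (fun n : ℕ => Real.log n / √(n : ℝ)) atTop (𝓝 0) := by
          have := (isLittleO_log_rpow_atTop (r := 1 / 2) (by norm_num)).tendsto_div_nhds_zero.comp
            (tendsto_natCast_atTop_atTop (R := ℝ))
          simpa only [Real.sqrt_eq_rpow, Function.comp_def] using this
        have h1 : Tendsto (fun n : ℕ => Real.log n / √(n : ℝ)) atTop (𝓝[>] 0) := by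
          refine tendsto_nhdsWithin_iff.2 ⟨h0, ?_⟩
          filter_upwards [eventually_gt_atTop 0, hlog 1] with n hn hl
          have hn' : (0 : ℝ) < n := by exact_mod_cast hn
          exact div_pos (by linarith) (Real.sqrt_pos.2 hn')
        refine h1.inv_tendsto_nhdsGT_zero.congr fun n => ?_
        rw [Pi.inv_apply, inv_div]
      refine tendsto_atTop_mono' atTop ?_ h
      filter_upwards [hρn, hb, hlog 1] with n h1 h2 hl
      rw [h1]
      have := h2.2.2.2.2.2.1
      gcongr
    -- The value of `D₁` at the finitely many `n` with a density outside `[0, 1]` is irrelevant.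
    let μ : ∀ n : ℕ, Measure (Fin n → Fin (d n) → ℝ) := fun n =>
      open Classical in
      if 0 ≤ ρ n ∧ ρ n ≤ 1 then plantedMeasure n (d n) (ρ n) 0 else nullMeasure n (d n)
    have hμ : ∀ᶠ n in atTop, μ n = plantedMeasure n (d n) (ρ n) 0 := by
      filter_upwards [hb] with n h
      exact if_pos ⟨h.2.2.1.le, h.2.2.2.1⟩
    have hμprob : ∀ n, IsProbabilityMeasure (μ n) := by
      intro n
      simp only [μ]
      split_ifs with h
      · exact isProbabilityMeasure_plantedMeasure _ _ h.1 h.2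
      · infer_instance
    refine ⟨μ, hμprob, fun κ hκ => ?_, fun κ hκ δ hδ => ?_, ?_⟩
    · refine tendsto_nullMeasure_matrixSpread (hb.mono fun n h => ⟨h.1, h.2.1⟩) ?_ le_rfl
      filter_upwards [hb, hlog (2 * κ)] with n h hl
      refine le_trans ?_ h.2.2.2.2.2.2
      rw [← mul_assoc]
      gcongr
    · have h := tendsto_plantedMeasure_not_matrixSpread (σ := fun _ => 0) (δ := δ)
        (m := fun n => κ * (d n / α n ^ 2)) (hb.mono fun n h => ⟨h.2.2.1, h.2.2.2.1⟩)
        (hb.mono fun n h => h.1) hρ_top (by simp) ?_ ⟨hδ.1.le, hδ.2⟩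
      · refine h.congr' ?_
        filter_upwards [hμ] with n hn
        rw [hn]
      · filter_upwards [hb, hρn, hlog (2 / κ), hlog 1, eventually_gt_atTop 0]
          with n h h1 hl hl1 hn
        have hn' : (0 : ℝ) < √n := Real.sqrt_pos.2 (by exact_mod_cast hn)
        have hs0 : 0 < (d n : ℝ) / α n ^ 2 := hn'.trans_le h.2.2.2.2.2.1
        rw [mul_assoc, h1, mul_div_assoc', div_lt_iff₀ (by linarith)]
        rw [div_le_iff₀ hκ] at hl
        nlinarith
    · filter_upwards [hb, hμ, ht, hlog B, hlog 1] with n hb hμ ht hB hl p hp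
      have : NeZero (d n) := ⟨hb.1.ne'⟩
      have hprob := hμprob n
      rw [hμ] at hprob ⊢
      refine ⟨(hasAllMoments_evalMatrix_plantedMeasure hb.2.2.1.le hb.2.2.2.1 p).integrable, ?_⟩
      obtain ⟨L, hL⟩ := exists_isLowDegreeLikelihoodRatio_plantedMeasure (n := n) (d := d n)
        (σ := 0) hb.2.2.1.le hb.2.2.2.1 (t n)
      have ht' : (t n : ℝ) ≤ (Real.log n) ^ (C + 1) := by
        refine ht.trans ?_
        rw [Real.rpow_add (by linarith), Real.rpow_one, mul_comm]
        gcongr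
      have hK := integral_sq_lowDegreeLikelihoodRatio_le_three_of_le hb.1 (by linarith [hb.2.1])
        hb.2.2.1 hb.2.2.2.1 (by norm_num) (Real.one_le_rpow hl (by linarith)) ht' hb.2.2.2.2.1 hL
      refine (hL.integral_sub_integral_le hasAllMoments_evalMatrix_nullMeasure hp).trans ?_
      gcongr
      rw [Real.sqrt_le_left (by norm_num)]
      linarith
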